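/- Let $N\ge 1$, let $\Omega\subseteq\mathbb R^N$ be a bounded open set, let $0<\alpha<\beta$, $b>0$, $c>0$ and $\lambda,\mu\in\mathbb R$, and consider the Kirchhoff equation with homogeneous Dirichlet boundary conditions $$u_{tt}-\Delta u-b\,\|\nabla u\|^{\beta}\Delta u+c\,\|u_t\|^{\alpha}u_t-\lambda u-\mu u_t=h,\qquad (K)$$ where $\|\cdot\|$ is the norm of $L^2(\Omega)$ (of $L^2(\Omega;\mathbb R^N)$ for gradients), taken at time $t$. *Solutions.* A strong solution of (K) on a bounded open interval $J$, with forcing term $h\in L^1(J;L^2(\Omega))$, is a function $u\in W^{1,\infty}(J;H^1_0(\Omega))\cap W^{2,1}(J;H^{-1}(\Omega))$ for which (K) holds as an equality in $L^1(J;H^{-1}(\Omega))$. A weak solution of (K) on an open interval $I$ is a function $u\in C^0(I;H^1_0(\Omega))\cap C^1(I;L^2(\Omega))$ that, on every compact interval $[s,t]\subseteq I$, is a limit of strong solutions: there are $h_n$ and strong solutions $u_n$ on $(s,t)$ with forcing terms $h_n$ such that $u_n\to u$ in $C^0([s,t];H^1_0(\Omega))$, $\partial_tu_n\to u_t$ in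 $C^0([s,t];L^2(\Omega))$ and $h_n\to h$ in $L^1((s,t);L^2(\Omega))$. (1) Set $$\gamma:=\min\left\{\frac{\alpha}{2},\ \frac{\beta-\alpha}{(\alpha+1)(\beta+2)}\right\}.$$ For every $M$ there exist real numbers $\Gamma$ and $\Gamma_*$, depending only on $M$, $\Omega$, $\alpha,\beta,b,c,\lambda,\mu$, such that for every $T>0$ and every $h\in L^\infty((0,T);L^2(\Omega))$ with $\|h(t)\|\le M$ for almost every $t\in(0,T)$, any weak solution $u$ of (K) on $(0,T)$ satisfies $$\|u_t(t)\|^2+\|\nabla u(t)\|^{\beta+2}\le\Gamma\,t^{-1/\gamma}+\Gamma_*\qquad\forall t\in(0,T).$$ (2) Assume that $\mu=0$, $h\equiv0$ and $\lambda<\lambda_1(\Omega)$, where $\lambda_1(\Omega)$ is the first eigenvalue of the Dirichlet Laplacian in $\Omega$. Then there exists a real number $D$, depending only on $\Omega$, $\alpha,\beta,b,c,\lambda$, such that any weak solution $u$ of (K) on $(0,+\infty)$ satisfies $$\|u_t(t)\|^2+\|\nabla u(t)\|^2\le D\,t^{-2/\alpha}\qquad\forall t\ge1.$$ -/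

import Mathlib

open MeasureTheory Set
open scoped ContDiff RealInnerProductSpace Gradient

noncomputable section

namespace Kirchhoff

/-- The Euclidean space `ℝ^N`. -/
abbrev Eucl (N : ℕ) : Type := EuclideanSpace ℝ (Fin N)

/-- The space `L²(Ω)` of real-valued functions. -/
abbrev L2 {N : ℕ} (Ω : Set (Eucl N)) : Type :=
  Lp ℝ 2 (volume.restrict Ω)

/-- The space `L²(Ω; ℝ^N)` of vector fields. -/
abbrev L2Vec {N : ℕ} (Ω : Set (Eucl N)) : Type :=
  Lp (Eucl N) 2 (volume.restrict Ω)

/-- The pairs `(φ, ∇φ)`, with `φ` a smooth function compactly supported in `Ω`, as a linear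
subspace of the Hilbert space `L²(Ω) × L²(Ω; ℝ^N)`. -/
def testGraph {N : ℕ} (Ω : Set (Eucl N)) : Submodule ℝ (WithLp 2 (L2 Ω × L2Vec Ω)) where
  carrier := {p | ∃ φ : Eucl N → ℝ, ContDiff ℝ ∞ φ ∧ HasCompactSupport φ ∧ tsupport φ ⊆ Ω ∧
    p.fst =ᵐ[volume.restrict Ω] φ ∧ p.snd =ᵐ[volume.restrict Ω] fun x => ∇ φ x}
  zero_mem' := by
    refine ⟨fun _ => 0, contDiff_const, HasCompactSupport.zero, ?_, ?_, ?_⟩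
    · simp [tsupport]
    · exact Lp.coeFn_zero ℝ 2 (volume.restrict Ω)
    · filter_upwards [Lp.coeFn_zero (Eucl N) 2 (volume.restrict Ω)] with x hx
      simp [gradient]
      simpa using hx
  add_mem' := by
    rintro p q ⟨φ, hφ, hφc, hφs, hp1, hp2⟩ ⟨ψ, hψ, hψc, hψs, hq1, hq2⟩
    refine ⟨fun x => φ x + ψ x, hφ.add hψ, hφc.add hψc, ?_, ?_, ?_⟩
    · exact (tsupport_add φ ψ).trans (union_subset hφs hψs)
    · filter_upwards [Lp.coeFn_add p.fst q.fst, hp1, hq1] with x hx h1 h2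
      simp only [WithLp.add_fst]
      rw [hx, Pi.add_apply, h1, h2]
    · filter_upwards [Lp.coeFn_add p.snd q.snd, hp2, hq2] with x hx h1 h2
      have e : fderiv ℝ (fun x => φ x + ψ x) x = fderiv ℝ φ x + fderiv ℝ ψ x :=
        fderiv_fun_add (hφ.differentiable (by simp) x) (hψ.differentiable (by simp) x)
      simp only [WithLp.add_snd]
      rw [hx, Pi.add_apply, h1, h2]
      simp only [gradient, e, map_add]
  smul_mem' := by
    rintro a p ⟨φ, hφ, hφc, hφs, hp1, hp2⟩
    refine ⟨fun x => a * φ x, contDiff_const.mul hφ, hφc.mul_left, ?_, ?_, ?_⟩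
    · exact (tsupport_mul_subset_right (f := fun _ => a) (g := φ)).trans hφs
    · filter_upwards [Lp.coeFn_smul a p.fst, hp1] with x hx h1
      simp only [WithLp.smul_fst]
      rw [hx, Pi.smul_apply, h1, smul_eq_mul]
    · filter_upwards [Lp.coeFn_smul a p.snd, hp2] with x hx h1
      have e : fderiv ℝ (fun x => a * φ x) x = a • fderiv ℝ φ x :=
        fderiv_const_mul (hφ.differentiable (by simp) x) a
      simp only [WithLp.smul_snd]
      rw [hx, Pi.smul_apply, h1]
      simp [gradient, e]

/-- The Sobolev space `H¹₀(Ω)`: the closure of the smooth compactly supported functions in the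
norm `(‖u‖² + ‖∇u‖²)^(1/2)`. An element is recorded together with its weak gradient. -/
def H10 {N : ℕ} (Ω : Set (Eucl N)) : Type := (testGraph Ω).topologicalClosure

instance {N : ℕ} (Ω : Set (Eucl N)) : NormedAddCommGroup (H10 Ω) :=
  inferInstanceAs (NormedAddCommGroup (testGraph Ω).topologicalClosure)

instance {N : ℕ} (Ω : Set (Eucl N)) : InnerProductSpace ℝ (H10 Ω) :=
  inferInstanceAs (InnerProductSpace ℝ (testGraph Ω).topologicalClosure)

instance {N : ℕ} (Ω : Set (Eucl N)) : CompleteSpace (H10 Ω) :=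
  inferInstanceAs (CompleteSpace (testGraph Ω).topologicalClosure)

/-- The pair `(u, ∇u)` attached to an element `u` of `H¹₀(Ω)`. -/
def inclH10 {N : ℕ} (Ω : Set (Eucl N)) : H10 Ω →L[ℝ] WithLp 2 (L2 Ω × L2Vec Ω) :=
  (testGraph Ω).topologicalClosure.subtypeL

/-- The imbedding `H¹₀(Ω) → L²(Ω)`. -/
def toL2 {N : ℕ} (Ω : Set (Eucl N)) : H10 Ω →L[ℝ] L2 Ω :=
  (WithLp.fstL 2 ℝ (L2 Ω) (L2Vec Ω)).comp (inclH10 Ω)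

/-- The weak gradient `H¹₀(Ω) → L²(Ω; ℝ^N)`. -/
def grad {N : ℕ} (Ω : Set (Eucl N)) : H10 Ω →L[ℝ] L2Vec Ω :=
  (WithLp.sndL 2 ℝ (L2 Ω) (L2Vec Ω)).comp (inclH10 Ω)

/-- The dual space `H⁻¹(Ω)` of `H¹₀(Ω)`. -/
abbrev HNeg1 {N : ℕ} (Ω : Set (Eucl N)) : Type := H10 Ω →L[ℝ] ℝ

/-- The imbedding `L²(Ω) → H⁻¹(Ω)`, `f ↦ (φ ↦ ∫ f φ)`. -/
def toHNeg1 {N : ℕ} (Ω : Set (Eucl N)) (f : L2 Ω) : HNeg1 Ω :=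
  (innerSL ℝ f).comp (toL2 Ω)

/-- `κ` is an eigenvalue of the Dirichlet Laplacian in `Ω`: there is `v ≠ 0` in `H¹₀(Ω)` with
`-Δ v = κ v` in `H⁻¹(Ω)`. -/
def IsDirichletEigenvalue {N : ℕ} (Ω : Set (Eucl N)) (κ : ℝ) : Prop :=
  ∃ v : H10 Ω, v ≠ 0 ∧ ∀ w : H10 Ω, ⟪grad Ω v, grad Ω w⟫ = κ * ⟪toL2 Ω v, toL2 Ω w⟫

/-- The first (smallest) eigenvalue of the Dirichlet Laplacian in `Ω`. -/
def firstEigenvalue {N : ℕ} (Ω : Set (Eucl N)) : ℝ :=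
  sInf {κ : ℝ | IsDirichletEigenvalue Ω κ}

/-- `g` is the weak (distributional) derivative of the vector-valued function `f` on the open
time interval `I`. -/
def HasWeakTimeDeriv {E : Type*} [NormedAddCommGroup E] [NormedSpace ℝ E]
    (I : Set ℝ) (f g : ℝ → E) : Prop :=
  ∀ φ : ℝ → ℝ, ContDiff ℝ ∞ φ → HasCompactSupport φ → tsupport φ ⊆ I →
    ∫ r in I, deriv φ r • f r = -∫ r in I, φ r • g r

/-- Strong solutions, on a bounded open time interval `I`, of
`u_tt - Δu - b ‖∇u‖^β Δu + c ‖u_t‖^α u_t - lam u - mu u_t = h`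
with homogeneous Dirichlet boundary conditions. The function `u` belongs to
`W^{1,∞}(I; H¹₀(Ω)) ∩ W^{2,1}(I; H⁻¹(Ω))`, with `u_t = v` and `u_tt = w`, and the equation is an
equality in `L¹(I; H⁻¹(Ω))`. -/
structure IsStrongSolution {N : ℕ} (Ω : Set (Eucl N)) (α β b c lam mu : ℝ) (I : Set ℝ)
    (h : ℝ → L2 Ω) (u v : ℝ → H10 Ω) : Prop where
  memLp_forcing : MemLp h 1 (volume.restrict I)
  memLp_u : MemLp u ⊤ (volume.restrict I)
  memLp_v : MemLp v ⊤ (volume.restrict I)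
  deriv_u : HasWeakTimeDeriv I u v
  equation : ∃ w : ℝ → HNeg1 Ω, MemLp w 1 (volume.restrict I) ∧
    HasWeakTimeDeriv I (fun r => toHNeg1 Ω (toL2 Ω (v r))) w ∧
    ∀ᵐ r ∂(volume.restrict I), ∀ φ : H10 Ω,
      w r φ + ⟪grad Ω (u r), grad Ω φ⟫
        + b * ‖grad Ω (u r)‖ ^ β * ⟪grad Ω (u r), grad Ω φ⟫
        + c * ‖toL2 Ω (v r)‖ ^ α * ⟪toL2 Ω (v r), toL2 Ω φ⟫
        - lam * ⟪toL2 Ω (u r), toL2 Ω φ⟫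
        - mu * ⟪toL2 Ω (v r), toL2 Ω φ⟫
      = ⟪h r, toL2 Ω φ⟫

/-- The time derivative `u_t`, as a function with values in `L²(Ω)`. -/
def velocity {N : ℕ} {Ω : Set (Eucl N)} (u : ℝ → H10 Ω) (t : ℝ) : L2 Ω :=
  deriv (fun r => toL2 Ω (u r)) t

/-- Weak (finite energy) solutions in the open time interval `I`, bounded or not: functions `u` in
`C⁰(I; H¹₀(Ω)) ∩ C¹(I; L²(Ω))` that, on every compact subinterval `[s, t]` of `I`, are limits of
strong solutions: `u` in `C⁰([s, t]; H¹₀(Ω))`, `u_t` in `C⁰([s, t]; L²(Ω))`, and the forcing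
terms in `L¹((s, t); L²(Ω))`. -/
structure IsWeakSolution {N : ℕ} (Ω : Set (Eucl N)) (α β b c lam mu : ℝ) (I : Set ℝ)
    (h : ℝ → L2 Ω) (u : ℝ → H10 Ω) : Prop where
  continuousOn : ContinuousOn u I
  contDiffOn : ContDiffOn ℝ 1 (fun r => toL2 Ω (u r)) I
  approx : ∀ s t : ℝ, s < t → Icc s t ⊆ I → ∀ ε : ℝ, 0 < ε →
    ∃ (h' : ℝ → L2 Ω) (u' v' : ℝ → H10 Ω),
      IsStrongSolution Ω α β b c lam mu (Ioo s t) h' u' v' ∧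
      (∀ᵐ r ∂(volume.restrict (Ioo s t)),
        ‖u' r - u r‖ ≤ ε ∧ ‖toL2 Ω (v' r) - velocity u r‖ ≤ ε) ∧
      eLpNorm (fun r => h' r - h r) 1 (volume.restrict (Ioo s t)) ≤ ENNReal.ofReal ε

end Kirchhoff

end

/-! With `E` the energy, `E' = -c‖u_t‖^(α+2) + μ‖u_t‖² + ⟪h, u_t⟫`, so the damping controls only the
velocity. The rest of the energy is recovered from the virial `P = ⟪u_t, u⟫`, whose derivative
contains `-‖∇u‖² - b‖∇u‖^(β+2)`. For small `ε`, and after adding a constant to `E` in part (1), the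
modified energy `Φ = E + ε E^γ P` is comparable with `E` and satisfies `Φ' ≤ -κ Φ^(1+γ) + K`. Since
`Φ^(-γ)` then grows at least linearly while `Φ` is large, `Φ(t)` is bounded by a multiple of
`t^(-1/γ)` plus a constant, whatever the initial data (`le_of_deriv_le_neg_rpow`,
`exists_decay_of_lyapunov`).

The two terms in the minimum defining `γ` are what Young's inequality needs to absorb `E^γ ‖u_t‖²`
and `E^γ ‖u_t‖^(α+1) ‖∇u‖` into `E^(1+γ)` and `‖u_t‖^(α+2)` (`exists_lyapunov_constants`).

For (2), part (1) bounds the energy at time `1/2` by a universal constant. On bounded energies, with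
`μ = 0`, `h = 0` and a coercive quadratic part, the same argument works with `γ = α/2` and `K = 0`
(`exists_lyapunov_constants_coercive`), hence decay to zero.

Two supporting facts are needed. The energy and virial identities are proved for strong solutions,
where `u_t` is merely bounded in `H¹₀` with an `L¹` derivative in `H⁻¹`
(`ae_norm_sq_eq_add_integral`), and pass to limits (`IsWeakSolution.identity`). Coercivity below the
first eigenvalue follows from the Rellich theorem, obtained by averaging on small cubes, and from
the spectral theory of compact operators. -/

namespace Kirchhoff

open Filter Topology

/-! ### Absolutely continuous functions and the fundamental theorem of calculus. -/

section Calculus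

variable {F : Type*} [NormedAddCommGroup F] [NormedSpace ℝ F]

/-- A function whose increments are dominated by the integral of an integrable function is
absolutely continuous. -/
theorem absolutelyContinuousOnInterval_of_dist_le {X : Type*} [PseudoMetricSpace X] {f : ℝ → X}
    {ρ : ℝ → ℝ} {a b : ℝ} (hab : a ≤ b) (hρ : IntervalIntegrable ρ volume a b)
    (h : ∀ x ∈ Icc a b, ∀ y ∈ Icc a b, x ≤ y → dist (f x) (f y) ≤ ∫ r in x..y, ρ r) :
    AbsolutelyContinuousOnInterval f a b := by
  have hac := hρ.absolutelyContinuousOnInterval_intervalIntegral (c := a) (by simp)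
  have key : ∀ x ∈ Icc a b, ∀ y ∈ Icc a b,
      dist (f x) (f y) ≤ dist (∫ r in a..x, ρ r) (∫ r in a..y, ρ r) := by
    have hi : ∀ x ∈ Icc a b, IntervalIntegrable ρ volume a x := fun x hx =>
      hρ.mono_set (by rw [uIcc_of_le hab, uIcc_of_le hx.1]; exact Icc_subset_Icc_right hx.2)
    have hle : ∀ x ∈ Icc a b, ∀ y ∈ Icc a b, x ≤ y →
        dist (f x) (f y) ≤ dist (∫ r in a..x, ρ r) (∫ r in a..y, ρ r) := by
      intro x hx y hy hxy
      refine (h x hx y hy hxy).trans ?_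
      rw [dist_comm, Real.dist_eq, intervalIntegral.integral_interval_sub_left (hi y hy) (hi x hx)]
      exact le_abs_self _
    intro x hx y hy
    rcases le_total x y with hxy | hxy
    · exact hle x hx y hy hxy
    · rw [dist_comm, dist_comm (∫ r in a..x, ρ r)]
      exact hle y hy x hx hxy
  rw [absolutelyContinuousOnInterval_iff] at hac ⊢
  intro ε hε
  obtain ⟨δ, hδ, H⟩ := hac ε hε
  refine ⟨δ, hδ, fun E hE hE' => lt_of_le_of_lt (Finset.sum_le_sum fun i hi => ?_) (H E hE hE')⟩
  have := hE.1 i hi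
  rw [uIcc_of_le hab] at this
  exact key _ this.1 _ this.2

theorem absolutelyContinuousOnInterval_integral [CompleteSpace F] {g : ℝ → F} {a b : ℝ}
    (hab : a ≤ b) (hg : IntervalIntegrable g volume a b) :
    AbsolutelyContinuousOnInterval (fun x => ∫ r in a..x, g r) a b := by
  have hi : ∀ x ∈ Icc a b, IntervalIntegrable g volume a x := fun x hx =>
    hg.mono_set (by rw [uIcc_of_le hab, uIcc_of_le hx.1]; exact Icc_subset_Icc_right hx.2)
  refine absolutelyContinuousOnInterval_of_dist_le hab hg.norm fun x hx y hy hxy => ?_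
  rw [dist_comm, dist_eq_norm, intervalIntegral.integral_interval_sub_left (hi y hy) (hi x hx)]
  exact intervalIntegral.norm_integral_le_integral_norm hxy

/-- The fundamental theorem of calculus for absolutely continuous functions with an integrable
derivative almost everywhere. -/
theorem eq_add_integral_of_ac [CompleteSpace F] {f g : ℝ → F} {a b : ℝ} (hab : a ≤ b)
    (hf : AbsolutelyContinuousOnInterval f a b) (hg : IntervalIntegrable g volume a b)
    (hd : ∀ᵐ x, x ∈ Ioo a b → HasDerivAt f (g x) x) :
    ∀ x ∈ Icc a b, f x = f a + ∫ r in a..x, g r := by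
  have hac := hf.sub (absolutelyContinuousOnInterval_integral hab hg)
  obtain ⟨C, hC⟩ := hac.const_of_ae_hasDerivAt_zero (by
    have h₁ : ∀ᵐ x : ℝ, x ≠ a := by simp [ae_iff, measure_singleton]
    have h₂ : ∀ᵐ x : ℝ, x ≠ b := by simp [ae_iff, measure_singleton]
    filter_upwards [hd, hg.ae_hasDerivAt_integral, h₁, h₂] with x hx hx' h1 h2 hxI
    have hxI' := hxI
    rw [uIcc_of_le hab] at hxI'
    have := (hx ⟨lt_of_le_of_ne hxI'.1 (Ne.symm h1), lt_of_le_of_ne hxI'.2 h2⟩).sub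
      (hx' hxI a left_mem_uIcc)
    rwa [sub_self] at this)
  rw [uIcc_of_le hab] at hC
  intro x hx
  have h1 := hC x hx
  have h2 := hC a ⟨le_rfl, hab⟩
  simp only [Pi.sub_apply, intervalIntegral.integral_same, sub_zero] at h1 h2
  rw [h2, ← h1]; abel

theorem ac_comp_lipschitzOnWith {f : ℝ → ℝ} {ψ : ℝ → ℝ} {a b : ℝ} {K : NNReal} {s : Set ℝ}
    (hf : AbsolutelyContinuousOnInterval f a b) (hs : MapsTo f (uIcc a b) s)
    (hψ : LipschitzOnWith K ψ s) :
    AbsolutelyContinuousOnInterval (fun x => ψ (f x)) a b := by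
  rw [absolutelyContinuousOnInterval_iff] at hf ⊢
  intro ε hε
  obtain ⟨δ, hδ, H⟩ := hf (ε / (K + 1)) (by positivity)
  refine ⟨δ, hδ, fun E hE hE' => ?_⟩
  have h1 := H E hE hE'
  calc _ ≤ ∑ i ∈ Finset.range E.1, K * dist (f (E.2 i).1) (f (E.2 i).2) := by
        refine Finset.sum_le_sum fun i hi => ?_
        exact hψ.dist_le_mul _ (hs (hE.1 i hi).1) _ (hs (hE.1 i hi).2)
    _ = K * ∑ i ∈ Finset.range E.1, dist (f (E.2 i).1) (f (E.2 i).2) :=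
        (Finset.mul_sum _ _ _).symm
    _ ≤ (K + 1) * ∑ i ∈ Finset.range E.1, dist (f (E.2 i).1) (f (E.2 i).2) := by
        have : 0 ≤ ∑ i ∈ Finset.range E.1, dist (f (E.2 i).1) (f (E.2 i).2) :=
          Finset.sum_nonneg fun _ _ => dist_nonneg
        nlinarith
    _ < (K + 1) * (ε / (K + 1)) := by gcongr
    _ = ε := by field_simp

/-- Composition of an absolutely continuous function with values in a compact interval with a
function of class `C¹` on that interval. -/
theorem ac_comp_contDiffOn {f : ℝ → ℝ} {ψ : ℝ → ℝ} {a b m M : ℝ}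
    (hf : AbsolutelyContinuousOnInterval f a b) (hs : MapsTo f (uIcc a b) (Icc m M))
    (hψ : ContDiffOn ℝ 1 ψ (Icc m M)) :
    AbsolutelyContinuousOnInterval (fun x => ψ (f x)) a b := by
  obtain ⟨K, hK⟩ := hψ.exists_lipschitzOnWith (by decide) (convex_Icc _ _) isCompact_Icc
  exact ac_comp_lipschitzOnWith hf hs hK

end Calculus

/-! ### Vector-valued weak derivatives in one variable. -/

section WeakDerivative

variable {F : Type*} [NormedAddCommGroup F] [NormedSpace ℝ F]

theorem exists_Icc_of_isCompact_subset_Ioo {K : Set ℝ} {a b : ℝ} (hab : a < b) (hK : IsCompact K)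
    (hKab : K ⊆ Ioo a b) : ∃ a' b', a < a' ∧ b' < b ∧ K ⊆ Icc a' b' := by
  -- For empty `K` the reversed pair `a' = b`, `b' = a` is admissible.
  rcases K.eq_empty_or_nonempty with rfl | hne
  · exact ⟨b, a, hab, hab, empty_subset _⟩
  · exact ⟨sInf K, sSup K, (hKab (hK.sInf_mem hne)).1, (hKab (hK.sSup_mem hne)).2,
      fun x hx => ⟨csInf_le hK.bddBelow hx, le_csSup hK.bddAbove hx⟩⟩

/-- A test function with zero mean is the derivative of a test function. -/
theorem exists_primitive_of_integral_eq_zero {θ : ℝ → ℝ} {a b : ℝ} (hab : a < b)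
    (hθ : ContDiff ℝ ∞ θ) (hc : HasCompactSupport θ) (hs : tsupport θ ⊆ Ioo a b)
    (h0 : ∫ x, θ x = 0) :
    ∃ φ : ℝ → ℝ, ContDiff ℝ ∞ φ ∧ HasCompactSupport φ ∧ tsupport φ ⊆ Ioo a b ∧ deriv φ = θ := by
  obtain ⟨a', b', ha', hb', hK⟩ := exists_Icc_of_isCompact_subset_Ioo hab hc hs
  have hsupp : Function.support θ ⊆ Icc a' b' := (subset_tsupport θ).trans hK
  have hd : ∀ x, HasDerivAt (fun x => ∫ r in a..x, θ r) (θ x) x := fun x =>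
    intervalIntegral.integral_hasDerivAt_right (hθ.continuous.intervalIntegrable _ _)
      (hθ.continuous.stronglyMeasurableAtFilter _ _) hθ.continuous.continuousAt
  have hderiv : deriv (fun x => ∫ r in a..x, θ r) = θ := funext fun x => (hd x).deriv
  -- Left of `a'` nothing has been integrated yet; right of `b'` the primitive equals the total
  -- integral, which is zero.
  have hsub : tsupport (fun x => ∫ r in a..x, θ r) ⊆ Icc a' b' := by
    refine closure_minimal (fun x hx => ?_) isClosed_Icc
    by_contra hx'
    apply hx
    rw [mem_Icc, not_and_or, not_le, not_le] at hx'
    rcases hx' with hx' | hx'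
    · refine intervalIntegral.integral_zero_ae (Eventually.of_forall fun r hr => ?_)
      by_contra hr0
      have := (hsupp hr0).1
      have h2 := hr.2
      have : r < a' := lt_of_le_of_lt h2 (max_lt ha' hx')
      linarith
    · change ∫ r in a..x, θ r = 0
      rw [intervalIntegral.integral_eq_integral_of_support_subset
        (hsupp.trans fun r hr => ⟨ha'.trans_le hr.1, hr.2.trans hx'.le⟩), h0]
  refine ⟨fun x => ∫ r in a..x, θ r, ?_, ?_, ?_, hderiv⟩
  · rw [contDiff_infty_iff_deriv, hderiv]
    exact ⟨fun x => (hd x).differentiableAt, hθ⟩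
  · exact HasCompactSupport.of_support_subset_isCompact isCompact_Icc
      ((subset_tsupport _).trans hsub)
  · exact hsub.trans fun r hr => ⟨ha'.trans_le hr.1, lt_of_le_of_lt hr.2 hb'⟩

theorem integrableOn_smul_test {k : ℝ → F} {a b : ℝ} (hk : IntegrableOn k (Ioo a b)) {ψ : ℝ → ℝ}
    (hψ : Continuous ψ) (hc : HasCompactSupport ψ) :
    IntegrableOn (fun r => ψ r • k r) (Ioo a b) := by
  obtain ⟨C, hC⟩ := hc.exists_bound_of_continuous hψ
  exact Integrable.bdd_smul hk C hψ.aestronglyMeasurable (Eventually.of_forall hC)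

/-- The du Bois-Reymond lemma. -/
theorem ae_eq_const_of_integral_deriv_smul_eq_zero [CompleteSpace F] {k : ℝ → F} {a b : ℝ}
    (hab : a < b) (hk : IntegrableOn k (Ioo a b))
    (h : ∀ φ : ℝ → ℝ, ContDiff ℝ ∞ φ → HasCompactSupport φ → tsupport φ ⊆ Ioo a b →
      ∫ r in Ioo a b, deriv φ r • k r = 0) :
    ∃ c : F, ∀ᵐ r, r ∈ Ioo a b → k r = c := by
  let B : ContDiffBump ((a + b) / 2) :=
    ⟨(b - a) / 8, (b - a) / 4, by linarith, by linarith⟩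
  set ψ₀ : ℝ → ℝ := B.normed volume with hψ₀
  have hψ₀s : ContDiff ℝ ∞ ψ₀ := B.contDiff_normed
  have hψ₀c : HasCompactSupport ψ₀ := B.hasCompactSupport_normed
  have hψ₀t : tsupport ψ₀ ⊆ Ioo a b := by
    rw [hψ₀, B.tsupport_normed_eq, Real.closedBall_eq_Icc]
    intro x hx
    have h1 := hx.1
    have h2 := hx.2
    change (a + b) / 2 - (b - a) / 4 ≤ x at h1
    change x ≤ (a + b) / 2 + (b - a) / 4 at h2
    constructor <;> linarith
  have hψ₀1 : ∫ x, ψ₀ x = 1 := B.integral_normed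
  -- The constant has to be the mean of `k` against a bump `ψ₀` of unit mass: for any test function
  -- `ψ`, the function `ψ - (∫ ψ) ψ₀` has zero mean, hence is the derivative of a test function.
  refine ⟨∫ r in Ioo a b, ψ₀ r • k r, ?_⟩
  set c := ∫ r in Ioo a b, ψ₀ r • k r with hc
  have hkc : IntegrableOn (fun r => k r - c) (Ioo a b) :=
    Integrable.sub hk (integrable_const c)
  have key := isOpen_Ioo.ae_eq_zero_of_integral_contDiff_smul_eq_zero (μ := volume) (U := Ioo a b)
    (f := fun r => k r - c) hkc.locallyIntegrableOn (fun ψ hψ hψc hψs => by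
      have hint : Integrable ψ := hψ.continuous.integrable_of_hasCompactSupport hψc
      have hint₀ : Integrable ψ₀ := hψ₀s.continuous.integrable_of_hasCompactSupport hψ₀c
      have hθs : ContDiff ℝ ∞ (fun x => ψ x - (∫ y, ψ y) * ψ₀ x) :=
        hψ.sub (contDiff_const.mul hψ₀s)
      have hθt : tsupport (fun x => ψ x - (∫ y, ψ y) * ψ₀ x) ⊆ Ioo a b := by
        refine (tsupport_sub _ _).trans (union_subset hψs ?_)
        exact (tsupport_mul_subset_right (f := fun _ => ∫ y, ψ y) (g := ψ₀)).trans hψ₀t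
      have hθc : HasCompactSupport (fun x => ψ x - (∫ y, ψ y) * ψ₀ x) :=
        hψc.sub hψ₀c.mul_left
      obtain ⟨φ, hφ, hφc, hφs, hφd⟩ := exists_primitive_of_integral_eq_zero hab hθs hθc hθt (by
        rw [integral_sub hint (hint₀.const_mul _), integral_const_mul, hψ₀1]; ring)
      have h1 := h φ hφ hφc hφs
      rw [hφd] at h1
      have e1 : ∫ r in Ioo a b, ψ r • k r = (∫ y, ψ y) • c := by
        have : (fun r => (ψ r - (∫ y, ψ y) * ψ₀ r) • k r)
            = fun r => ψ r • k r - (∫ y, ψ y) • (ψ₀ r • k r) := by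
          funext r; rw [sub_smul, mul_smul]
        have i2 : IntegrableOn (fun r => (∫ y, ψ y) • (ψ₀ r • k r)) (Ioo a b) :=
          (integrableOn_smul_test hk hψ₀s.continuous hψ₀c).smul (∫ y, ψ y)
        rw [this, integral_sub (integrableOn_smul_test hk hψ.continuous hψc) i2,
          integral_smul] at h1
        exact sub_eq_zero.mp h1
      have e2 : ∫ r in Ioo a b, ψ r = ∫ y, ψ y :=
        setIntegral_eq_integral_of_forall_compl_eq_zero fun x hx => by
          by_contra h0; exact hx (hψs (subset_tsupport _ h0))
      rw [← setIntegral_eq_integral_of_forall_compl_eq_zero (s := Ioo a b) (fun x hx => by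
          have : ψ x = 0 := by by_contra h0; exact hx (hψs (subset_tsupport _ h0))
          rw [this, zero_smul])]
      simp only [smul_sub]
      rw [integral_sub (integrableOn_smul_test hk hψ.continuous hψc)
        (hint.integrableOn.smul_const c), e1, integral_smul_const, e2, sub_self])
  filter_upwards [key] with r hr hrI
  exact sub_eq_zero.mp (hr hrI)

/-- A function with an integrable weak derivative is almost everywhere a primitive of it. -/
theorem HasWeakTimeDeriv.ae_eq_add_integral [CompleteSpace F] {f g : ℝ → F} {a b : ℝ}
    (hab : a < b) (h : HasWeakTimeDeriv (Ioo a b) f g) (hf : IntegrableOn f (Ioo a b))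
    (hg : IntegrableOn g (Ioo a b)) :
    ∃ c : F, ∀ᵐ r, r ∈ Ioo a b → f r = c + ∫ ρ in a..r, g ρ := by
  have hgi : IntervalIntegrable g volume a b :=
    (intervalIntegrable_iff_integrableOn_Ioo_of_le hab.le).2 hg
  have hGac := absolutelyContinuousOnInterval_integral hab.le hgi
  set G : ℝ → F := fun x => ∫ r in a..x, g r with hG
  have hGi : IntegrableOn G (Ioo a b) :=
    (hGac.continuousOn.integrableOn_compact isCompact_uIcc).mono_set
      (by rw [uIcc_of_le hab.le]; exact Ioo_subset_Icc_self)
  have hparts : ∀ φ : ℝ → ℝ, ContDiff ℝ ∞ φ → HasCompactSupport φ → tsupport φ ⊆ Ioo a b →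
      ∫ r in Ioo a b, deriv φ r • G r = -∫ r in Ioo a b, φ r • g r := by
    intro φ hφ hφc hφs
    have hφac : AbsolutelyContinuousOnInterval φ a b :=
      (hφ.of_le (by simp)).contDiffOn.absolutelyContinuousOnInterval
    have hdc : Continuous (deriv φ) := hφ.continuous_deriv (by simp)
    have i1 := integrableOn_smul_test hGi hdc hφc.deriv
    have i2 := integrableOn_smul_test hg hφ.continuous hφc
    have hsum : IntervalIntegrable (fun r => deriv φ r • G r + φ r • g r) volume a b :=
      (intervalIntegrable_iff_integrableOn_Ioo_of_le hab.le).2 (i1.add i2)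
    have := eq_add_integral_of_ac hab.le (hφac.smul hGac) hsum (by
      filter_upwards [hgi.ae_hasDerivAt_integral] with x hx hxI
      have h2 := hx (by rw [uIcc_of_le hab.le]; exact Ioo_subset_Icc_self hxI) a left_mem_uIcc
      have h1 := (hφ.differentiable (by simp) x).hasDerivAt
      have := h1.smul h2
      rwa [add_comm] at this) b ⟨hab.le, le_rfl⟩
    have ha : φ a = 0 := by
      by_contra h0; exact lt_irrefl _ (hφs (subset_tsupport _ h0)).1
    have hb : φ b = 0 := by
      by_contra h0; exact lt_irrefl _ (hφs (subset_tsupport _ h0)).2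
    rw [Pi.smul_apply', Pi.smul_apply', ha, hb, zero_smul, zero_smul, zero_add,
      intervalIntegral.integral_of_le hab.le, integral_Ioc_eq_integral_Ioo,
      integral_add i1 i2] at this
    exact eq_neg_of_add_eq_zero_left this.symm
  -- By `hparts` the primitive `G` has weak derivative `g`, so `f - G` has weak derivative zero.
  obtain ⟨c, hc⟩ := ae_eq_const_of_integral_deriv_smul_eq_zero hab (Integrable.sub hf hGi)
    (fun φ hφ hφc hφs => by
      have hdc : Continuous (deriv φ) := hφ.continuous_deriv (by simp)
      simp only [Pi.sub_apply, smul_sub]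
      rw [integral_sub (integrableOn_smul_test hf hdc hφc.deriv)
        (integrableOn_smul_test hGi hdc hφc.deriv), h φ hφ hφc hφs, hparts φ hφ hφc hφs, sub_self])
  refine ⟨c, ?_⟩
  filter_upwards [hc] with r hr hrI
  rw [← hr hrI, Pi.sub_apply, sub_add_cancel]

end WeakDerivative

/-! ### Lebesgue points. -/

section LebesguePoints

variable {F : Type*} [NormedAddCommGroup F]

/-- Almost every point is a limit of points `y n` of a given set of full measure along which a
locally integrable function converges. -/
theorem ae_exists_seq_tendsto {f : ℝ → F} (hf : LocallyIntegrable f) {p : ℝ → Prop}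
    (hp : ∀ᵐ x, p x) :
    ∀ᵐ t, ∃ y : ℕ → ℝ, (∀ n, p (y n)) ∧ Tendsto y atTop (𝓝[≠] t) ∧
      Tendsto (fun n => f (y n)) atTop (𝓝 (f t)) := by
  filter_upwards [IsUnifLocDoublingMeasure.ae_tendsto_average_norm_sub volume hf 1] with t ht
  have hδ0 : Tendsto (fun n : ℕ => 1 / ((n : ℝ) + 1)) atTop (𝓝 0) :=
    tendsto_one_div_add_atTop_nhds_zero_nat
  have hδ : Tendsto (fun n : ℕ => 1 / ((n : ℝ) + 1)) atTop (𝓝[>] 0) :=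
    tendsto_nhdsWithin_iff.2 ⟨hδ0, Eventually.of_forall fun n => by
      rw [mem_Ioi]; positivity⟩
  have h := ht (fun _ => t) _ hδ (Eventually.of_forall fun n => by
    refine Metric.mem_closedBall_self ?_
    positivity)
  -- Outside a null set some point of the ball has `‖f y - f t‖` at most the mean value, and the
  -- mean tends to zero at a Lebesgue point.
  have hex : ∀ n : ℕ, ∃ y, p y ∧ y ≠ t ∧ y ∈ Metric.closedBall t (1 / ((n : ℝ) + 1)) ∧
      ‖f y - f t‖ ≤ ⨍ y in Metric.closedBall t (1 / ((n : ℝ) + 1)), ‖f y - f t‖ := by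
    intro n
    have hpos : 0 < 1 / ((n : ℝ) + 1) := by positivity
    have hint : IntegrableOn (fun y => ‖f y - f t‖) (Metric.closedBall t (1 / ((n : ℝ) + 1))) := by
      refine (Integrable.sub (hf.integrableOn_isCompact (isCompact_closedBall _ _)) ?_).norm
      exact integrableOn_const measure_closedBall_lt_top.ne
    have hq : ∀ᵐ y ∂(volume.restrict (Metric.closedBall t (1 / ((n : ℝ) + 1)))),
        p y ∧ y ≠ t ∧ y ∈ Metric.closedBall t (1 / ((n : ℝ) + 1)) := by
      have h₁ : ∀ᵐ x : ℝ, x ≠ t := by simp [ae_iff, measure_singleton]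
      filter_upwards [ae_restrict_of_ae hp, ae_restrict_of_ae h₁,
        ae_restrict_mem Metric.isClosed_closedBall.measurableSet] with y a1 a2 a3
      exact ⟨a1, a2, a3⟩
    have : IsFiniteMeasure (volume.restrict (Metric.closedBall t (1 / ((n : ℝ) + 1)))) :=
      ⟨by rw [Measure.restrict_apply_univ]; exact measure_closedBall_lt_top⟩
    obtain ⟨y, hy1, hy2⟩ := exists_notMem_null_le_average
      (μ := volume.restrict (Metric.closedBall t (1 / ((n : ℝ) + 1)))) (by
        rw [Ne, Measure.restrict_eq_zero]
        exact (Metric.measure_closedBall_pos volume t hpos).ne') hint (ae_iff.1 hq)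
    rw [mem_ofPred_eq, not_not] at hy1
    exact ⟨y, hy1.1, hy1.2.1, hy1.2.2, hy2⟩
  choose y hy1 hy2 hy3 hy4 using hex
  refine ⟨y, hy1, tendsto_nhdsWithin_iff.2 ⟨?_, Eventually.of_forall fun n => hy2 n⟩, ?_⟩
  · rw [tendsto_iff_dist_tendsto_zero]
    exact squeeze_zero (fun _ => dist_nonneg) (fun n => Metric.mem_closedBall.1 (hy3 n)) hδ0
  · rw [tendsto_iff_norm_sub_tendsto_zero]
    exact squeeze_zero (fun _ => norm_nonneg _) hy4 h

end LebesguePoints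

/-! ### Product rules, and the derivative of the squared norm in a Gelfand triple. -/

section Duality

theorem intervalIntegrable_left {E : Type*} [NormedAddCommGroup E] {g : ℝ → E} {a b x : ℝ} (hg : IntervalIntegrable g volume a b)
    (hx : x ∈ Icc a b) : IntervalIntegrable g volume a x :=
  hg.mono_set (by
    rw [uIcc_of_le (hx.1.trans hx.2), uIcc_of_le hx.1]; exact Icc_subset_Icc_right hx.2)

theorem norm_sub_le_integral {E : Type*} [NormedAddCommGroup E] [NormedSpace ℝ E]
    {f f' : ℝ → E} {a b : ℝ}
    (hf' : IntervalIntegrable f' volume a b) (hf : ∀ x ∈ Icc a b, f x = f a + ∫ r in a..x, f' r)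
    {x y : ℝ} (hx : x ∈ Icc a b) (hy : y ∈ Icc a b) :
    ‖f y - f x‖ ≤ |∫ r in x..y, ‖f' r‖| := by
  rw [hf x hx, hf y hy, add_sub_add_left_eq_sub,
    intervalIntegral.integral_interval_sub_left (intervalIntegrable_left hf' hy)
      (intervalIntegrable_left hf' hx)]
  exact intervalIntegral.norm_integral_le_abs_integral_norm

variable {E F : Type*} [NormedAddCommGroup E] [NormedSpace ℝ E] [CompleteSpace E]
  [NormedAddCommGroup F] [NormedSpace ℝ F] [CompleteSpace F]

theorem continuousOn_of_eq_add_integral {f f' : ℝ → E} {a b : ℝ} (hab : a ≤ b)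
    (hf' : IntervalIntegrable f' volume a b) (hf : ∀ x ∈ Icc a b, f x = f a + ∫ r in a..x, f' r) :
    ContinuousOn f (Icc a b) := by
  have := (absolutelyContinuousOnInterval_integral hab hf').continuousOn
  rw [uIcc_of_le hab] at this
  exact (continuousOn_const.add this).congr hf

theorem ae_hasDerivAt_of_eq_add_integral {f f' : ℝ → E} {a b : ℝ} (hab : a ≤ b)
    (hf' : IntervalIntegrable f' volume a b) (hf : ∀ x ∈ Icc a b, f x = f a + ∫ r in a..x, f' r) :
    ∀ᵐ x, x ∈ Ioo a b → HasDerivAt f (f' x) x := by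
  filter_upwards [hf'.ae_hasDerivAt_integral] with x hx hxI
  have h1 := (hx (by rw [uIcc_of_le hab]; exact Ioo_subset_Icc_self hxI) a left_mem_uIcc).const_add
    (f a)
  refine h1.congr_of_eventuallyEq ?_
  filter_upwards [Icc_mem_nhds hxI.1 hxI.2] with y hy using hf y hy

/-- The product rule, in integrated form, for a bilinear pairing of two primitives. -/
theorem bilin_ac (L : E →L[ℝ] F →L[ℝ] ℝ) {f f' : ℝ → E} {g g' : ℝ → F} {a b : ℝ} (hab : a ≤ b)
    (hf' : IntervalIntegrable f' volume a b) (hf : ∀ x ∈ Icc a b, f x = f a + ∫ r in a..x, f' r)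
    (hg' : IntervalIntegrable g' volume a b) (hg : ∀ x ∈ Icc a b, g x = g a + ∫ r in a..x, g' r) :
    AbsolutelyContinuousOnInterval (fun x => L (f x) (g x)) a b ∧
      IntervalIntegrable (fun r => L (f' r) (g r) + L (f r) (g' r)) volume a b ∧
      ∀ᵐ x, x ∈ Ioo a b →
        HasDerivAt (fun x => L (f x) (g x)) (L (f' x) (g x) + L (f x) (g' x)) x := by
  have hfc := continuousOn_of_eq_add_integral hab hf' hf
  have hgc := continuousOn_of_eq_add_integral hab hg' hg
  obtain ⟨Cf, hCf⟩ := isCompact_Icc.exists_bound_of_continuousOn hfc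
  obtain ⟨Cg, hCg⟩ := isCompact_Icc.exists_bound_of_continuousOn hgc
  have hCf0 : 0 ≤ Cf := (norm_nonneg _).trans (hCf a ⟨le_rfl, hab⟩)
  have hCg0 : 0 ≤ Cg := (norm_nonneg _).trans (hCg a ⟨le_rfl, hab⟩)
  have hρ : IntervalIntegrable (fun r => ‖L‖ * Cg * ‖f' r‖ + ‖L‖ * Cf * ‖g' r‖) volume a b :=
    (hf'.norm.const_mul _).add (hg'.norm.const_mul _)
  have hLm : Continuous fun p : E × F => L p.1 p.2 :=
    L.isBoundedBilinearMap.continuous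
  refine ⟨absolutelyContinuousOnInterval_of_dist_le hab hρ fun x hx y hy hxy => ?_, ?_, ?_⟩
  · have hsub : ∀ {k : ℝ → ℝ}, IntervalIntegrable k volume a b → IntervalIntegrable k volume x y :=
      fun hk => hk.mono_set (by
        rw [uIcc_of_le hab, uIcc_of_le hxy]; exact Icc_subset_Icc hx.1 hy.2)
    rw [intervalIntegral.integral_add (hsub (hf'.norm.const_mul _)) (hsub (hg'.norm.const_mul _)),
      intervalIntegral.integral_const_mul, intervalIntegral.integral_const_mul, dist_comm,
      dist_eq_norm]
    have e : L (f y) (g y) - L (f x) (g x) = L (f y - f x) (g y) + L (f x) (g y - g x) := by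
      simp only [map_sub, sub_apply]; ring
    have h1 := norm_sub_le_integral hf' hf hx hy
    have h2 := norm_sub_le_integral hg' hg hx hy
    rw [abs_of_nonneg (intervalIntegral.integral_nonneg hxy fun _ _ => norm_nonneg _)] at h1 h2
    rw [e]
    refine (norm_add_le _ _).trans (add_le_add ?_ ?_)
    · calc _ ≤ ‖L‖ * ‖f y - f x‖ * ‖g y‖ := L.le_opNorm₂ _ _
        _ ≤ ‖L‖ * (∫ r in x..y, ‖f' r‖) * Cg := by
          have := hCg y hy
          have h0 : 0 ≤ ∫ r in x..y, ‖f' r‖ :=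
            intervalIntegral.integral_nonneg hxy fun _ _ => norm_nonneg _
          gcongr
        _ = _ := by ring
    · calc _ ≤ ‖L‖ * ‖f x‖ * ‖g y - g x‖ := L.le_opNorm₂ _ _
        _ ≤ ‖L‖ * Cf * ∫ r in x..y, ‖g' r‖ := by
          gcongr
          exact hCf x hx
  · rw [intervalIntegrable_iff_integrableOn_Ioc_of_le hab] at hf' hg' hρ ⊢
    have hfm : AEStronglyMeasurable f (volume.restrict (Ioc a b)) :=
      (hfc.mono Ioc_subset_Icc_self).aestronglyMeasurable measurableSet_Ioc
    have hgm : AEStronglyMeasurable g (volume.restrict (Ioc a b)) :=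
      (hgc.mono Ioc_subset_Icc_self).aestronglyMeasurable measurableSet_Ioc
    refine Integrable.mono' hρ ?_ ?_
    · exact (hLm.comp_aestronglyMeasurable (hf'.aestronglyMeasurable.prodMk hgm)).add
        (hLm.comp_aestronglyMeasurable (hfm.prodMk hg'.aestronglyMeasurable))
    · filter_upwards [ae_restrict_mem measurableSet_Ioc] with r hr
      have hr' := Ioc_subset_Icc_self hr
      refine (norm_add_le _ _).trans (add_le_add ?_ ?_)
      · calc _ ≤ ‖L‖ * ‖f' r‖ * ‖g r‖ := L.le_opNorm₂ _ _
          _ ≤ ‖L‖ * ‖f' r‖ * Cg := by gcongr; exact hCg r hr'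
          _ = _ := by ring
      · calc _ ≤ ‖L‖ * ‖f r‖ * ‖g' r‖ := L.le_opNorm₂ _ _
          _ ≤ ‖L‖ * Cf * ‖g' r‖ := by gcongr; exact hCf r hr'
  · filter_upwards [ae_hasDerivAt_of_eq_add_integral hab hf' hf,
      ae_hasDerivAt_of_eq_add_integral hab hg' hg] with x h1 h2 hx
    have h3 := (L.hasFDerivAt.comp_hasDerivAt x (h1 hx)).clm_apply (h2 hx)
    exact h3

variable {V H : Type*} [NormedAddCommGroup V] [NormedSpace ℝ V]
  [NormedAddCommGroup H] [InnerProductSpace ℝ H]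

/-- If `v` is bounded with values in `V`, and its image in the dual of `V` under the Riesz map of a
Hilbert space `H` has an integrable derivative `w`, then `‖v‖²_H` is a primitive of `2 ⟨w, v⟩`. -/
theorem ae_norm_sq_eq_add_integral (i : V →L[ℝ] H) {v : ℝ → V} {w : ℝ → V →L[ℝ] ℝ}
    {y₀ : V →L[ℝ] ℝ} {a b C : ℝ} (hab : a < b) (hv : IntegrableOn v (Ioo a b))
    (hvC : ∀ᵐ r, r ∈ Ioo a b → ‖v r‖ ≤ C) (hw : IntegrableOn w (Ioo a b))
    (hY : ∀ᵐ r, r ∈ Ioo a b → (innerSL ℝ (i (v r))).comp i = y₀ + ∫ ρ in a..r, w ρ) :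
    IntervalIntegrable (fun r => 2 * w r (v r)) volume a b ∧
    ∃ c, ∀ᵐ r, r ∈ Ioo a b → ‖i (v r)‖ ^ 2 = c + ∫ ρ in a..r, 2 * w ρ (v ρ) := by
  have hwi : IntervalIntegrable w volume a b :=
    (intervalIntegrable_iff_integrableOn_Ioo_of_le hab.le).2 hw
  set Y : ℝ → V →L[ℝ] ℝ := fun r => y₀ + ∫ ρ in a..r, w ρ with hYdef
  have hYeq : ∀ x ∈ Icc a b, Y x = Y a + ∫ r in a..x, w r := by
    intro x _; simp [hYdef]
  have hint : IntervalIntegrable (fun r => 2 * w r (v r)) volume a b := by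
    refine (intervalIntegrable_iff_integrableOn_Ioo_of_le hab.le).2 ?_
    refine Integrable.const_mul ?_ 2
    refine Integrable.mono' (hw.norm.const_mul C) ?_ ?_
    · exact isBoundedBilinearMap_apply.continuous.comp_aestronglyMeasurable
        (hw.aestronglyMeasurable.prodMk hv.aestronglyMeasurable)
    · filter_upwards [(ae_restrict_iff' measurableSet_Ioo).2 hvC] with r hr
      calc _ ≤ ‖w r‖ * ‖v r‖ := (w r).le_opNorm _
        _ ≤ ‖w r‖ * C := by gcongr
        _ = _ := mul_comm _ _
  refine ⟨hint, ?_⟩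
  have hgood := hvC.and hY
  set S : Set ℝ := {r | r ∈ Ioo a b ∧ ‖v r‖ ≤ C ∧ (innerSL ℝ (i (v r))).comp i = Y r} with hS
  have hSae : ∀ᵐ r, r ∈ Ioo a b → r ∈ S := by
    filter_upwards [hgood] with r hr hrI using ⟨hrI, hr.1 hrI, hr.2 hrI⟩
  -- By symmetry of the inner product the cross terms cancel. Only increments of the absolutely
  -- continuous `Y` appear, so no continuity of `v` in `V` is required.
  have hdiff : ∀ r ∈ S, ∀ r' ∈ S,
      ‖i (v r')‖ ^ 2 - ‖i (v r)‖ ^ 2 = (Y r' - Y r) (v r' + v r) := by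
    intro r hr r' hr'
    rw [← hr.2.2, ← hr'.2.2]
    simp only [sub_apply, ContinuousLinearMap.comp_apply, innerSL_apply_apply,
      map_add, real_inner_self_eq_norm_sq]
    rw [real_inner_comm (i (v r)) (i (v r'))]
    ring
  have hS_ne : S.Nonempty := by
    have : ∀ᵐ r ∂(volume.restrict (Ioo a b)), r ∈ S := (ae_restrict_iff' measurableSet_Ioo).2 hSae
    have : (ae (volume.restrict (Ioo a b))).NeBot := by
      rw [ae_neBot, Ne, Measure.restrict_eq_zero, Real.volume_Ioo]
      simpa using hab
    exact (Eventually.exists ‹∀ᵐ r ∂(volume.restrict (Ioo a b)), r ∈ S›)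
  have hC0 : 0 ≤ C := (norm_nonneg _).trans hS_ne.choose_spec.2.1
  set m : ℝ → ℝ := fun r => ∫ ρ in a..r, ‖w ρ‖ with hm
  have hmsub : ∀ x ∈ Icc a b, ∀ y ∈ Icc a b, m y - m x = ∫ ρ in x..y, ‖w ρ‖ := fun x hx y hy =>
    intervalIntegral.integral_interval_sub_left (intervalIntegrable_left hwi.norm hy)
      (intervalIntegrable_left hwi.norm hx)
  have hFm : ∀ r ∈ S, ∀ r' ∈ S, |‖i (v r')‖ ^ 2 - ‖i (v r)‖ ^ 2| ≤ 2 * C * |m r' - m r| := by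
    intro r hr r' hr'
    have hrI := Ioo_subset_Icc_self hr.1
    have hrI' := Ioo_subset_Icc_self hr'.1
    rw [hdiff r hr r' hr', hmsub r hrI r' hrI']
    calc _ ≤ ‖Y r' - Y r‖ * ‖v r' + v r‖ := (Y r' - Y r).le_opNorm _
      _ ≤ |∫ ρ in r..r', ‖w ρ‖| * (C + C) := by
        gcongr
        · exact norm_sub_le_integral hwi hYeq hrI hrI'
        · exact (norm_add_le _ _).trans (add_le_add hr'.2.1 hr.2.1)
      _ = _ := by ring
  -- On `S` the squared norm is a Lipschitz function of `m`. Extending that function to the line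
  -- gives the absolutely continuous representative `g ∘ m`.
  obtain ⟨g, hg, hgS⟩ : ∃ g : ℝ → ℝ, LipschitzWith (2 * C).toNNReal g ∧
      ∀ r ∈ S, g (m r) = ‖i (v r)‖ ^ 2 := by
    have hinv : ∀ r ∈ S, Function.invFunOn m S (m r) ∈ S ∧ m (Function.invFunOn m S (m r)) = m r :=
      fun r hr => ⟨Function.invFunOn_mem ⟨r, hr, rfl⟩, Function.invFunOn_eq ⟨r, hr, rfl⟩⟩
    have hLip : LipschitzOnWith (2 * C).toNNReal
        (fun z => ‖i (v (Function.invFunOn m S z))‖ ^ 2) (m '' S) := by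
      refine LipschitzOnWith.of_dist_le_mul ?_
      rintro _ ⟨r, hr, rfl⟩ _ ⟨r', hr', rfl⟩
      have := hFm _ (hinv r' hr').1 _ (hinv r hr).1
      rw [(hinv r' hr').2, (hinv r hr).2] at this
      rwa [Real.dist_eq, Real.dist_eq, Real.coe_toNNReal _ (by positivity)]
    obtain ⟨g, hg, hge⟩ := hLip.extend_real
    refine ⟨g, hg, fun r hr => ?_⟩
    have h1 := hge (mem_image_of_mem m hr)
    have h2 := hFm _ hr _ (hinv r hr).1
    rw [(hinv r hr).2, sub_self, abs_zero, mul_zero] at h2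
    have h3 := abs_nonpos_iff.1 h2
    change ‖i (v (Function.invFunOn m S (m r)))‖ ^ 2 = g (m r) at h1
    linarith
  have hac : AbsolutelyContinuousOnInterval (fun r => g (m r)) a b := by
    refine ac_comp_lipschitzOnWith (s := univ) ?_ (mapsTo_univ _ _) hg.lipschitzOnWith
    exact absolutelyContinuousOnInterval_integral hab.le hwi.norm
  have hloc : LocallyIntegrable ((Ioo a b).indicator v) :=
    ((integrable_indicator_iff measurableSet_Ioo).2 hv).locallyIntegrable
  -- Since `v` is only measurable, the derivative is identified along points `y n` of `S` with `v (y
  -- n) → v t`; there the difference quotient tends to `w t (v t + v t)`.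
  have hderiv : ∀ᵐ x, x ∈ Ioo a b → HasDerivAt (fun r => g (m r)) (2 * w x (v x)) x := by
    filter_upwards [hac.ae_differentiableAt, ae_hasDerivAt_of_eq_add_integral hab.le hwi hYeq,
      hSae, ae_exists_seq_tendsto hloc hSae] with t h1 h2 h3 h4 ht
    have hd := (h1 (by rw [uIcc_of_le hab.le]; exact Ioo_subset_Icc_self ht)).hasDerivAt
    obtain ⟨y, hy1, hy2, hy3⟩ := h4
    have hyI : ∀ᶠ n in atTop, y n ∈ Ioo a b :=
      (tendsto_nhdsWithin_iff.1 hy2).1.eventually (Ioo_mem_nhds ht.1 ht.2)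
    have hvlim : Tendsto (fun n => v (y n)) atTop (𝓝 (v t)) := by
      rw [indicator_of_mem ht] at hy3
      refine hy3.congr' ?_
      filter_upwards [hyI] with n hn using indicator_of_mem hn v
    have s1 := (hasDerivAt_iff_tendsto_slope.1 hd).comp hy2
    have s2 := (hasDerivAt_iff_tendsto_slope.1 (h2 ht)).comp hy2
    have s3 := (isBoundedBilinearMap_apply.continuous.tendsto (w t, v t + v t)).comp
      (s2.prodMk_nhds (hvlim.add (tendsto_const_nhds (x := v t))))
    have s4 : Tendsto (slope (fun r => g (m r)) t ∘ y) atTop (𝓝 (w t (v t + v t))) := by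
      refine s3.congr' ?_
      filter_upwards [hyI] with n hn
      simp only [Function.comp_apply, slope_def_module, smul_apply]
      rw [hgS _ (hy1 n hn), hgS _ (h3 ht), hdiff _ (h3 ht) _ (hy1 n hn)]
    have := tendsto_nhds_unique s1 s4
    rw [this, map_add, ← two_mul] at hd
    exact hd
  refine ⟨g (m a), ?_⟩
  have hfin := eq_add_integral_of_ac hab.le hac hint hderiv
  filter_upwards [hSae] with r hr hrI
  rw [← hgS r (hr hrI)]
  exact hfin r (Ioo_subset_Icc_self hrI)

end Duality

/-! ### Energy and virial identities for strong solutions. -/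

section Strong

/-- The fundamental theorem of calculus for real absolutely continuous functions whose derivative
is known almost everywhere. -/
theorem eq_add_integral_of_ac_real {f g : ℝ → ℝ} {a b : ℝ} (hab : a ≤ b)
    (hf : AbsolutelyContinuousOnInterval f a b)
    (hd : ∀ᵐ x, x ∈ Ioo a b → HasDerivAt f (g x) x) :
    IntervalIntegrable g volume a b ∧ ∀ x ∈ Icc a b, f x = f a + ∫ r in a..x, g r := by
  have hg : IntervalIntegrable g volume a b := by
    refine hf.intervalIntegrable_deriv.congr_ae ?_
    rw [uIoc_of_le hab, Measure.restrict_congr_set Ioo_ae_eq_Ioc.symm]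
    refine (ae_restrict_iff' measurableSet_Ioo).2 ?_
    filter_upwards [hd] with x hx hxI using (hx hxI).deriv
  exact ⟨hg, eq_add_integral_of_ac hab hf hg hd⟩

variable {N : ℕ} (Ω : Set (Eucl N)) (α β b c lam mu : ℝ)

/-- The energy of the Kirchhoff equation. -/
noncomputable def energy (x : H10 Ω) (z : L2 Ω) : ℝ :=
  ‖z‖ ^ 2 / 2 + ‖grad Ω x‖ ^ 2 / 2 + b / (β + 2) * ‖grad Ω x‖ ^ (β + 2) - lam / 2 * ‖toL2 Ω x‖ ^ 2

/-- The unforced part of the time derivative of the energy. -/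
noncomputable def energyRate (z : L2 Ω) : ℝ := -(c * ‖z‖ ^ α * ‖z‖ ^ 2) + mu * ‖z‖ ^ 2

/-- The unforced part of the time derivative of `⟪u_t, u⟫`. -/
noncomputable def virialRate (x : H10 Ω) (z : L2 Ω) : ℝ :=
  ‖z‖ ^ 2 - ‖grad Ω x‖ ^ 2 - b * ‖grad Ω x‖ ^ β * ‖grad Ω x‖ ^ 2 - c * ‖z‖ ^ α * ⟪z, toL2 Ω x⟫
    + lam * ‖toL2 Ω x‖ ^ 2 + mu * ⟪z, toL2 Ω x⟫

/-- Almost everywhere on `(s, t)`, `f` is a primitive of the integrable function `g`. -/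
def IsAEPrimitive (s t : ℝ) (f g : ℝ → ℝ) : Prop :=
  IntervalIntegrable g volume s t ∧ ∃ C, ∀ᵐ r, r ∈ Ioo s t → f r = C + ∫ ρ in s..r, g ρ

variable {Ω α β b c lam mu}

/-- The real inner product pulled back along a continuous linear map. -/
noncomputable def pullbackInner {V H : Type*} [NormedAddCommGroup V] [NormedSpace ℝ V] [NormedAddCommGroup H]
    [InnerProductSpace ℝ H] (G : V →L[ℝ] H) : V →L[ℝ] V →L[ℝ] ℝ :=
  ((isBoundedBilinearMap_inner (𝕜 := ℝ) (E := H)).toContinuousLinearMap).bilinearComp G G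

theorem pullbackInner_apply {V H : Type*} [NormedAddCommGroup V] [NormedSpace ℝ V]
    [NormedAddCommGroup H] [InnerProductSpace ℝ H] (G : V →L[ℝ] H) (x y : V) :
    pullbackInner G x y = ⟪G x, G y⟫ := rfl

theorem norm_sq_ac {V H : Type*} [NormedAddCommGroup V] [NormedSpace ℝ V] [CompleteSpace V]
    [NormedAddCommGroup H] [InnerProductSpace ℝ H] (G : V →L[ℝ] H) {f f' : ℝ → V} {a b : ℝ}
    (hab : a ≤ b) (hf' : IntervalIntegrable f' volume a b)
    (hf : ∀ x ∈ Icc a b, f x = f a + ∫ r in a..x, f' r) :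
    AbsolutelyContinuousOnInterval (fun x => ‖G (f x)‖ ^ 2) a b ∧
      ∀ᵐ x, x ∈ Ioo a b → HasDerivAt (fun x => ‖G (f x)‖ ^ 2) (2 * ⟪G (f x), G (f' x)⟫) x := by
  obtain ⟨h1, -, h2⟩ := bilin_ac (pullbackInner G) hab hf' hf hf' hf
  simp only [pullbackInner_apply, real_inner_self_eq_norm_sq] at h1 h2
  refine ⟨h1, ?_⟩
  filter_upwards [h2] with x hx hxI
  have := hx hxI
  rwa [real_inner_comm, ← two_mul] at this

/-- The potential energy along a primitive in `H¹₀(Ω)`. -/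
theorem potential_ac (hβ : 0 < β) {f f' : ℝ → H10 Ω} {s t : ℝ}
    (hst : s ≤ t) (hf' : IntervalIntegrable f' volume s t)
    (hf : ∀ x ∈ Icc s t, f x = f s + ∫ r in s..x, f' r) :
    IsAEPrimitive s t
      (fun x => ‖grad Ω (f x)‖ ^ 2 / 2 + b / (β + 2) * ‖grad Ω (f x)‖ ^ (β + 2)
        - lam / 2 * ‖toL2 Ω (f x)‖ ^ 2)
      (fun x => ⟪grad Ω (f x), grad Ω (f' x)⟫ + b * ‖grad Ω (f x)‖ ^ β *
        ⟪grad Ω (f x), grad Ω (f' x)⟫ - lam * ⟪toL2 Ω (f x), toL2 Ω (f' x)⟫) := by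
  obtain ⟨g1, g2⟩ := norm_sq_ac (grad Ω) hst hf' hf
  obtain ⟨i1, i2⟩ := norm_sq_ac (toL2 Ω) hst hf' hf
  -- Writing `‖∇u‖^(β+2)` as a `C¹` function of `‖∇u‖²` avoids differentiating the norm at zero.
  have hpow : ContDiff ℝ 1 (fun z : ℝ => z ^ ((β + 2) / 2)) :=
    Real.contDiff_rpow_const_of_le (by push_cast; linarith)
  obtain ⟨M, hM⟩ := g1.exists_bound
  have g3 := ac_comp_contDiffOn (m := -M) (M := M) g1
    (fun x hx => abs_le.1 (by simpa using hM x hx)) hpow.contDiffOn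
  have hrw : ∀ y : ℝ, 0 ≤ y → (y ^ 2) ^ ((β + 2) / 2) = y ^ (β + 2) := fun y hy => by
    rw [← Real.rpow_natCast, ← Real.rpow_mul hy]; congr 1; push_cast; ring
  have hrw' : ∀ y : ℝ, 0 ≤ y → (y ^ 2) ^ ((β + 2) / 2 - 1) = y ^ β := fun y hy => by
    rw [← Real.rpow_natCast, ← Real.rpow_mul hy]; congr 1; push_cast; ring
  have hac := ((g1.const_mul (1 / 2)).add (g3.const_mul (b / (β + 2)))).sub
    (i1.const_mul (lam / 2))
  have := eq_add_integral_of_ac_real hst hac (g := fun x => ⟪grad Ω (f x), grad Ω (f' x)⟫ +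
    b * ‖grad Ω (f x)‖ ^ β * ⟪grad Ω (f x), grad Ω (f' x)⟫ -
      lam * ⟪toL2 Ω (f x), toL2 Ω (f' x)⟫) (by
    filter_upwards [g2, i2] with x hg hi hx
    have e1 := hg hx
    have e2 := e1.rpow_const (p := (β + 2) / 2) (Or.inr (by linarith))
    have e3 := hi hx
    have := ((e1.const_mul (1 / 2)).add (e2.const_mul (b / (β + 2)))).sub
      (e3.const_mul (lam / 2))
    refine this.congr_deriv ?_
    rw [hrw' _ (norm_nonneg _)]
    have : β + 2 ≠ 0 := by linarith
    field_simp)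
  refine ⟨this.1, ‖grad Ω (f s)‖ ^ 2 / 2 + b / (β + 2) * ‖grad Ω (f s)‖ ^ (β + 2)
        - lam / 2 * ‖toL2 Ω (f s)‖ ^ 2, Eventually.of_forall fun r hr => ?_⟩
  have h := this.2 r (Ioo_subset_Icc_self hr)
  simp only [Pi.sub_apply, Pi.add_apply, hrw _ (norm_nonneg _)] at h
  rw [one_div, inv_mul_eq_div, inv_mul_eq_div] at h
  exact h

theorem IsAEPrimitive.add {s t : ℝ} {f g f' g' : ℝ → ℝ} (h : IsAEPrimitive s t f g)
    (h' : IsAEPrimitive s t f' g') : IsAEPrimitive s t (fun r => f r + f' r)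
      (fun r => g r + g' r) := by
  obtain ⟨hi, C, hC⟩ := h
  obtain ⟨hi', C', hC'⟩ := h'
  refine ⟨hi.add hi', C + C', ?_⟩
  filter_upwards [hC, hC'] with r h1 h2 hr
  have hr' := Ioo_subset_Icc_self hr
  rw [h1 hr, h2 hr, intervalIntegral.integral_add (intervalIntegrable_left hi hr')
    (intervalIntegrable_left hi' hr')]
  ring

theorem IsAEPrimitive.congr {s t : ℝ} {f g f' g' : ℝ → ℝ} (h : IsAEPrimitive s t f g)
    (hst : s ≤ t) (hf : ∀ᵐ r, r ∈ Ioo s t → f r = f' r) (hg : ∀ᵐ r, r ∈ Ioo s t → g r = g' r) :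
    IsAEPrimitive s t f' g' := by
  obtain ⟨hi, C, hC⟩ := h
  have hg' : ∀ᵐ r, r ∈ Ioc s t → g r = g' r := by
    have h₂ : ∀ᵐ x : ℝ, x ≠ t := by simp [ae_iff, measure_singleton]
    filter_upwards [hg, h₂] with r h1 h2 hr using h1 ⟨hr.1, lt_of_le_of_ne hr.2 h2⟩
  refine ⟨hi.congr_ae ?_, C, ?_⟩
  · rw [uIoc_of_le hst]
    exact (ae_restrict_iff' measurableSet_Ioc).2 hg'
  · filter_upwards [hC, hf] with r h1 h2 hr
    rw [← h2 hr, h1 hr]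
    congr 1
    refine intervalIntegral.integral_congr_ae ?_
    filter_upwards [hg'] with ρ h3 hρ
    rw [uIoc_of_le hr.1.le] at hρ
    exact h3 ⟨hρ.1, hρ.2.trans hr.2.le⟩

/-- The energy and virial identities for strong solutions. -/
theorem IsStrongSolution.identities (hβ : 0 < β) {s t : ℝ} (hst : s < t) {h : ℝ → L2 Ω}
    {u v : ℝ → H10 Ω} (hu : IsStrongSolution Ω α β b c lam mu (Ioo s t) h u v) :
    IsAEPrimitive s t (fun r => energy Ω β b lam (u r) (toL2 Ω (v r)))
      (fun r => energyRate Ω α c mu (toL2 Ω (v r)) + ⟪h r, toL2 Ω (v r)⟫) ∧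
    IsAEPrimitive s t (fun r => ⟪toL2 Ω (v r), toL2 Ω (u r)⟫)
      (fun r => virialRate Ω α β b c lam mu (u r) (toL2 Ω (v r)) + ⟪h r, toL2 Ω (u r)⟫) := by
  have hui : IntegrableOn u (Ioo s t) := hu.memLp_u.integrable le_top
  have hvi : IntegrableOn v (Ioo s t) := hu.memLp_v.integrable le_top
  have hvI : IntervalIntegrable v volume s t :=
    (intervalIntegrable_iff_integrableOn_Ioo_of_le hst.le).2 hvi
  obtain ⟨C, hC⟩ : ∃ C, ∀ᵐ r, r ∈ Ioo s t → ‖v r‖ ≤ C := by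
    refine ⟨(eLpNormEssSup v (volume.restrict (Ioo s t))).toReal, ?_⟩
    refine (ae_restrict_iff' measurableSet_Ioo).1 ?_
    have hfin : eLpNormEssSup v (volume.restrict (Ioo s t)) ≠ ⊤ := by
      have := hu.memLp_v.2.ne
      rwa [eLpNorm_exponent_top] at this
    filter_upwards [enorm_ae_le_eLpNormEssSup v (volume.restrict (Ioo s t))] with r hr
    rw [← toReal_enorm]
    exact ENNReal.toReal_mono hfin hr
  obtain ⟨w, hw, hwd, heq⟩ := hu.equation
  have heq' := (ae_restrict_iff' measurableSet_Ioo).1 heq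
  have hwi : IntegrableOn w (Ioo s t) := memLp_one_iff_integrable.1 hw
  have hwI : IntervalIntegrable w volume s t :=
    (intervalIntegrable_iff_integrableOn_Ioo_of_le hst.le).2 hwi
  have hYi : IntegrableOn (fun r => toHNeg1 Ω (toL2 Ω (v r))) (Ioo s t) := by
    have := (pullbackInner (toL2 Ω)).integrable_comp hvi
    exact this
  obtain ⟨u₀, hu₀⟩ := hu.deriv_u.ae_eq_add_integral hst hui hvi
  obtain ⟨y₀, hy₀⟩ := hwd.ae_eq_add_integral hst hYi hwi
  -- `U` and `Y` are the absolutely continuous representatives of `u` and of `u_t` seen in `H⁻¹`.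
  set U : ℝ → H10 Ω := fun r => u₀ + ∫ ρ in s..r, v ρ with hU
  set Y : ℝ → HNeg1 Ω := fun r => y₀ + ∫ ρ in s..r, w ρ with hY
  have hUeq : ∀ x ∈ Icc s t, U x = U s + ∫ r in s..x, v r := by intro x _; simp [hU]
  have hYeq : ∀ x ∈ Icc s t, Y x = Y s + ∫ r in s..x, w r := by intro x _; simp [hY]
  obtain ⟨k1, c1, k2⟩ := ae_norm_sq_eq_add_integral (toL2 Ω) hst hvi hC hwi hy₀
  have hkin : IsAEPrimitive s t (fun r => ‖toL2 Ω (v r)‖ ^ 2 / 2) (fun r => w r (v r)) := by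
    refine ⟨?_, c1 / 2, ?_⟩
    · have := k1.const_mul (1 / 2)
      refine this.congr fun r _ => ?_
      ring
    · filter_upwards [k2] with r hr hrI
      rw [hr hrI, intervalIntegral.integral_const_mul]
      ring
  have hpot := potential_ac (b := b) (lam := lam) hβ hst.le hvI hUeq
  obtain ⟨p1, -, p2⟩ := bilin_ac (ContinuousLinearMap.id ℝ (HNeg1 Ω)) hst.le hwI hYeq hvI hUeq
  have hvir : IsAEPrimitive s t (fun r => Y r (U r)) (fun r => w r (U r) + Y r (v r)) := by
    have := eq_add_integral_of_ac_real hst.le p1 p2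
    exact ⟨this.1, _, Eventually.of_forall fun r hr => this.2 r (Ioo_subset_Icc_self hr)⟩
  constructor
  · refine (hkin.add hpot).congr hst.le ?_ ?_
    · filter_upwards [hu₀] with r hr hrI
      rw [energy, hr hrI]
      ring
    · filter_upwards [hu₀, heq'] with r hr he hrI
      -- The energy identity is the equation tested with `u_t`.
      have := he hrI (v r)
      have hUr : u r = U r := hr hrI
      rw [← hUr, energyRate, ← real_inner_self_eq_norm_sq (toL2 Ω (v r))]
      linarith
  · refine hvir.congr hst.le ?_ ?_
    · filter_upwards [hu₀, hy₀] with r hr hr' hrI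
      have hUr : u r = U r := hr hrI
      have hYr : toHNeg1 Ω (toL2 Ω (v r)) = Y r := hr' hrI
      rw [← hUr, ← hYr]
      rfl
    · filter_upwards [hu₀, hy₀, heq'] with r hr hr' he hrI
      -- The virial identity is the equation tested with `u`.
      have := he hrI (u r)
      have hUr : u r = U r := hr hrI
      have hYr : toHNeg1 Ω (toL2 Ω (v r)) = Y r := hr' hrI
      have e : toHNeg1 Ω (toL2 Ω (v r)) (v r) = ⟪toL2 Ω (v r), toL2 Ω (v r)⟫ := rfl
      rw [← hUr, ← hYr, e, virialRate, ← real_inner_self_eq_norm_sq (toL2 Ω (v r)),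
        ← real_inner_self_eq_norm_sq (toL2 Ω (u r)), ← real_inner_self_eq_norm_sq (grad Ω (u r))]
      linarith

end Strong

/-! ### Passage of the identities to weak solutions. -/

section Weak

/-- The continuous functions `max f C` and `C` agree almost everywhere on the interval, hence
everywhere. This turns almost-everywhere approximation by strong solutions into bounds at every
time, endpoints included. -/
theorem le_on_Icc_of_ae_le {f : ℝ → ℝ} {a b C : ℝ} (hab : a < b) (hf : ContinuousOn f (Icc a b))
    (h : ∀ᵐ r, r ∈ Ioo a b → f r ≤ C) : ∀ r ∈ Icc a b, f r ≤ C := by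
  have hae : (fun r => max (f r) C) =ᵐ[volume.restrict (Icc a b)] fun _ => C := by
    rw [Measure.restrict_congr_set Ioo_ae_eq_Icc.symm]
    refine (ae_restrict_iff' measurableSet_Ioo).2 ?_
    filter_upwards [h] with r hr hrI using max_eq_right (hr hrI)
  have := Measure.eqOn_Icc_of_ae_eq volume hab.ne hae (hf.sup continuousOn_const)
    continuousOn_const
  intro r hr
  have h1 := this hr
  change max (f r) C = C at h1
  exact (le_max_left _ _).trans h1.le

variable {N : ℕ} {Ω : Set (Eucl N)} {α β b c lam mu : ℝ}

theorem IsWeakSolution.continuousOn_velocity {I : Set ℝ} (hI : IsOpen I) {h : ℝ → L2 Ω}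
    {u : ℝ → H10 Ω} (hu : IsWeakSolution Ω α β b c lam mu I h u) :
    ContinuousOn (velocity u) I :=
  hu.contDiffOn.continuousOn_deriv_of_isOpen hI le_rfl

/-- An integrated identity valid for all strong solutions, with continuous terms, is inherited by
weak solutions. -/
theorem IsWeakSolution.identity {Φ Q : H10 Ω × L2 Ω → ℝ} {X : H10 Ω × L2 Ω → L2 Ω}
    (hΦ : Continuous Φ) (hQ : Continuous Q) (hX : Continuous X)
    (hstrong : ∀ s t : ℝ, s < t → ∀ (h : ℝ → L2 Ω) (u v : ℝ → H10 Ω),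
      IsStrongSolution Ω α β b c lam mu (Ioo s t) h u v →
      IsAEPrimitive s t (fun r => Φ (u r, toL2 Ω (v r)))
        (fun r => Q (u r, toL2 Ω (v r)) + ⟪h r, X (u r, toL2 Ω (v r))⟫))
    {I : Set ℝ} (hI : IsOpen I) {h : ℝ → L2 Ω} {u : ℝ → H10 Ω}
    (hu : IsWeakSolution Ω α β b c lam mu I h u) {s t : ℝ} (hst : s < t) (hstI : Icc s t ⊆ I)
    (hh : IntegrableOn h (Ioo s t)) :
    IntervalIntegrable (fun r => Q (u r, velocity u r) + ⟪h r, X (u r, velocity u r)⟫)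
        volume s t ∧
      ∀ r ∈ Icc s t, Φ (u r, velocity u r) = Φ (u s, velocity u s) +
        ∫ ρ in s..r, (Q (u ρ, velocity u ρ) + ⟪h ρ, X (u ρ, velocity u ρ)⟫) := by
  set z : ℝ → H10 Ω × L2 Ω := fun r => (u r, velocity u r) with hz
  have hzc : ContinuousOn z (Icc s t) :=
    (hu.continuousOn.mono hstI).prodMk ((hu.continuousOn_velocity hI).mono hstI)
  have hK : IsCompact (z '' Icc s t) := isCompact_Icc.image_of_continuousOn hzc
  obtain ⟨B, hB⟩ := hK.exists_bound_of_continuousOn hX.continuousOn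
  have hB0 : 0 ≤ B := (norm_nonneg _).trans (hB _ (mem_image_of_mem z ⟨le_rfl, hst.le⟩))
  set e : ℝ → ℝ := fun r => Q (z r) + ⟪h r, X (z r)⟫ with he
  have hinner : IntegrableOn (fun r => ⟪h r, X (z r)⟫) (Ioo s t) := by
    refine Integrable.mono' (hh.norm.mul_const B) ?_ ?_
    · exact hh.aestronglyMeasurable.inner (((hX.comp_continuousOn hzc).mono
        Ioo_subset_Icc_self).aestronglyMeasurable measurableSet_Ioo)
    · filter_upwards [ae_restrict_mem measurableSet_Ioo] with r hr
      refine (norm_inner_le_norm _ _).trans ?_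
      gcongr
      exact hB _ (mem_image_of_mem z (Ioo_subset_Icc_self hr))
  have heI : IntegrableOn e (Ioo s t) :=
    (((hQ.comp_continuousOn hzc).integrableOn_Icc).mono_set Ioo_subset_Icc_self).add hinner
  have hei : IntervalIntegrable e volume s t :=
    (intervalIntegrable_iff_integrableOn_Ioo_of_le hst.le).2 heI
  refine ⟨hei, ?_⟩
  -- The identity says that `k` is constant; it is shown to lie within a multiple of `η` of a
  -- constant, for each small `η`.
  set k : ℝ → ℝ := fun r => Φ (z r) - ∫ ρ in s..r, e ρ with hk
  have hkc : ContinuousOn k (Icc s t) := by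
    have := (absolutelyContinuousOnInterval_integral hst.le hei).continuousOn
    rw [uIcc_of_le hst.le] at this
    exact (hΦ.comp_continuousOn hzc).sub this
  set A : ℝ := ∫ r in Ioo s t, ‖h r‖ with hA
  have hA0 : 0 ≤ A := integral_nonneg fun _ => norm_nonneg _
  -- The four terms of the factor come from the errors in `Φ`, in `Q`, in the forcing (paired with a
  -- vector of norm at most `B + 1`), and in `X` (paired with `h`).
  have key : ∀ η : ℝ, 0 < η → η ≤ 1 → ∃ C, ∀ r ∈ Icc s t,
      |k r - C| ≤ η * (1 + (t - s) + (B + 1) + A) := by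
    intro η hη hη1
    -- The approximants need not stay in a compact set, so continuity is used uniformly at the
    -- points of the compact trajectory of `z`, with one argument free.
    have hunif := hK.uniformContinuousAt_of_continuousAt (fun p => (Φ p, Q p, X p))
      (fun p _ => (hΦ.prodMk (hQ.prodMk hX)).continuousAt) (Metric.dist_mem_uniformity hη)
    obtain ⟨δ, hδ, hδ'⟩ := Metric.mem_uniformity_dist.1 hunif
    have hε : 0 < min (δ / 2) η := lt_min (by linarith) hη
    obtain ⟨h', u', v', hs', hclose, hL1⟩ := hu.approx s t hst hstI (min (δ / 2) η) hε
    obtain ⟨hi', C, hC⟩ := hstrong s t hst h' u' v' hs'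
    have hclose' := (ae_restrict_iff' measurableSet_Ioo).1 hclose
    have hh' : IntegrableOn h' (Ioo s t) := memLp_one_iff_integrable.1 hs'.memLp_forcing
    have hdist : ∀ᵐ r, r ∈ Ioo s t →
        |Φ (u' r, toL2 Ω (v' r)) - Φ (z r)| ≤ η ∧ |Q (u' r, toL2 Ω (v' r)) - Q (z r)| ≤ η ∧
        ‖X (u' r, toL2 Ω (v' r)) - X (z r)‖ ≤ η := by
      filter_upwards [hclose'] with r hr hrI
      have hd : dist (z r) (u' r, toL2 Ω (v' r)) < δ := by
        rw [Prod.dist_eq, dist_comm, dist_comm (z r).2, dist_eq_norm, dist_eq_norm]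
        have h1 := (hr hrI).1.trans (min_le_left _ _)
        have h2 := (hr hrI).2.trans (min_le_left _ _)
        exact max_lt (lt_of_le_of_lt h1 (by linarith)) (lt_of_le_of_lt h2 (by linarith))
      have := hδ' hd (mem_image_of_mem z (Ioo_subset_Icc_self hrI))
      change dist (Φ (z r), Q (z r), X (z r)) _ < η at this
      rw [Prod.dist_eq, Prod.dist_eq, max_lt_iff, max_lt_iff, dist_comm, dist_comm (Q (z r)),
        dist_comm (X (z r)), dist_eq_norm, dist_eq_norm, dist_eq_norm] at this
      exact ⟨this.1.le, this.2.1.le, this.2.2.le⟩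
    have hdiff : ∫ r in Ioo s t, ‖h' r - h r‖ ≤ η := by
      have hsub : Integrable (fun r => h' r - h r) (volume.restrict (Ioo s t)) := hh'.sub hh
      rw [eLpNorm_one_eq_lintegral_enorm] at hL1
      rw [integral_norm_eq_lintegral_enorm hsub.aestronglyMeasurable]
      exact ENNReal.toReal_le_of_le_ofReal hη.le
        (hL1.trans (ENNReal.ofReal_le_ofReal (min_le_right _ _)))
    set e' : ℝ → ℝ := fun r => Q (u' r, toL2 Ω (v' r)) + ⟪h' r, X (u' r, toL2 Ω (v' r))⟫ with he'
    have hee : ∀ᵐ r, r ∈ Ioo s t → ‖e' r - e r‖ ≤ η + (B + 1) * ‖h' r - h r‖ + η * ‖h r‖ := by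
      filter_upwards [hdist] with r hr hrI
      obtain ⟨-, h2, h3⟩ := hr hrI
      have hXz := hB _ (mem_image_of_mem z (Ioo_subset_Icc_self hrI))
      have hX' : ‖X (u' r, toL2 Ω (v' r))‖ ≤ B + 1 := by
        have := norm_add_le (X (u' r, toL2 Ω (v' r)) - X (z r)) (X (z r))
        rw [sub_add_cancel] at this
        linarith
      have e1 : e' r - e r = (Q (u' r, toL2 Ω (v' r)) - Q (z r)) +
          ⟪h' r - h r, X (u' r, toL2 Ω (v' r))⟫ +
          ⟪h r, X (u' r, toL2 Ω (v' r)) - X (z r)⟫ := by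
        simp only [he', he, inner_sub_left, inner_sub_right]; ring
      rw [e1]
      refine (norm_add_le _ _).trans (add_le_add ((norm_add_le _ _).trans (add_le_add h2 ?_)) ?_)
      · refine (norm_inner_le_norm _ _).trans ?_
        rw [mul_comm]
        gcongr
      · refine (norm_inner_le_norm _ _).trans ?_
        rw [mul_comm]
        gcongr
    have hint : ∀ r ∈ Icc s t, |(∫ ρ in s..r, e' ρ) - ∫ ρ in s..r, e ρ| ≤
        η * ((t - s) + (B + 1) + A) := by
      intro r hr
      rw [← intervalIntegral.integral_sub (intervalIntegrable_left hi' hr)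
        (intervalIntegrable_left hei hr)]
      have i2 : IntegrableOn (fun r => (B + 1) * ‖h' r - h r‖) (Ioo s t) :=
        (Integrable.sub hh' hh).norm.const_mul _
      have i1 : IntegrableOn (fun _ : ℝ => η) (Ioo s t) := integrable_const η
      have i3 : IntegrableOn (fun r => η * ‖h r‖) (Ioo s t) := hh.norm.const_mul _
      have hIt : ∫ r in Ioo s t, (η + (B + 1) * ‖h' r - h r‖ + η * ‖h r‖) ≤
          η * ((t - s) + (B + 1) + A) := by
        have i12 : IntegrableOn (fun r => η + (B + 1) * ‖h' r - h r‖) (Ioo s t) := i1.add i2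
        rw [integral_add i12 i3, integral_add i1 i2, integral_const_mul,
          integral_const_mul, setIntegral_const, Real.volume_real_Ioo_of_le hst.le, smul_eq_mul]
        nlinarith
      calc _ ≤ ∫ ρ in s..r, ‖e' ρ - e ρ‖ := intervalIntegral.norm_integral_le_integral_norm hr.1
        _ = ∫ ρ in Ioo s r, ‖e' ρ - e ρ‖ := by
          rw [intervalIntegral.integral_of_le hr.1, integral_Ioc_eq_integral_Ioo]
        _ ≤ ∫ ρ in Ioo s t, ‖e' ρ - e ρ‖ := by
          refine setIntegral_mono_set ?_ (Eventually.of_forall fun _ => norm_nonneg _)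
            (Ioo_subset_Ioo_right hr.2).eventuallyLE
          exact (((intervalIntegrable_iff_integrableOn_Ioo_of_le hst.le).1 hi').sub heI).norm
        _ ≤ ∫ r in Ioo s t, (η + (B + 1) * ‖h' r - h r‖ + η * ‖h r‖) := by
          refine integral_mono_ae ?_ ((i1.add i2).add i3)
            ((ae_restrict_iff' measurableSet_Ioo).2 hee)
          exact (((intervalIntegrable_iff_integrableOn_Ioo_of_le hst.le).1 hi').sub heI).norm
        _ ≤ _ := hIt
    refine ⟨C, le_on_Icc_of_ae_le hst (hkc.sub continuousOn_const).abs ?_⟩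
    filter_upwards [hdist, hC] with r h1 h2 hr
    have a1 := (h1 hr).1
    have a2 := hint r (Ioo_subset_Icc_self hr)
    rw [h2 hr] at a1
    rw [abs_le] at a1 a2 ⊢
    simp only [hk]
    constructor <;> linarith [a1.1, a1.2, a2.1, a2.2]
  have hconst : ∀ r ∈ Icc s t, k r = k s := by
    intro r hr
    set L : ℝ := 1 + (t - s) + (B + 1) + A with hL
    have hL0 : 0 < L := by rw [hL]; linarith
    have : |k r - k s| ≤ 0 := by
      refine le_of_forall_pos_le_add fun d hd => ?_
      have hη : 0 < min 1 (d / (2 * L)) := lt_min one_pos (by positivity)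
      obtain ⟨C, hC⟩ := key _ hη (min_le_left _ _)
      have a1 := hC r hr
      have a2 := hC s ⟨le_rfl, hst.le⟩
      have a3 : min 1 (d / (2 * L)) * L ≤ d / 2 := by
        calc _ ≤ d / (2 * L) * L := by gcongr; exact min_le_right _ _
          _ = d / 2 := by field_simp
      rw [abs_le] at a1 a2 ⊢
      constructor <;> linarith [a1.1, a1.2, a2.1, a2.2]
    exact sub_eq_zero.1 (abs_nonpos_iff.1 this)
  intro r hr
  have := hconst r hr
  simp only [hk, intervalIntegral.integral_same, sub_zero] at this
  linarith

theorem continuous_energy (hβ : 0 < β) :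
    Continuous fun p : H10 Ω × L2 Ω => energy Ω β b lam p.1 p.2 := by
  unfold energy
  have h1 : Continuous fun p : H10 Ω × L2 Ω => ‖grad Ω p.1‖ ^ (β + 2) :=
    ((grad Ω).continuous.comp continuous_fst).norm.rpow_const fun _ => Or.inr (by linarith)
  fun_prop

theorem continuous_energyRate (hα : 0 < α) :
    Continuous fun p : H10 Ω × L2 Ω => energyRate Ω α c mu p.2 := by
  unfold energyRate
  have h1 : Continuous fun p : H10 Ω × L2 Ω => ‖p.2‖ ^ α :=
    continuous_snd.norm.rpow_const fun _ => Or.inr hα.le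
  fun_prop

theorem continuous_virialRate (hα : 0 < α) (hβ : 0 < β) :
    Continuous fun p : H10 Ω × L2 Ω => virialRate Ω α β b c lam mu p.1 p.2 := by
  unfold virialRate
  have h1 : Continuous fun p : H10 Ω × L2 Ω => ‖grad Ω p.1‖ ^ β :=
    ((grad Ω).continuous.comp continuous_fst).norm.rpow_const fun _ => Or.inr hβ.le
  have h2 : Continuous fun p : H10 Ω × L2 Ω => ‖p.2‖ ^ α :=
    continuous_snd.norm.rpow_const fun _ => Or.inr hα.le
  have h3 : Continuous fun p : H10 Ω × L2 Ω => ⟪p.2, toL2 Ω p.1⟫ :=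
    continuous_snd.inner ((toL2 Ω).continuous.comp continuous_fst)
  fun_prop

/-- The energy identity for weak solutions. -/
theorem IsWeakSolution.energy_identity (hα : 0 < α) (hβ : 0 < β) {I : Set ℝ} (hI : IsOpen I)
    {h : ℝ → L2 Ω} {u : ℝ → H10 Ω} (hu : IsWeakSolution Ω α β b c lam mu I h u) {s t : ℝ}
    (hst : s < t) (hstI : Icc s t ⊆ I) (hh : IntegrableOn h (Ioo s t)) :
    IntervalIntegrable (fun r => energyRate Ω α c mu (velocity u r) + ⟪h r, velocity u r⟫)
        volume s t ∧
      ∀ r ∈ Icc s t, energy Ω β b lam (u r) (velocity u r) =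
        energy Ω β b lam (u s) (velocity u s) +
        ∫ ρ in s..r, (energyRate Ω α c mu (velocity u ρ) + ⟪h ρ, velocity u ρ⟫) :=
  hu.identity (continuous_energy hβ) (continuous_energyRate hα) continuous_snd
    (fun _ _ hst _ _ _ h => (h.identities hβ hst).1) hI hst hstI hh

/-- The virial identity for weak solutions. -/
theorem IsWeakSolution.virial_identity (hα : 0 < α) (hβ : 0 < β) {I : Set ℝ} (hI : IsOpen I)
    {h : ℝ → L2 Ω} {u : ℝ → H10 Ω} (hu : IsWeakSolution Ω α β b c lam mu I h u) {s t : ℝ}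
    (hst : s < t) (hstI : Icc s t ⊆ I) (hh : IntegrableOn h (Ioo s t)) :
    IntervalIntegrable (fun r => virialRate Ω α β b c lam mu (u r) (velocity u r)
        + ⟪h r, toL2 Ω (u r)⟫) volume s t ∧
      ∀ r ∈ Icc s t, ⟪velocity u r, toL2 Ω (u r)⟫ = ⟪velocity u s, toL2 Ω (u s)⟫ +
        ∫ ρ in s..r, (virialRate Ω α β b c lam mu (u ρ) (velocity u ρ) + ⟪h ρ, toL2 Ω (u ρ)⟫) :=
  hu.identity (Φ := fun p => ⟪p.2, toL2 Ω p.1⟫)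
    (continuous_snd.inner ((toL2 Ω).continuous.comp continuous_fst))
    (continuous_virialRate hα hβ) ((toL2 Ω).continuous.comp continuous_fst)
    (fun _ _ hst _ _ _ h => (h.identities hβ hst).2) hI hst hstI hh

end Weak

/-! ### Differential inequalities for a modified energy. -/

section Lyapunov

theorem exists_pos_bounds {f : ℝ → ℝ} {s t : ℝ} (hf : ContinuousOn f (Icc s t)) (hst : s ≤ t)
    (hpos : ∀ r ∈ Icc s t, 0 < f r) : ∃ m M, 0 < m ∧ ∀ r ∈ Icc s t, f r ∈ Icc m M := by
  obtain ⟨x, hx, hmin⟩ := isCompact_Icc.exists_isMinOn ⟨s, ⟨le_rfl, hst⟩⟩ hf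
  obtain ⟨y, hy, hmax⟩ := isCompact_Icc.exists_isMaxOn ⟨s, ⟨le_rfl, hst⟩⟩ hf
  exact ⟨f x, f y, hpos x hx, fun r hr => ⟨hmin hr, hmax hr⟩⟩

/-- The composition of a positive absolutely continuous function with a power. -/
theorem ac_rpow {f : ℝ → ℝ} {s t : ℝ} (hst : s ≤ t) (hf : AbsolutelyContinuousOnInterval f s t)
    (hpos : ∀ r ∈ Icc s t, 0 < f r) (p : ℝ) :
    AbsolutelyContinuousOnInterval (fun r => f r ^ p) s t := by
  have hc := hf.continuousOn
  rw [uIcc_of_le hst] at hc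
  obtain ⟨m, M, hm, h⟩ := exists_pos_bounds hc hst hpos
  refine ac_comp_contDiffOn (ψ := fun z => z ^ p) (m := m) (M := M) hf
    (fun r hr => h r (by rwa [uIcc_of_le hst] at hr)) ?_
  intro z hz
  exact (Real.contDiffAt_rpow_const_of_ne (hm.trans_le hz.1).ne').contDiffWithinAt

/-- Comparison with the equation `Φ' = -κ Φ^(1+γ) + K`: a universal bound. -/
theorem le_of_deriv_le_neg_rpow {Φ f : ℝ → ℝ} {s t γ κ K : ℝ} (hst : s < t) (hγ : 0 < γ)
    (hκ : 0 < κ) (hK : 0 ≤ K) (hΦ : AbsolutelyContinuousOnInterval Φ s t)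
    (hpos : ∀ r ∈ Icc s t, 0 < Φ r)
    (hd : ∀ᵐ r, r ∈ Ioo s t → HasDerivAt Φ (f r) r ∧ f r ≤ -κ * Φ r ^ (1 + γ) + K) :
    Φ t ≤ (γ * κ / 2) ^ (-(1 / γ)) * (t - s) ^ (-(1 / γ)) + (2 * K / κ) ^ (1 / (1 + γ)) := by
  -- Above the level `L` the constant `K` is at most half of `κ Φ^(1+γ)`.
  set L : ℝ := (2 * K / κ) ^ (1 / (1 + γ)) with hL
  have hL0 : 0 ≤ L := Real.rpow_nonneg (by positivity) _
  have hcont := hΦ.continuousOn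
  rw [uIcc_of_le hst.le] at hcont
  have hZac := ac_rpow hst.le hΦ hpos (-γ)
  -- While `Φ > L`, the function `Φ^(-γ)` has derivative at least `γκ/2`.
  have hgrow : ∀ q ∈ Ico s t, (∀ r ∈ Ioo q t, L < Φ r) →
      γ * κ / 2 * (t - q) ≤ Φ t ^ (-γ) - Φ q ^ (-γ) := by
    intro q hq hq'
    have hsub : uIcc q t ⊆ uIcc s t := by
      rw [uIcc_of_le hq.2.le, uIcc_of_le hst.le]; exact Icc_subset_Icc_left hq.1
    have hderiv : ∀ᵐ r, r ∈ Ioo q t →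
        HasDerivAt (fun r => Φ r ^ (-γ)) (f r * (-γ) * Φ r ^ (-γ - 1)) r := by
      filter_upwards [hd] with r hr hrI
      have hrs : r ∈ Ioo s t := ⟨hq.1.trans_lt hrI.1, hrI.2⟩
      exact (hr hrs).1.rpow_const (Or.inl (hpos r (Ioo_subset_Icc_self hrs)).ne')
    obtain ⟨hi, hint⟩ := eq_add_integral_of_ac_real hq.2.le (hZac.mono hsub) hderiv
    have h1 := hint t ⟨hq.2.le, le_rfl⟩
    rw [h1, add_sub_cancel_left]
    have h2 : ∫ _ in q..t, γ * κ / 2 = γ * κ / 2 * (t - q) := by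
      rw [intervalIntegral.integral_const, smul_eq_mul, mul_comm]
    rw [← h2]
    refine intervalIntegral.integral_mono_ae_restrict hq.2.le intervalIntegrable_const hi ?_
    rw [Measure.restrict_congr_set Ioo_ae_eq_Icc.symm]
    refine (ae_restrict_iff' measurableSet_Ioo).2 ?_
    filter_upwards [hd] with r hr hrI
    have hrs : r ∈ Ioo s t := ⟨hq.1.trans_lt hrI.1, hrI.2⟩
    have hΦr := hpos r (Ioo_subset_Icc_self hrs)
    have hlev : 2 * K ≤ κ * Φ r ^ (1 + γ) := by
      have := Real.rpow_le_rpow hL0 (hq' r hrI).le (z := 1 + γ) (by linarith)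
      rw [hL, ← Real.rpow_mul (by positivity), one_div, inv_mul_cancel₀ (by linarith),
        Real.rpow_one, div_le_iff₀ hκ] at this
      linarith
    have hf := (hr hrs).2
    have hf2 : κ / 2 * Φ r ^ (1 + γ) ≤ -f r := by linarith
    have hpow : Φ r ^ (1 + γ) * Φ r ^ (-γ - 1) = 1 := by
      rw [← Real.rpow_add hΦr, show 1 + γ + (-γ - 1) = 0 by ring, Real.rpow_zero]
    have hp0 : 0 ≤ γ * Φ r ^ (-γ - 1) := by positivity
    calc γ * κ / 2 = κ / 2 * Φ r ^ (1 + γ) * (γ * Φ r ^ (-γ - 1)) := by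
          rw [show κ / 2 * Φ r ^ (1 + γ) * (γ * Φ r ^ (-γ - 1)) =
            γ * κ / 2 * (Φ r ^ (1 + γ) * Φ r ^ (-γ - 1)) by ring, hpow, mul_one]
      _ ≤ -f r * (γ * Φ r ^ (-γ - 1)) := by gcongr
      _ = _ := by ring
  have htt : t ∈ Icc s t := ⟨hst.le, le_rfl⟩
  have hA0 : 0 ≤ (γ * κ / 2) ^ (-(1 / γ)) * (t - s) ^ (-(1 / γ)) :=
    mul_nonneg (Real.rpow_nonneg (by positivity) _) (Real.rpow_nonneg (by linarith) _)
  by_cases hlow : Φ t ≤ L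
  · linarith
  rw [not_le] at hlow
  by_cases hne : ∃ r ∈ Icc s t, Φ r ≤ L
  · have hcl : IsClosed (Icc s t ∩ Φ ⁻¹' Iic L) := hcont.preimage_isClosed_of_isClosed isClosed_Icc
      isClosed_Iic
    have hcomp : IsCompact (Icc s t ∩ Φ ⁻¹' Iic L) :=
      isCompact_Icc.of_isClosed_subset hcl inter_subset_left
    have hmem := hcomp.sSup_mem (by obtain ⟨r, hr, hr'⟩ := hne; exact ⟨r, hr, hr'⟩)
    -- After the last time `q` with `Φ ≤ L`, the growth of `Φ^(-γ)` gives `Φ t < Φ q ≤ L`, a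
    -- contradiction.
    set q := sSup (Icc s t ∩ Φ ⁻¹' Iic L) with hqdef
    have hqL : Φ q ≤ L := hmem.2
    have hqt : q < t := by
      refine lt_of_le_of_ne hmem.1.2 fun h => ?_
      rw [h] at hqL
      linarith
    have := hgrow q ⟨hmem.1.1, hqt⟩ fun r hr => by
      by_contra hr'
      have : r ≤ q := le_csSup hcomp.bddAbove
        ⟨⟨hmem.1.1.trans hr.1.le, hr.2.le⟩, not_lt.1 hr'⟩
      linarith [hr.1]
    have hpos' : 0 < γ * κ / 2 * (t - q) := mul_pos (by positivity) (by linarith)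
    have hZ : Φ q ^ (-γ) < Φ t ^ (-γ) := by linarith
    have := (Real.rpow_lt_rpow_iff_of_neg (hpos q hmem.1) (hpos t htt)
      (neg_lt_zero.2 hγ)).1 hZ
    linarith
  · push Not at hne
    have h1 := hgrow s ⟨le_rfl, hst⟩ fun r hr => hne r (Ioo_subset_Icc_self hr)
    -- Only the sign of `Φ s ^ (-γ)` is used, so the bound does not depend on the initial value.
    have h2 : 0 < Φ s ^ (-γ) := Real.rpow_pos_of_pos (hpos s ⟨le_rfl, hst.le⟩) _
    have h3 : 0 < γ * κ / 2 * (t - s) := mul_pos (by positivity) (by linarith)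
    have h4 : γ * κ / 2 * (t - s) ≤ Φ t ^ (-γ) := by linarith
    have h5 := Real.rpow_le_rpow_of_nonpos h3 h4 (z := -(1 / γ)) (by
      rw [neg_nonpos]; positivity)
    rw [← Real.rpow_mul (hpos t htt).le, show -γ * -(1 / γ) = 1 by field_simp, Real.rpow_one,
      Real.mul_rpow (by positivity) (by linarith)] at h5
    linarith

/-- Decay of an energy `E` with `E' = e`, controlled through the modified energy `E + ε E^γ P`, where
`P' = d`. -/
theorem exists_decay_of_lyapunov {γ C₁ k₁ k₂ C₂ : ℝ} (hγ : 0 < γ) (hC₁ : 0 ≤ C₁) (hk₁ : 0 < k₁)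
    (hk₂ : 0 < k₂) (hC₂ : 0 ≤ C₂) :
    ∃ A B : ℝ, 0 ≤ A ∧ 0 ≤ B ∧ ∀ (K : ℝ), 0 ≤ K → ∀ (s t : ℝ), s < t → ∀ E e P d X : ℝ → ℝ,
      IntervalIntegrable e volume s t → (∀ r ∈ Icc s t, E r = E s + ∫ ρ in s..r, e ρ) →
      IntervalIntegrable d volume s t → (∀ r ∈ Icc s t, P r = P s + ∫ ρ in s..r, d ρ) →
      (∀ r ∈ Icc s t, 0 < E r) → (∀ r ∈ Icc s t, |E r ^ γ * P r| ≤ C₁ * E r) →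
      (∀ r, 0 ≤ X r) →
      (∀ᵐ r, r ∈ Ioo s t → e r ≤ -k₁ * X r + K ∧
        E r ^ γ * d r ≤ -k₂ * E r ^ (1 + γ) + C₂ * (X r + K)) →
      E t ≤ A * (t - s) ^ (-(1 / γ)) + B * K ^ (1 / (1 + γ)) := by
  -- The three conditions serve, in order, to make `Φ` comparable with `E`, to keep the factor `1 +
  -- θ` in front of `e` between `1/2` and `3/2`, and to absorb `ε C₂ X` into half of the
  -- dissipation.
  obtain ⟨ε, hε, hε1, hε2, hε3⟩ : ∃ ε : ℝ, 0 < ε ∧ ε * C₁ ≤ 1 / 2 ∧ ε * (γ * C₁) ≤ 1 / 2 ∧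
      ε * C₂ ≤ k₁ / 2 := by
    have hsm : ∀ D q : ℝ, 0 ≤ D → 0 < q → ∃ ε : ℝ, 0 < ε ∧ ∀ ε', 0 < ε' → ε' ≤ ε → ε' * D ≤ q := by
      intro D q hD hq
      refine ⟨q / (D + 1), by positivity, fun ε' h0 h => ?_⟩
      calc ε' * D ≤ q / (D + 1) * (D + 1) := by gcongr; linarith
        _ = q := by field_simp
    obtain ⟨a1, p1, h1⟩ := hsm C₁ (1 / 2) hC₁ (by norm_num)
    obtain ⟨a2, p2, h2⟩ := hsm (γ * C₁) (1 / 2) (by positivity) (by norm_num)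
    obtain ⟨a3, p3, h3⟩ := hsm C₂ (k₁ / 2) hC₂ (by positivity)
    have hp : 0 < min a1 (min a2 a3) := lt_min p1 (lt_min p2 p3)
    exact ⟨min a1 (min a2 a3), hp, h1 _ hp (min_le_left _ _),
      h2 _ hp ((min_le_right _ _).trans (min_le_left _ _)),
      h3 _ hp ((min_le_right _ _).trans (min_le_right _ _))⟩
  -- The power of `2/3` comes from `Φ ≤ (3/2) E`; the factors `2` in the witnesses below come from
  -- `E ≤ 2 Φ`.
  set κ : ℝ := ε * k₂ * (2 / 3) ^ (1 + γ) with hκ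
  have hκ0 : 0 < κ := by positivity
  refine ⟨2 * (γ * κ / 2) ^ (-(1 / γ)), 2 * (2 * (3 / 2 + k₁ / 2) / κ) ^ (1 / (1 + γ)),
    by positivity, by positivity, ?_⟩
  intro K hK s t hst E e P d X he hE hd hP hEpos hEP hX hineq
  have hid : ∀ {f : ℝ → ℝ} {g : ℝ → ℝ}, IntervalIntegrable g volume s t →
      (∀ r ∈ Icc s t, f r = f s + ∫ ρ in s..r, g ρ) → AbsolutelyContinuousOnInterval f s t := by
    intro f g hg hf
    refine absolutelyContinuousOnInterval_of_dist_le hst.le hg.norm fun x hx y hy hxy => ?_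
    have := norm_sub_le_integral hg hf hx hy
    rwa [abs_of_nonneg (intervalIntegral.integral_nonneg hxy fun _ _ => norm_nonneg _),
      ← dist_eq_norm, dist_comm] at this
  have hEac := hid he hE
  have hPac := hid hd hP
  have hΦac := hEac.add (((ac_rpow hst.le hEac hEpos γ).mul hPac).const_mul ε)
  have hθ : ∀ r ∈ Icc s t, |ε * (E r ^ γ * P r)| ≤ E r / 2 := by
    intro r hr
    rw [abs_mul, abs_of_pos hε]
    calc _ ≤ ε * (C₁ * E r) := by gcongr; exact hEP r hr
      _ = ε * C₁ * E r := by ring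
      _ ≤ 1 / 2 * E r := by
        have := (hEpos r hr).le
        gcongr
      _ = _ := by ring
  set Φ : ℝ → ℝ := fun r => E r + ε * (E r ^ γ * P r) with hΦ
  have hΦl : ∀ r ∈ Icc s t, E r / 2 ≤ Φ r := fun r hr => by
    have := (abs_le.1 (hθ r hr)).1; simp only [hΦ]; linarith
  have hΦu : ∀ r ∈ Icc s t, Φ r ≤ 3 / 2 * E r := fun r hr => by
    have := (abs_le.1 (hθ r hr)).2; simp only [hΦ]; linarith
  have hmain := le_of_deriv_le_neg_rpow (Φ := Φ)
    (f := fun r => e r + ε * (e r * γ * E r ^ (γ - 1) * P r + E r ^ γ * d r)) hst hγ hκ0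
    (K := (3 / 2 + k₁ / 2) * K) (by positivity) hΦac
    (fun r hr => by have := hΦl r hr; have := hEpos r hr; linarith) (by
      filter_upwards [ae_hasDerivAt_of_eq_add_integral hst.le he hE,
        ae_hasDerivAt_of_eq_add_integral hst.le hd hP, hineq] with r h1 h2 h3 hr
      have hrI := Ioo_subset_Icc_self hr
      have hE0 := hEpos r hrI
      refine ⟨(h1 hr).add ((((h1 hr).rpow_const (Or.inl hE0.ne')).mul (h2 hr)).const_mul ε), ?_⟩
      obtain ⟨g1, g2⟩ := h3 hr
      -- Differentiating the factor `E^γ` in `ε E^γ P` contributes `θ e`, so `Φ' = (1 + θ) e + ε E^γ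
      -- d`.
      set θ : ℝ := ε * γ * (E r ^ (γ - 1) * P r) with hθdef
      have hθ1 : |θ| ≤ 1 / 2 := by
        have e1 : E r * θ = ε * γ * (E r ^ γ * P r) := by
          rw [hθdef, Real.rpow_sub_one hE0.ne']; field_simp
        have e2 : E r * |θ| ≤ E r * (1 / 2) := by
          rw [← abs_of_pos hE0, ← abs_mul, abs_of_pos hE0, e1, abs_mul,
            abs_of_pos (by positivity : 0 < ε * γ)]
          calc _ ≤ ε * γ * (C₁ * E r) := by gcongr; exact hEP r hrI
            _ = ε * (γ * C₁) * E r := by ring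
            _ ≤ 1 / 2 * E r := by gcongr
            _ = _ := mul_comm _ _
        exact le_of_mul_le_mul_left e2 hE0
      obtain ⟨t1, t2⟩ := abs_le.1 hθ1
      have hXr := hX r
      have hpow : (2 / 3 : ℝ) ^ (1 + γ) * Φ r ^ (1 + γ) ≤ E r ^ (1 + γ) := by
        have hl := hΦl r hrI
        have hu := hΦu r hrI
        rw [← Real.mul_rpow (by norm_num) (by linarith)]
        exact Real.rpow_le_rpow (by linarith) (by linarith) (by linarith)
      have a1 : (1 + θ) * e r ≤ (1 + θ) * (-k₁ * X r + K) :=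
        mul_le_mul_of_nonneg_left g1 (by linarith)
      have a2 : ε * (E r ^ γ * d r) ≤ ε * (-k₂ * E r ^ (1 + γ) + C₂ * (X r + K)) :=
        mul_le_mul_of_nonneg_left g2 hε.le
      have a3 : (1 + θ) * (k₁ * X r) ≥ 1 / 2 * (k₁ * X r) :=
        mul_le_mul_of_nonneg_right (by linarith) (by positivity)
      have a4 : (1 + θ) * K ≤ 3 / 2 * K := mul_le_mul_of_nonneg_right (by linarith) hK
      have a5 : ε * C₂ * (X r + K) ≤ k₁ / 2 * (X r + K) :=
        mul_le_mul_of_nonneg_right hε3 (by linarith)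
      have a6 : ε * k₂ * ((2 / 3 : ℝ) ^ (1 + γ) * Φ r ^ (1 + γ)) ≤ ε * k₂ * E r ^ (1 + γ) :=
        mul_le_mul_of_nonneg_left hpow (by positivity)
      have a7 : e r + ε * (e r * γ * E r ^ (γ - 1) * P r + E r ^ γ * d r) =
          (1 + θ) * e r + ε * (E r ^ γ * d r) := by rw [hθdef]; ring
      rw [a7, hκ]
      nlinarith)
  have hfin := hΦl t ⟨hst.le, le_rfl⟩
  rw [show 2 * ((3 / 2 + k₁ / 2) * K) / κ = 2 * (3 / 2 + k₁ / 2) / κ * K by ring,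
    Real.mul_rpow (by positivity) hK] at hmain
  linarith

end Lyapunov

/-! ### Young-type inequalities and the choice of constants. -/

section Inequalities

/-- Young's inequality for powers. -/
theorem exists_mul_rpow_le {γ σ η a : ℝ} (hγ : 0 < γ) (hσ : 0 ≤ σ) (hσ1 : σ < 1) (hη : 0 < η)
    (ha : 0 ≤ a) : ∃ C : ℝ, 0 ≤ C ∧ ∀ X z : ℝ, 0 < X → 0 ≤ z →
      a * (X ^ (γ + σ) * z) ≤ η * X ^ (1 + γ) + C * z ^ ((1 + γ) / (1 - σ)) := by
  have h1σ : 0 < 1 - σ := by linarith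
  set η' : ℝ := η / (a + 1) with hη'
  have hη0 : 0 < η' := by positivity
  refine ⟨a * (η'⁻¹) ^ ((γ + σ) / (1 - σ)), by positivity, fun X z hX hz => ?_⟩
  have ha' : a * η' ≤ η := by
    calc a * η' ≤ (a + 1) * η' := by gcongr; linarith
      _ = η := by rw [hη']; field_simp
  have hX1 : 0 < X ^ (1 + γ) := Real.rpow_pos_of_pos hX _
  -- Either `z` is small relative to `X^(1-σ)` and the product is absorbed by `X^(1+γ)`, or `X` is
  -- bounded by a power of `z`.
  by_cases h : z ≤ η' * X ^ (1 - σ)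
  · have : X ^ (γ + σ) * z ≤ η' * X ^ (1 + γ) := by
      calc X ^ (γ + σ) * z ≤ X ^ (γ + σ) * (η' * X ^ (1 - σ)) := by gcongr
        _ = η' * (X ^ (γ + σ) * X ^ (1 - σ)) := by ring
        _ = η' * X ^ (1 + γ) := by rw [← Real.rpow_add hX]; congr 2; ring
    calc a * (X ^ (γ + σ) * z) ≤ a * (η' * X ^ (1 + γ)) := by gcongr
      _ = a * η' * X ^ (1 + γ) := by ring
      _ ≤ η * X ^ (1 + γ) := by gcongr
      _ ≤ _ := le_add_of_nonneg_right (by positivity)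
  · rw [not_le] at h
    have hz0 : 0 < z := lt_of_le_of_lt (by positivity) h
    have h1 : X ^ (1 - σ) ≤ η'⁻¹ * z := by
      rw [inv_mul_eq_div, le_div_iff₀ hη0, mul_comm]; exact h.le
    have h2 : X ^ (γ + σ) ≤ (η'⁻¹) ^ ((γ + σ) / (1 - σ)) * z ^ ((γ + σ) / (1 - σ)) := by
      rw [← Real.mul_rpow (by positivity) hz]
      calc X ^ (γ + σ) = (X ^ (1 - σ)) ^ ((γ + σ) / (1 - σ)) := by
            rw [← Real.rpow_mul hX.le]; congr 1; field_simp
        _ ≤ _ := Real.rpow_le_rpow (by positivity) h1 (by positivity)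
    have h3 : z ^ ((γ + σ) / (1 - σ)) * z = z ^ ((1 + γ) / (1 - σ)) := by
      rw [← Real.rpow_add_one hz0.ne']; congr 1; field_simp; ring
    calc a * (X ^ (γ + σ) * z)
        ≤ a * ((η'⁻¹) ^ ((γ + σ) / (1 - σ)) * z ^ ((γ + σ) / (1 - σ)) * z) := by gcongr
      _ = a * (η'⁻¹) ^ ((γ + σ) / (1 - σ)) * (z ^ ((γ + σ) / (1 - σ)) * z) := by ring
      _ = a * (η'⁻¹) ^ ((γ + σ) / (1 - σ)) * z ^ ((1 + γ) / (1 - σ)) := by rw [h3]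
      _ ≤ _ := le_add_of_nonneg_left (by positivity)

/-- Beyond the radius `R` at which `R^(q-D) = η'` the lower power is absorbed by the higher one;
below `R` it is bounded by a constant. -/
theorem exists_mul_rpow_le_add {q D η a : ℝ} (hq : 0 ≤ q) (hqD : q < D) (hη : 0 < η)
    (ha : 0 ≤ a) : ∃ C : ℝ, 0 ≤ C ∧ ∀ y : ℝ, 0 ≤ y → a * y ^ q ≤ η * y ^ D + C := by
  set η' : ℝ := η / (a + 1) with hη'
  have hη0 : 0 < η' := by positivity
  have hDq : 0 < D - q := by linarith
  set R : ℝ := η' ^ (-(1 / (D - q))) with hR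
  have hR0 : 0 < R := Real.rpow_pos_of_pos hη0 _
  refine ⟨a * R ^ q, by positivity, fun y hy => ?_⟩
  have ha' : a * η' ≤ η := by
    calc a * η' ≤ (a + 1) * η' := by gcongr; linarith
      _ = η := by rw [hη']; field_simp
  rcases le_or_gt y R with h | h
  · calc a * y ^ q ≤ a * R ^ q := by gcongr
      _ ≤ _ := le_add_of_nonneg_left (by positivity)
  · have hy0 : 0 < y := hR0.trans h
    have h1 : y ^ (q - D) ≤ η' := by
      calc y ^ (q - D) ≤ R ^ (q - D) :=
            Real.rpow_le_rpow_of_nonpos hR0 h.le (by linarith)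
        _ = η' := by
          rw [hR, ← Real.rpow_mul hη0.le, show -(1 / (D - q)) * (q - D) = 1 by
            rw [show q - D = -(D - q) by ring]; field_simp, Real.rpow_one]
    have h2 : y ^ q ≤ η' * y ^ D := by
      calc y ^ q = y ^ (q - D) * y ^ D := by rw [← Real.rpow_add hy0]; congr 1; ring
        _ ≤ _ := by gcongr
    calc a * y ^ q ≤ a * (η' * y ^ D) := by gcongr
      _ = a * η' * y ^ D := by ring
      _ ≤ η * y ^ D := by gcongr
      _ ≤ _ := le_add_of_nonneg_right (by positivity)

theorem rpow_le_rpow_add_one {x q r : ℝ} (hx : 0 ≤ x) (hq : 0 ≤ q) (hqr : q ≤ r) :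
    x ^ q ≤ x ^ r + 1 := by
  rcases le_total x 1 with h | h
  · exact (Real.rpow_le_one hx h hq).trans (le_add_of_nonneg_left (by positivity))
  · exact (Real.rpow_le_rpow_of_exponent_le h hqr).trans (le_add_of_nonneg_right zero_le_one)

theorem rpow_mul_sq {x α : ℝ} (hx : 0 ≤ x) (hα : 0 < α) : x ^ α * x ^ 2 = x ^ (α + 2) := by
  rw [Real.rpow_add' hx (by linarith), Real.rpow_two]

theorem le_const_mul_rpow {k y E D : ℝ} (hk : 0 < k) (hy : 0 ≤ y) (hD : 0 < D)
    (h : k * y ^ D ≤ E) : y ≤ (k⁻¹) ^ (1 / D) * E ^ (1 / D) := by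
  have hE : 0 ≤ E := le_trans (by positivity) h
  have h1 : y ^ D ≤ k⁻¹ * E := by rw [inv_mul_eq_div, le_div_iff₀ hk, mul_comm]; exact h
  rw [← Real.mul_rpow (by positivity) hE]
  calc y = (y ^ D) ^ (1 / D) := by
        rw [← Real.rpow_mul hy, mul_one_div_cancel hD.ne', Real.rpow_one]
    _ ≤ _ := Real.rpow_le_rpow (by positivity) h1 (by positivity)

/-- The exponent conditions satisfied by the decay rate. -/
theorem exponent_conditions {α β γ : ℝ} (hα : 0 < α) (hαβ : α < β)
    (hγ : γ = min (α / 2) ((β - α) / ((α + 1) * (β + 2)))) :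
    0 < γ ∧ 2 * γ ≤ α ∧ γ + 1 / 2 + 1 / (β + 2) ≤ 1 ∧
      (α + 1) * ((1 + γ) / (1 - 1 / (β + 2))) ≤ α + 2 := by
  have hβ : 0 < β := hα.trans hαβ
  have hγ0 : 0 < γ := by
    rw [hγ]; exact lt_min (by linarith) (div_pos (by linarith) (by positivity))
  have h1 : 2 * γ ≤ α := by
    have : γ ≤ α / 2 := hγ ▸ min_le_left _ _
    linarith
  have h2 : γ * ((α + 1) * (β + 2)) ≤ β - α := by
    have : γ ≤ (β - α) / ((α + 1) * (β + 2)) := hγ ▸ min_le_right _ _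
    rwa [le_div_iff₀ (by positivity)] at this
  refine ⟨hγ0, h1, ?_, ?_⟩
  -- This is no further restriction on `γ`: if it failed, `βγ ≤ αγ(β+2)` and `h2` would give
  -- `2(β+2)γ ≤ β - α + 2γ ≤ β`.
  · have h3 : 2 * ((β + 2) * γ) ≤ β := by
      by_contra hcon
      rw [not_le] at hcon
      have a1 : γ * (β + 2) * (2 * γ) ≤ γ * (β + 2) * α := by gcongr
      have a2 : β * γ ≤ 2 * ((β + 2) * γ) * γ := by gcongr
      nlinarith
    have h4 : γ + 1 / 2 + 1 / (β + 2) - 1 = (2 * ((β + 2) * γ) - β) / (2 * (β + 2)) := by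
      field_simp; ring
    have h5 : (2 * ((β + 2) * γ) - β) / (2 * (β + 2)) ≤ 0 :=
      div_nonpos_of_nonpos_of_nonneg (by linarith) (by positivity)
    linarith
  · have e : (α + 1) * ((1 + γ) / (1 - 1 / (β + 2))) =
        (α + 1) * (1 + γ) * (β + 2) / (β + 1) := by
      have : (1 : ℝ) - 1 / (β + 2) = (β + 1) / (β + 2) := by field_simp; ring
      rw [this]; field_simp
    rw [e, div_le_iff₀ (by linarith)]
    nlinarith

set_option maxHeartbeats 1000000 in
/-- The Lyapunov inequalities behind the universal bound. -/
theorem exists_lyapunov_constants {α β b c lam mu C₀ M γ : ℝ} (hα : 0 < α) (hαβ : α < β)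
    (hb : 0 < b) (hc : 0 < c) (hC₀ : 0 ≤ C₀) (hM : 0 ≤ M)
    (hγ : γ = min (α / 2) ((β - α) / ((α + 1) * (β + 2)))) :
    ∃ K₀ k₀ C₁ k₁ k₂ C₂ K : ℝ, 0 < k₀ ∧ 0 ≤ C₁ ∧ 0 < k₁ ∧ 0 < k₂ ∧ 0 ≤ C₂ ∧ 0 ≤ K ∧
      ∀ x y p P hv hu E : ℝ, 0 ≤ x → 0 ≤ y → 0 ≤ p → p ≤ C₀ * y → |P| ≤ x * p → |hv| ≤ M * x →
        |hu| ≤ M * p →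
        E = x ^ 2 / 2 + y ^ 2 / 2 + b / (β + 2) * y ^ (β + 2) - lam / 2 * p ^ 2 + K₀ →
        0 < E ∧ k₀ * (x ^ 2 + y ^ (β + 2)) ≤ E ∧ |E ^ γ * P| ≤ C₁ * E ∧
        -(c * x ^ α * x ^ 2) + mu * x ^ 2 + hv ≤ -k₁ * x ^ (α + 2) + K ∧
        E ^ γ * (x ^ 2 - y ^ 2 - b * y ^ β * y ^ 2 - c * x ^ α * P + lam * p ^ 2 + mu * P + hu) ≤
          -k₂ * E ^ (1 + γ) + C₂ * (x ^ (α + 2) + K) := by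
  have hβ : 0 < β := hα.trans hαβ
  obtain ⟨hγ0, hγα, hγ1, hγ2⟩ := exponent_conditions hα hαβ hγ
  have hD : 0 < β + 2 := by linarith
  have hbD : 0 < b / (2 * (β + 2)) := by positivity
  -- `A₁` handles the `λ` term of the energy, `A₂` and `A₃` the `μ` and forcing terms of its
  -- derivative (leaving `c/2` of the damping), `A₄` and `A₅` the lower-order terms of the virial.
  obtain ⟨A₁, hA₁, HA₁⟩ := exists_mul_rpow_le_add (q := 2) (D := β + 2) (η := b / (2 * (β + 2)))
    (a := |lam| / 2 * C₀ ^ 2) (by norm_num) (by linarith) hbD (by positivity)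
  obtain ⟨A₂, hA₂, HA₂⟩ := exists_mul_rpow_le_add (q := 2) (D := α + 2) (η := c / 4)
    (a := |mu|) (by norm_num) (by linarith) (by positivity) (by positivity)
  obtain ⟨A₃, hA₃, HA₃⟩ := exists_mul_rpow_le_add (q := 1) (D := α + 2) (η := c / 4)
    (a := M) (by norm_num) (by linarith) (by positivity) hM
  obtain ⟨A₄, hA₄, HA₄⟩ := exists_mul_rpow_le_add (q := 2) (D := β + 2) (η := b / 4)
    (a := 3 / 2 * |lam| * C₀ ^ 2 + |mu| * C₀) (by norm_num) (by linarith) (by positivity)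
    (by positivity)
  obtain ⟨A₅, hA₅, HA₅⟩ := exists_mul_rpow_le_add (q := 1) (D := β + 2) (η := b / 4)
    (a := M * C₀) (by norm_num) (by linarith) (by positivity) (by positivity)
  -- The extra `1` gives `E ≥ 1`, so that powers of `E` increase with the exponent.
  set K₀ : ℝ := A₁ + 1 with hK₀
  set k₀ : ℝ := min (1 / 2) (b / (2 * (β + 2))) with hk₀
  have hk₀0 : 0 < k₀ := lt_min (by norm_num) hbD
  set cx : ℝ := (k₀⁻¹) ^ (1 / 2 : ℝ) with hcx
  set cy : ℝ := (k₀⁻¹) ^ (1 / (β + 2)) with hcy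
  have hcx0 : 0 ≤ cx := by positivity
  have hcy0 : 0 ≤ cy := by positivity
  -- In the virial, `x²` is written as `-x²/2 + (3/2) x²`, the first term being the kinetic part of
  -- `-E`.
  set B₁ : ℝ := 3 / 2 + |mu| * C₀ with hB₁
  set B₂ : ℝ := K₀ + A₄ + A₅ with hB₂
  have hB₁0 : 0 ≤ B₁ := by positivity
  have hB₂0 : 0 ≤ B₂ := by positivity
  -- Three shares of `1/6` leave half of `E^(1+γ)`, which is `k₂`.
  obtain ⟨G₁, hG₁, HG₁⟩ := exists_mul_rpow_le (γ := γ) (σ := 0) (η := 1 / 6) (a := B₁) hγ0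
    le_rfl one_pos (by norm_num) hB₁0
  obtain ⟨G₂, hG₂, HG₂⟩ := exists_mul_rpow_le (γ := γ) (σ := 0) (η := 1 / 6) (a := B₂) hγ0
    le_rfl one_pos (by norm_num) hB₂0
  have hσ : 1 / (β + 2) < 1 := by rw [div_lt_one hD]; linarith
  obtain ⟨G₃, hG₃, HG₃⟩ := exists_mul_rpow_le (γ := γ) (σ := 1 / (β + 2)) (η := 1 / 6)
    (a := c * C₀ * cy) hγ0 (by positivity) hσ (by norm_num) (by positivity)
  refine ⟨K₀, k₀, C₀ * cx * cy, c / 2, 1 / 2, G₁ + G₂ + G₃, A₂ + A₃ + 1, hk₀0, by positivity,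
    by positivity, by norm_num, by positivity, by positivity, ?_⟩
  intro x y p P hv hu E hx hy hp hpy hP hhv hhu hE
  have hpy2 : p ^ 2 ≤ C₀ ^ 2 * y ^ 2 := by
    rw [← mul_pow]; exact pow_le_pow_left₀ hp hpy 2
  have hlam1 : lam * p ^ 2 ≤ |lam| * (C₀ ^ 2 * y ^ 2) :=
    (mul_le_mul_of_nonneg_right (le_abs_self _) (sq_nonneg p)).trans (by gcongr)
  have hlam2 : -(lam * p ^ 2) ≤ |lam| * (C₀ ^ 2 * y ^ 2) := by
    rw [← neg_mul]
    exact (mul_le_mul_of_nonneg_right (neg_le_abs _) (sq_nonneg p)).trans (by gcongr)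
  have hYD : 0 ≤ y ^ (β + 2) := by positivity
  have hXD : 0 ≤ x ^ (α + 2) := by positivity
  have a1 := HA₁ y hy
  rw [Real.rpow_two] at a1
  have hElow : x ^ 2 / 2 + b / (2 * (β + 2)) * y ^ (β + 2) + 1 ≤ E := by
    have : b / (β + 2) = b / (2 * (β + 2)) + b / (2 * (β + 2)) := by field_simp; ring
    rw [hE, this, add_mul]
    linarith [sq_nonneg y]
  have hE1 : 1 ≤ E := by
    have : 0 ≤ b / (2 * (β + 2)) * y ^ (β + 2) := by positivity
    linarith [sq_nonneg x]
  have hE0 : 0 < E := by linarith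
  have hkE : k₀ * (x ^ 2 + y ^ (β + 2)) ≤ E := by
    have h1 : k₀ * x ^ 2 ≤ 1 / 2 * x ^ 2 := by gcongr; exact min_le_left _ _
    have h2 : k₀ * y ^ (β + 2) ≤ b / (2 * (β + 2)) * y ^ (β + 2) := by
      gcongr; exact min_le_right _ _
    linarith
  have hxE : x ≤ cx * E ^ (1 / 2 : ℝ) := le_const_mul_rpow hk₀0 hx (by norm_num) (by
    rw [Real.rpow_two]; linarith [mul_nonneg hk₀0.le hYD])
  have hyE : y ≤ cy * E ^ (1 / (β + 2)) := le_const_mul_rpow hk₀0 hy hD (by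
    linarith [mul_nonneg hk₀0.le (sq_nonneg x)])
  have hPxy : |P| ≤ C₀ * (x * y) := by
    calc |P| ≤ x * p := hP
      _ ≤ x * (C₀ * y) := by gcongr
      _ = _ := by ring
  refine ⟨hE0, hkE, ?_, ?_, ?_⟩
  · rw [abs_mul, abs_of_pos (Real.rpow_pos_of_pos hE0 γ)]
    calc E ^ γ * |P| ≤ E ^ γ * (C₀ * (cx * E ^ (1 / 2 : ℝ) * (cy * E ^ (1 / (β + 2))))) := by
          gcongr
          exact hPxy.trans (by gcongr)
      _ = C₀ * cx * cy * (E ^ γ * E ^ (1 / 2 : ℝ) * E ^ (1 / (β + 2))) := by ring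
      _ = C₀ * cx * cy * E ^ (γ + 1 / 2 + 1 / (β + 2)) := by
          rw [← Real.rpow_add hE0, ← Real.rpow_add hE0]
      _ ≤ C₀ * cx * cy * E ^ (1 : ℝ) := by
          gcongr
      _ = _ := by rw [Real.rpow_one]
  · have b2 := HA₂ x hx
    have b3 := HA₃ x hx
    rw [Real.rpow_two] at b2
    rw [Real.rpow_one] at b3
    have e1 : c * x ^ α * x ^ 2 = c * x ^ (α + 2) := by rw [mul_assoc, rpow_mul_sq hx hα]
    have e2 : mu * x ^ 2 ≤ |mu| * x ^ 2 :=
      mul_le_mul_of_nonneg_right (le_abs_self _) (sq_nonneg x)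
    have e3 := (le_abs_self hv).trans hhv
    rw [e1]
    linarith
  · have e1 : b * y ^ β * y ^ 2 = b * y ^ (β + 2) := by rw [mul_assoc, rpow_mul_sq hy hβ]
    have e2 : -(c * x ^ α * P) ≤ c * C₀ * (x ^ (α + 1) * y) := by
      calc -(c * x ^ α * P) = c * x ^ α * -P := by ring
        _ ≤ c * x ^ α * (C₀ * (x * y)) := by
          gcongr
          exact (neg_le_abs P).trans hPxy
        _ = c * C₀ * (x ^ α * x * y) := by ring
        _ = _ := by rw [Real.rpow_add' hx (by linarith), Real.rpow_one]
    have e3 : mu * P ≤ |mu| * C₀ * (x ^ 2 + y ^ 2) := by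
      calc mu * P ≤ |mu| * |P| := by rw [← abs_mul]; exact le_abs_self _
        _ ≤ |mu| * (C₀ * (x * y)) := by gcongr
        _ ≤ |mu| * (C₀ * (x ^ 2 + y ^ 2)) := by
          gcongr
          nlinarith [sq_nonneg (x - y), sq_nonneg x, sq_nonneg y]
        _ = _ := by ring
    have e4 : hu ≤ M * C₀ * y := by
      calc hu ≤ M * p := (le_abs_self _).trans hhu
        _ ≤ M * (C₀ * y) := by gcongr
        _ = _ := by ring
    have b4 := HA₄ y hy
    have b5 := HA₅ y hy
    rw [Real.rpow_two] at b4
    rw [Real.rpow_one] at b5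
    have hbb : b / (β + 2) * y ^ (β + 2) ≤ b / 2 * y ^ (β + 2) := by
      gcongr; linarith
    -- The potential part of the virial bounds `-E`; what remains is quadratic in the velocity,
    -- constant, or the damping cross term, where `y` is replaced by a multiple of `E^(1/(β+2))`.
    have hd : x ^ 2 - y ^ 2 - b * y ^ β * y ^ 2 - c * x ^ α * P + lam * p ^ 2 + mu * P + hu ≤
        -E + B₁ * x ^ 2 + B₂ + c * C₀ * cy * (E ^ (1 / (β + 2)) * x ^ (α + 1)) := by
      have e5 : c * C₀ * (x ^ (α + 1) * y) ≤
          c * C₀ * cy * (E ^ (1 / (β + 2)) * x ^ (α + 1)) := by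
        calc c * C₀ * (x ^ (α + 1) * y) ≤
            c * C₀ * (x ^ (α + 1) * (cy * E ^ (1 / (β + 2)))) := by gcongr
          _ = _ := by ring
      rw [e1]
      have hmain : E ≤ x ^ 2 / 2 + y ^ 2 / 2 + b / 2 * y ^ (β + 2) +
          |lam| / 2 * (C₀ ^ 2 * y ^ 2) + K₀ := by rw [hE]; linarith
      rw [hB₁, hB₂]
      linarith [sq_nonneg y]
    have hEγ : 0 < E ^ γ := Real.rpow_pos_of_pos hE0 _
    have hmul := mul_le_mul_of_nonneg_left hd hEγ.le
    have g1 := HG₁ E (x ^ 2) hE0 (sq_nonneg x)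
    have g2 := HG₂ E 1 hE0 zero_le_one
    have g3 := HG₃ E (x ^ (α + 1)) hE0 (by positivity)
    rw [Real.one_rpow] at g2
    have p1 : (x ^ 2) ^ ((1 + γ) / (1 - 0)) ≤ x ^ (α + 2) + 1 := by
      rw [← Real.rpow_two, ← Real.rpow_mul hx]
      exact rpow_le_rpow_add_one hx (by rw [sub_zero, div_one]; linarith)
        (by rw [sub_zero, div_one]; linarith)
    have p3 : (x ^ (α + 1)) ^ ((1 + γ) / (1 - 1 / (β + 2))) ≤ x ^ (α + 2) + 1 := by
      rw [← Real.rpow_mul hx]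
      have : 0 < 1 - 1 / (β + 2) := by linarith
      exact rpow_le_rpow_add_one hx (by positivity) hγ2
    rw [add_zero] at g1 g2
    rw [Real.rpow_add hE0] at g3
    have q1 : E ^ (1 + γ) = E ^ γ * E := by
      rw [add_comm, Real.rpow_add_one hE0.ne']
    have r1 := mul_le_mul_of_nonneg_left p1 hG₁
    have r3 := mul_le_mul_of_nonneg_left p3 hG₃
    have r4 : 0 ≤ G₁ * (A₂ + A₃) := by positivity
    have r5 : 0 ≤ G₂ * (A₂ + A₃) := by positivity
    have r6 : 0 ≤ G₃ * (A₂ + A₃) := by positivity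
    have r7 : 0 ≤ G₂ * x ^ (α + 2) := by positivity
    rw [q1] at g1 g2 g3 ⊢
    linarith

/-- The Lyapunov inequalities behind the decay to zero. -/
theorem exists_lyapunov_constants_coercive {α β b c lam C₀ δ R : ℝ} (hα : 0 < α) (hαβ : α < β)
    (hb : 0 < b) (hc : 0 < c) (hC₀ : 0 ≤ C₀) (hδ : 0 < δ) (hR : 0 ≤ R) :
    ∃ C₁ k₂ C₂ : ℝ, 0 ≤ C₁ ∧ 0 < k₂ ∧ 0 ≤ C₂ ∧
      ∀ x y p P E : ℝ, 0 ≤ x → 0 ≤ y → 0 ≤ p → p ≤ C₀ * y → |P| ≤ x * p →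
        δ * y ^ 2 ≤ y ^ 2 - lam * p ^ 2 →
        E = x ^ 2 / 2 + y ^ 2 / 2 + b / (β + 2) * y ^ (β + 2) - lam / 2 * p ^ 2 →
        0 < E → E ≤ R →
        |E ^ (α / 2) * P| ≤ C₁ * E ∧
        E ^ (α / 2) * (x ^ 2 - y ^ 2 - b * y ^ β * y ^ 2 - c * x ^ α * P + lam * p ^ 2) ≤
          -k₂ * E ^ (1 + α / 2) + C₂ * x ^ (α + 2) := by
  have hβ : 0 < β := hα.trans hαβ
  -- As `x² ≤ 2E ≤ 2R`, the damping cross term is at most `Q x y`. Its `y²` share, `δ/2`, is covered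
  -- by half of the coercivity, and its `x²` share enters `B`.
  set Q : ℝ := c * (2 * R) ^ (α / 2) * C₀ with hQ
  have hQ0 : 0 ≤ Q := by positivity
  set B : ℝ := 2 + Q ^ 2 / (2 * δ) with hB
  have hB0 : 0 ≤ B := by positivity
  obtain ⟨G, hG, HG⟩ := exists_mul_rpow_le (γ := α / 2) (σ := 0) (η := 1 / 2) (a := B)
    (by positivity) le_rfl one_pos (by norm_num) hB0
  refine ⟨R ^ (α / 2) * (C₀ * (1 + 1 / δ)), 1 / 2, G, by positivity, by norm_num, hG, ?_⟩
  intro x y p P E hx hy hp hpy hP hcoer hE hE0 hER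
  have hYD : 0 ≤ y ^ (β + 2) := by positivity
  have hbY : 0 ≤ b / (β + 2) * y ^ (β + 2) := by positivity
  have hx2 : x ^ 2 ≤ 2 * E := by nlinarith [mul_nonneg hδ.le (sq_nonneg y)]
  have hy2 : δ * y ^ 2 ≤ 2 * E := by nlinarith [sq_nonneg x]
  have hPxy : |P| ≤ C₀ * (x * y) := by
    calc |P| ≤ x * p := hP
      _ ≤ x * (C₀ * y) := by gcongr
      _ = _ := by ring
  constructor
  · rw [abs_mul, abs_of_pos (Real.rpow_pos_of_pos hE0 _)]
    have hxy : x * y ≤ (1 + 1 / δ) * E := by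
      have h1 : y ^ 2 ≤ 2 * E / δ := by rw [le_div_iff₀ hδ]; linarith
      have h2 : 2 * E / δ = 2 * (1 / δ * E) := by ring
      nlinarith [sq_nonneg (x - y)]
    calc E ^ (α / 2) * |P| ≤ R ^ (α / 2) * (C₀ * ((1 + 1 / δ) * E)) := by
          gcongr
          exact hPxy.trans (by gcongr)
      _ = _ := by ring
  · have e1 : b * y ^ β * y ^ 2 = b * y ^ (β + 2) := by rw [mul_assoc, rpow_mul_sq hy hβ]
    have hxα : x ^ α ≤ (2 * R) ^ (α / 2) := by
      calc x ^ α = (x ^ 2) ^ (α / 2) := by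
            rw [← Real.rpow_two, ← Real.rpow_mul hx]; congr 1; ring
        _ ≤ _ := Real.rpow_le_rpow (sq_nonneg x) (by linarith) (by positivity)
    have e2 : -(c * x ^ α * P) ≤ Q * (x * y) := by
      calc -(c * x ^ α * P) = c * x ^ α * -P := by ring
        _ ≤ c * x ^ α * (C₀ * (x * y)) := by
          gcongr
          exact (neg_le_abs P).trans hPxy
        _ ≤ c * (2 * R) ^ (α / 2) * (C₀ * (x * y)) := by gcongr
        _ = _ := by rw [hQ]; ring
    have e3 : Q * (x * y) ≤ δ / 2 * y ^ 2 + Q ^ 2 / (2 * δ) * x ^ 2 := by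
      have h0 : 0 ≤ (δ * y - Q * x) ^ 2 / (2 * δ) := by positivity
      have h1 : (δ * y - Q * x) ^ 2 / (2 * δ) =
          δ / 2 * y ^ 2 + Q ^ 2 / (2 * δ) * x ^ 2 - Q * (x * y) := by field_simp; ring
      linarith
    have hbb : b / (β + 2) * y ^ (β + 2) ≤ b / 2 * y ^ (β + 2) := by
      gcongr; linarith
    have hd : x ^ 2 - y ^ 2 - b * y ^ β * y ^ 2 - c * x ^ α * P + lam * p ^ 2 ≤
        -E + B * x ^ 2 := by
      rw [e1, hB]
      nlinarith
    have hEγ : 0 < E ^ (α / 2) := Real.rpow_pos_of_pos hE0 _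
    have hmul := mul_le_mul_of_nonneg_left hd hEγ.le
    have g1 := HG E (x ^ 2) hE0 (sq_nonneg x)
    -- With `γ = α/2` this exponent matches the dissipation exactly, so no additive constant
    -- obstructs the decay to zero.
    have p1 : (x ^ 2) ^ ((1 + α / 2) / (1 - 0)) = x ^ (α + 2) := by
      rw [← Real.rpow_two, ← Real.rpow_mul hx]; congr 1; ring
    rw [add_zero, p1] at g1
    have q1 : E ^ (1 + α / 2) = E ^ (α / 2) * E := by
      rw [add_comm, Real.rpow_add_one hE0.ne']
    rw [q1] at g1 ⊢
    linarith

end Inequalities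

/-! ### The universal bound and the decay to zero, given Poincaré and coercivity constants. -/

section Decay

variable {N : ℕ} {Ω : Set (Eucl N)} {α β b c lam mu : ℝ}

/-- The universal bound, in terms of a constant in the Poincaré inequality. -/
theorem exists_universal_bound {C₀ : ℝ} (hα : 0 < α) (hαβ : α < β) (hb : 0 < b) (hc : 0 < c)
    (hC₀ : 0 ≤ C₀) (hpoinc : ∀ x : H10 Ω, ‖toL2 Ω x‖ ≤ C₀ * ‖grad Ω x‖) (M : ℝ) :
    ∃ Γ Γs : ℝ, ∀ T : ℝ, 0 < T → ∀ h : ℝ → L2 Ω,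
      MemLp h ⊤ (volume.restrict (Ioo 0 T)) →
      (∀ᵐ t ∂(volume.restrict (Ioo 0 T)), ‖h t‖ ≤ M) →
      ∀ u : ℝ → H10 Ω, IsWeakSolution Ω α β b c lam mu (Ioo 0 T) h u →
        ∀ t ∈ Ioo 0 T, ‖velocity u t‖ ^ 2 + ‖grad Ω (u t)‖ ^ (β + 2)
            ≤ Γ * t ^ (-(1 / min (α / 2) ((β - α) / ((α + 1) * (β + 2))))) + Γs := by
  have hβ : 0 < β := hα.trans hαβ
  set γ : ℝ := min (α / 2) ((β - α) / ((α + 1) * (β + 2))) with hγ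
  have hγ0 : 0 < γ := (exponent_conditions hα hαβ hγ).1
  obtain ⟨K₀, k₀, C₁, k₁, k₂, C₂, K, hk₀, hC₁, hk₁, hk₂, hC₂, hK, H⟩ :=
    exists_lyapunov_constants (lam := lam) (mu := mu) hα hαβ hb hc hC₀ (abs_nonneg M) hγ
  obtain ⟨A, B, hA, hB, HAB⟩ := exists_decay_of_lyapunov hγ0 hC₁ hk₁ hk₂ hC₂
  refine ⟨k₀⁻¹ * (A * (1 / 2) ^ (-(1 / γ))), k₀⁻¹ * (B * K ^ (1 / (1 + γ))), ?_⟩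
  intro T hT h hh hhM u hu t ht
  -- The comparison is run on `[t/2, t]`, which stays inside the open interval; this costs the
  -- factor `(1/2)^(-1/γ)` in `Γ`.
  have ht2 : t / 2 < t := by linarith [ht.1]
  have hsub : Icc (t / 2) t ⊆ Ioo 0 T := fun r hr =>
    ⟨by linarith [ht.1, hr.1], lt_of_le_of_lt hr.2 ht.2⟩
  have hh1 : IntegrableOn h (Ioo (t / 2) t) := by
    have : IntegrableOn h (Ioo 0 T) := hh.integrable le_top
    exact this.mono_set (Ioo_subset_Icc_self.trans hsub)
  obtain ⟨e1, e2⟩ := hu.energy_identity hα hβ isOpen_Ioo ht2 hsub hh1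
  obtain ⟨d1, d2⟩ := hu.virial_identity hα hβ isOpen_Ioo ht2 hsub hh1
  have hhM' := (ae_restrict_iff' measurableSet_Ioo).1 hhM
  have key : ∀ r, ∀ hr : L2 Ω, ‖hr‖ ≤ |M| → _ := fun r hr hrM =>
    H ‖velocity u r‖ ‖grad Ω (u r)‖ ‖toL2 Ω (u r)‖ ⟪velocity u r, toL2 Ω (u r)⟫
      ⟪hr, velocity u r⟫ ⟪hr, toL2 Ω (u r)⟫ (energy Ω β b lam (u r) (velocity u r) + K₀)
      (norm_nonneg _) (norm_nonneg _) (norm_nonneg _) (hpoinc _) (abs_real_inner_le_norm _ _)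
      ((abs_real_inner_le_norm _ _).trans (by gcongr))
      ((abs_real_inner_le_norm _ _).trans (by gcongr)) rfl
  -- The bound on `h` holds only almost everywhere; the conclusions not involving `h` are obtained
  -- at every time by taking zero force.
  have key0 := fun r => key r 0 (by rw [norm_zero]; exact abs_nonneg M)
  have hfin := HAB K hK (t / 2) t ht2
    (fun r => energy Ω β b lam (u r) (velocity u r) + K₀)
    (fun r => energyRate Ω α c mu (velocity u r) + ⟪h r, velocity u r⟫)
    (fun r => ⟪velocity u r, toL2 Ω (u r)⟫)
    (fun r => virialRate Ω α β b c lam mu (u r) (velocity u r) + ⟪h r, toL2 Ω (u r)⟫)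
    (fun r => ‖velocity u r‖ ^ (α + 2)) e1
    (fun r hr => by rw [e2 r hr]; ring) d1 d2
    (fun r _ => (key0 r).1) (fun r _ => (key0 r).2.2.1)
    (fun r => Real.rpow_nonneg (norm_nonneg _) _) (by
      filter_upwards [hhM'] with r hr hrI
      obtain ⟨-, -, -, q1, q2⟩ := key r (h r)
        ((hr (hsub (Ioo_subset_Icc_self hrI))).trans (le_abs_self M))
      refine ⟨?_, ?_⟩
      · rw [energyRate]; exact q1
      · rw [virialRate]; exact q2)
  have hlow := (key0 t).2.1
  rw [show t - t / 2 = 1 / 2 * t by ring, Real.mul_rpow (by norm_num) ht.1.le] at hfin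
  have hdiv := mul_le_mul_of_nonneg_left (hlow.trans hfin) (inv_nonneg.2 hk₀.le)
  rw [inv_mul_cancel_left₀ hk₀.ne'] at hdiv
  calc _ ≤ _ := hdiv
    _ = _ := by ring

theorem IsWeakSolution.mono {I J : Set ℝ} (hJI : J ⊆ I) {h : ℝ → L2 Ω} {u : ℝ → H10 Ω}
    (hu : IsWeakSolution Ω α β b c lam mu I h u) : IsWeakSolution Ω α β b c lam mu J h u :=
  ⟨hu.continuousOn.mono hJI, hu.contDiffOn.mono hJI,
    fun s t hst hI => hu.approx s t hst (hI.trans hJI)⟩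

/-- Decay to zero of unforced solutions, in terms of the constants in the Poincaré inequality and
in the coercivity inequality. -/
theorem exists_decay {C₀ δ : ℝ} (hα : 0 < α) (hαβ : α < β) (hb : 0 < b) (hc : 0 < c)
    (hC₀ : 0 ≤ C₀) (hpoinc : ∀ x : H10 Ω, ‖toL2 Ω x‖ ≤ C₀ * ‖grad Ω x‖) (hδ : 0 < δ)
    (hcoer : ∀ x : H10 Ω, δ * ‖grad Ω x‖ ^ 2 ≤ ‖grad Ω x‖ ^ 2 - lam * ‖toL2 Ω x‖ ^ 2) :
    ∃ D : ℝ, ∀ u : ℝ → H10 Ω,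
      IsWeakSolution Ω α β b c lam 0 (Ioi 0) (fun _ => 0) u →
      ∀ t : ℝ, 1 ≤ t →
        ‖velocity u t‖ ^ 2 + ‖grad Ω (u t)‖ ^ 2 ≤ D * t ^ (-(2 / α)) := by
  have hβ : 0 < β := hα.trans hαβ
  obtain ⟨Γ, Γs, HΓ⟩ := exists_universal_bound (Ω := Ω) (lam := lam) (mu := 0) hα hαβ hb hc hC₀
    hpoinc 0
  set R₀ : ℝ := |Γ * (1 / 2 : ℝ) ^ (-(1 / min (α / 2) ((β - α) / ((α + 1) * (β + 2))))) + Γs|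
    with hR₀
  have hR₀0 : 0 ≤ R₀ := abs_nonneg _
  set a : ℝ := 1 / 2 + |lam| / 2 * C₀ ^ 2 with ha
  have ha0 : 0 ≤ a := by positivity
  -- `R₀` is the universal bound at time `1/2`, on the interval `(0, 1)`; `R` is the resulting bound
  -- on the energy at that time.
  set R : ℝ := R₀ + a * (R₀ + 1) + b / (β + 2) * R₀ with hR
  have hR0 : 0 ≤ R := by positivity
  obtain ⟨C₁, k₂, C₂, hC₁, hk₂, hC₂, H⟩ := exists_lyapunov_constants_coercive (lam := lam) hα hαβ
    hb hc hC₀ hδ hR0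
  have hγ0 : 0 < α / 2 := by linarith
  obtain ⟨A, B, hA, hB, HAB⟩ := exists_decay_of_lyapunov hγ0 hC₁ hc hk₂ hC₂
  set k : ℝ := min (1 / 2) (δ / 2) with hk
  have hk0 : 0 < k := lt_min (by norm_num) (by linarith)
  refine ⟨k⁻¹ * (A * (1 / 2) ^ (-(2 / α))), fun u hu t ht => ?_⟩
  set E : ℝ → ℝ := fun r => energy Ω β b lam (u r) (velocity u r) with hEdef
  have hElow : ∀ r, k * (‖velocity u r‖ ^ 2 + ‖grad Ω (u r)‖ ^ 2) ≤ E r := by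
    intro r
    have h1 : k * ‖velocity u r‖ ^ 2 ≤ 1 / 2 * ‖velocity u r‖ ^ 2 := by
      gcongr; exact min_le_left _ _
    have h2 : k * ‖grad Ω (u r)‖ ^ 2 ≤ δ / 2 * ‖grad Ω (u r)‖ ^ 2 := by
      gcongr; exact min_le_right _ _
    have h3 := hcoer (u r)
    have h4 : 0 ≤ b / (β + 2) * ‖grad Ω (u r)‖ ^ (β + 2) := by positivity
    simp only [hEdef, energy]
    linarith
  have htt : (1 / 2 : ℝ) < t := by linarith
  have hsub : Icc (1 / 2) t ⊆ Ioi (0 : ℝ) := fun r hr => lt_of_lt_of_le (by norm_num) hr.1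
  have hh1 : IntegrableOn (fun _ : ℝ => (0 : L2 Ω)) (Ioo (1 / 2) t) := integrableOn_zero
  obtain ⟨e1, e2⟩ := hu.energy_identity hα hβ isOpen_Ioi htt hsub hh1
  obtain ⟨d1, d2⟩ := hu.virial_identity hα hβ isOpen_Ioi htt hsub hh1
  simp only [inner_zero_left, add_zero] at e1 e2 d1 d2
  have hrate : ∀ z : L2 Ω, energyRate Ω α c 0 z = -c * ‖z‖ ^ (α + 2) := fun z => by
    rw [energyRate, mul_assoc, rpow_mul_sq (norm_nonneg z) hα]; ring
  have hmono : ∀ r ∈ Icc (1 / 2) t, E t ≤ E r ∧ E r ≤ E (1 / 2) := by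
    have hneg : ∀ x y : ℝ, x ≤ y → ∫ ρ in x..y, energyRate Ω α c 0 (velocity u ρ) ≤ 0 := by
      intro x y hxy
      rw [intervalIntegral.integral_of_le hxy]
      refine integral_nonpos fun ρ => ?_
      change energyRate Ω α c 0 (velocity u ρ) ≤ 0
      rw [hrate, neg_mul, neg_nonpos]
      positivity
    intro r hr
    have g1 := e2 r hr
    have g2 := e2 t ⟨htt.le, le_rfl⟩
    have g3 := intervalIntegral.integral_interval_sub_left
      (intervalIntegrable_left e1 ⟨htt.le, le_rfl⟩) (intervalIntegrable_left e1 hr)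
    have g4 := hneg _ _ hr.1
    have g5 := hneg _ _ hr.2
    constructor <;> simp only [hEdef] <;> linarith
  have hstart : E (1 / 2) ≤ R := by
    have hw : IsWeakSolution Ω α β b c lam 0 (Ioo 0 1) (fun _ => 0) u := hu.mono fun r hr => hr.1
    have hb1 := (HΓ 1 one_pos (fun _ => 0) MemLp.zero (Eventually.of_forall fun _ => by simp) u hw
      (1 / 2) ⟨by norm_num, by norm_num⟩).trans (le_abs_self _)
    rw [← hR₀] at hb1
    have hv0 := sq_nonneg ‖velocity u (1 / 2)‖
    have hg0 : 0 ≤ ‖grad Ω (u (1 / 2))‖ ^ (β + 2) := by positivity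
    have hg2 : ‖grad Ω (u (1 / 2))‖ ^ 2 ≤ R₀ + 1 := by
      have := rpow_le_rpow_add_one (norm_nonneg (grad Ω (u (1 / 2)))) (q := 2) (r := β + 2)
        (by norm_num) (by linarith)
      rw [Real.rpow_two] at this
      linarith
    have hp2 : ‖toL2 Ω (u (1 / 2))‖ ^ 2 ≤ C₀ ^ 2 * ‖grad Ω (u (1 / 2))‖ ^ 2 := by
      rw [← mul_pow]; exact pow_le_pow_left₀ (norm_nonneg _) (hpoinc _) 2
    have hlam : -(lam / 2 * ‖toL2 Ω (u (1 / 2))‖ ^ 2) ≤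
        |lam| / 2 * (C₀ ^ 2 * ‖grad Ω (u (1 / 2))‖ ^ 2) := by
      have h1 : -(lam / 2) ≤ |lam| / 2 := by linarith [neg_le_abs lam]
      rw [← neg_mul]
      exact (mul_le_mul_of_nonneg_right h1 (sq_nonneg _)).trans (by gcongr)
    have h5 : a * ‖grad Ω (u (1 / 2))‖ ^ 2 ≤ a * (R₀ + 1) := by gcongr
    have h6 : b / (β + 2) * ‖grad Ω (u (1 / 2))‖ ^ (β + 2) ≤ b / (β + 2) * R₀ := by
      gcongr; linarith
    have h7 : a * ‖grad Ω (u (1 / 2))‖ ^ 2 = 1 / 2 * ‖grad Ω (u (1 / 2))‖ ^ 2 +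
        |lam| / 2 * (C₀ ^ 2 * ‖grad Ω (u (1 / 2))‖ ^ 2) := by rw [ha]; ring
    simp only [hEdef, energy]
    rw [hR]
    linarith
  have ht0 : (0 : ℝ) ≤ t := by linarith
  have hEt : E t ≤ A * (1 / 2) ^ (-(2 / α)) * t ^ (-(2 / α)) := by
    have hrhs : 0 ≤ A * (1 / 2) ^ (-(2 / α)) * t ^ (-(2 / α)) := by positivity
    -- If `E t > 0`, monotonicity makes the energy positive on all of `[1/2, t]`, as division by its
    -- powers requires.
    rcases le_or_gt (E t) 0 with h0 | h0
    · exact h0.trans hrhs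
    have key : ∀ r ∈ Icc (1 / 2) t, _ := fun r hr =>
      H ‖velocity u r‖ ‖grad Ω (u r)‖ ‖toL2 Ω (u r)‖ ⟪velocity u r, toL2 Ω (u r)⟫ (E r)
        (norm_nonneg _) (norm_nonneg _) (norm_nonneg _) (hpoinc _) (abs_real_inner_le_norm _ _)
        (hcoer _) rfl (h0.trans_le (hmono r hr).1) ((hmono r hr).2.trans hstart)
    have hfin := HAB 0 le_rfl (1 / 2) t htt E
      (fun r => energyRate Ω α c 0 (velocity u r)) (fun r => ⟪velocity u r, toL2 Ω (u r)⟫)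
      (fun r => virialRate Ω α β b c lam 0 (u r) (velocity u r))
      (fun r => ‖velocity u r‖ ^ (α + 2)) e1 e2 d1 d2
      (fun r hr => h0.trans_le (hmono r hr).1) (fun r hr => (key r hr).1)
      (fun r => Real.rpow_nonneg (norm_nonneg _) _) (Eventually.of_forall fun r hr => by
        refine ⟨by rw [hrate, add_zero], ?_⟩
        have := (key r (Ioo_subset_Icc_self hr)).2
        rw [virialRate, zero_mul, add_zero, add_zero]
        exact this)
    rw [Real.zero_rpow (by positivity), mul_zero, add_zero,
      show 1 / (α / 2) = 2 / α by field_simp] at hfin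
    refine hfin.trans ?_
    rw [mul_assoc, ← Real.mul_rpow (by norm_num) ht0]
    refine mul_le_mul_of_nonneg_left ?_ hA
    -- Here `t ≥ 1` enters through `t - 1/2 ≥ t/2`.
    exact Real.rpow_le_rpow_of_nonpos (by positivity) (by linarith)
      (by rw [neg_nonpos]; positivity)
  have hdiv := mul_le_mul_of_nonneg_left ((hElow t).trans hEt) (inv_nonneg.2 hk0.le)
  rw [inv_mul_cancel_left₀ hk0.ne'] at hdiv
  calc _ ≤ _ := hdiv
    _ = _ := by ring

end Decay

/-! ### Translation estimates and the Poincaré inequality. -/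

section Translations

/-- The integral of `(g - c)²`, with `c` the mean of `g`, is nonnegative. -/
theorem sq_integral_le {X : Type*} [MeasurableSpace X] {μ : Measure X} [IsFiniteMeasure μ]
    {g : X → ℝ} (hg : Integrable g μ) (hg2 : Integrable (fun x => g x ^ 2) μ) :
    (∫ x, g x ∂μ) ^ 2 ≤ μ.real univ * ∫ x, g x ^ 2 ∂μ := by
  rcases eq_or_ne μ 0 with rfl | hμ
  · simp
  have hm : 0 < μ.real univ := by
    rw [measureReal_def]
    exact ENNReal.toReal_pos (Measure.measure_univ_ne_zero.2 hμ) (measure_ne_top _ _)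
  set c : ℝ := (∫ x, g x ∂μ) / μ.real univ with hc
  have h0 : 0 ≤ ∫ x, (g x - c) ^ 2 ∂μ := integral_nonneg fun _ => sq_nonneg _
  have e : ∀ x, (g x - c) ^ 2 = g x ^ 2 - 2 * c * g x + c ^ 2 := fun x => by ring
  simp only [e] at h0
  have i1 : Integrable (fun x => g x ^ 2 - 2 * c * g x) μ := hg2.sub (hg.const_mul _)
  rw [integral_add i1 (integrable_const _), integral_sub hg2 (hg.const_mul _),
    integral_const_mul, integral_const, smul_eq_mul] at h0
  have hI : ∫ x, g x ∂μ = c * μ.real univ := by rw [hc]; field_simp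
  rw [hI] at h0 ⊢
  nlinarith

variable {N : ℕ}

theorem continuous_gradient {φ : Eucl N → ℝ} (hφ : ContDiff ℝ ∞ φ) : Continuous fun x => ∇ φ x :=
  (InnerProductSpace.toDual ℝ (Eucl N)).symm.continuous.comp (hφ.continuous_fderiv (by simp))

/-- Fundamental theorem of calculus along the segment from `x` to `x + h`, then Cauchy–Schwarz. -/
theorem sq_sub_le_integral_gradient {φ : Eucl N → ℝ} (hφ : ContDiff ℝ ∞ φ) (x h : Eucl N) :
    (φ (x + h) - φ x) ^ 2 ≤ ‖h‖ ^ 2 * ∫ s in Ioc (0 : ℝ) 1, ‖∇ φ (x + s • h)‖ ^ 2 := by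
  have hgc := continuous_gradient hφ
  have hline : Continuous fun s : ℝ => x + s • h := by fun_prop
  have hd : ∀ s : ℝ, HasDerivAt (fun s : ℝ => φ (x + s • h)) ⟪∇ φ (x + s • h), h⟫ s := by
    intro s
    have h1 := (hφ.differentiable (by simp) (x + s • h)).hasGradientAt.hasFDerivAt
    have h2 : HasDerivAt (fun s : ℝ => x + s • h) h s := by
      simpa using ((hasDerivAt_id s).smul_const h).const_add x
    exact h1.comp_hasDerivAt s h2
  have hcont : Continuous fun s : ℝ => ⟪∇ φ (x + s • h), h⟫ :=
    (hgc.comp hline).inner continuous_const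
  have hftc := intervalIntegral.integral_eq_sub_of_hasDerivAt (a := 0) (b := 1)
    (fun s _ => hd s) (hcont.intervalIntegrable _ _)
  rw [one_smul, zero_smul, add_zero, intervalIntegral.integral_of_le zero_le_one] at hftc
  have hcI : ∀ {k : ℝ → ℝ}, Continuous k → IntegrableOn k (Ioc 0 1) := fun hk =>
    (hk.integrableOn_Icc).mono_set Ioc_subset_Icc_self
  have hJ := sq_integral_le (hcI hcont) (hcI (hcont.pow 2))
  rw [← hftc]
  refine hJ.trans ?_
  rw [measureReal_restrict_apply_univ, Real.volume_real_Ioc_of_le zero_le_one, sub_zero, one_mul,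
    ← integral_const_mul]
  refine integral_mono (hcI (hcont.pow 2))
    ((hcI ((hgc.comp hline).norm.pow 2)).const_mul _) fun s => ?_
  change ⟪∇ φ (x + s • h), h⟫ ^ 2 ≤ ‖h‖ ^ 2 * ‖∇ φ (x + s • h)‖ ^ 2
  rw [← sq_abs, ← mul_pow, mul_comm]
  exact pow_le_pow_left₀ (abs_nonneg _) (abs_real_inner_le_norm _ _) 2

/-- Translations of smooth functions in `L²`. -/
theorem lintegral_sq_translate_sub_le {φ : Eucl N → ℝ} (hφ : ContDiff ℝ ∞ φ) (h : Eucl N) :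
    ∫⁻ x, ENNReal.ofReal ((φ (x + h) - φ x) ^ 2) ≤
      ENNReal.ofReal (‖h‖ ^ 2) * ∫⁻ x, ENNReal.ofReal (‖∇ φ x‖ ^ 2) := by
  have hgc := continuous_gradient hφ
  have hmeas : Measurable (Function.uncurry fun (x : Eucl N) (s : ℝ) =>
      ENNReal.ofReal (‖∇ φ (x + s • h)‖ ^ 2)) := by
    refine ENNReal.measurable_ofReal.comp (Continuous.measurable ?_)
    exact (hgc.comp (by fun_prop)).norm.pow 2
  calc ∫⁻ x, ENNReal.ofReal ((φ (x + h) - φ x) ^ 2)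
      ≤ ∫⁻ x, ENNReal.ofReal (‖h‖ ^ 2) *
          ∫⁻ s in Ioc (0 : ℝ) 1, ENNReal.ofReal (‖∇ φ (x + s • h)‖ ^ 2) := by
        refine lintegral_mono fun x => ?_
        refine (ENNReal.ofReal_le_ofReal (sq_sub_le_integral_gradient hφ x h)).trans ?_
        rw [ENNReal.ofReal_mul (sq_nonneg _), ofReal_integral_eq_lintegral_ofReal]
        · have hc : Continuous fun s : ℝ => ‖∇ φ (x + s • h)‖ ^ 2 :=
            (hgc.comp (by fun_prop)).norm.pow 2
          exact (hc.integrableOn_Icc).mono_set Ioc_subset_Icc_self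
        · exact Eventually.of_forall fun _ => sq_nonneg _
    _ = ENNReal.ofReal (‖h‖ ^ 2) * ∫⁻ x, ∫⁻ s in Ioc (0 : ℝ) 1,
          ENNReal.ofReal (‖∇ φ (x + s • h)‖ ^ 2) := by
        rw [lintegral_const_mul' _ _ ENNReal.ofReal_ne_top]
    _ = ENNReal.ofReal (‖h‖ ^ 2) * ∫⁻ s in Ioc (0 : ℝ) 1, ∫⁻ x,
          ENNReal.ofReal (‖∇ φ (x + s • h)‖ ^ 2) := by
        rw [lintegral_lintegral_swap hmeas.aemeasurable]
    _ = ENNReal.ofReal (‖h‖ ^ 2) * ∫⁻ _ in Ioc (0 : ℝ) 1, ∫⁻ x,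
          ENNReal.ofReal (‖∇ φ x‖ ^ 2) := by
        congr 1
        refine lintegral_congr fun s => ?_
        exact lintegral_add_right_eq_self (fun x => ENNReal.ofReal (‖∇ φ x‖ ^ 2)) (s • h)
    _ = _ := by
        rw [setLIntegral_const, Real.volume_Ioc, sub_zero, ENNReal.ofReal_one, mul_one]

theorem ofReal_norm_sq_eq_lintegral {X F : Type*} [MeasurableSpace X] {μ : Measure X}
    [NormedAddCommGroup F] [InnerProductSpace ℝ F] (f : Lp F 2 μ) :
    ENNReal.ofReal (‖f‖ ^ 2) = ∫⁻ x, ENNReal.ofReal (‖f x‖ ^ 2) ∂μ := by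
  rw [← real_inner_self_eq_norm_sq, L2.inner_def, ofReal_integral_eq_lintegral_ofReal]
  · simp only [real_inner_self_eq_norm_sq]
  · exact L2.integrable_inner f f
  · exact Eventually.of_forall fun x => by
      simp only [Pi.zero_apply, real_inner_self_eq_norm_sq]; positivity

theorem setLIntegral_gradient_eq {Ω : Set (Eucl N)} {φ : Eucl N → ℝ} (hs : tsupport φ ⊆ Ω)
    (hΩ : MeasurableSet Ω) :
    ∫⁻ x in Ω, ENNReal.ofReal (‖∇ φ x‖ ^ 2) = ∫⁻ x, ENNReal.ofReal (‖∇ φ x‖ ^ 2) := by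
  rw [← lintegral_indicator hΩ]
  refine lintegral_congr fun x => ?_
  by_cases hx : x ∈ Ω
  · rw [indicator_of_mem hx]
  · rw [indicator_of_notMem hx]
    have : fderiv ℝ φ x = 0 := by
      by_contra h0
      exact hx (hs (support_fderiv_subset ℝ h0))
    simp [gradient, this]

/-- A closed inequality between the components, valid on smooth functions, holds on `H¹₀(Ω)`. -/
theorem H10.induction {Ω : Set (Eucl N)} {p : L2 Ω → L2Vec Ω → Prop}
    (hclosed : IsClosed {q : WithLp 2 (L2 Ω × L2Vec Ω) | p q.fst q.snd})
    (h : ∀ q ∈ testGraph Ω, p q.fst q.snd) (x : H10 Ω) : p (toL2 Ω x) (grad Ω x) := by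
  have hmem : inclH10 Ω x ∈ closure (testGraph Ω : Set (WithLp 2 (L2 Ω × L2Vec Ω))) := x.2
  exact closure_minimal (t := {q : WithLp 2 (L2 Ω × L2Vec Ω) | p q.fst q.snd}) h hclosed hmem

theorem continuous_withLp_fst {X Y : Type*} [NormedAddCommGroup X] [NormedSpace ℝ X]
    [NormedAddCommGroup Y] [NormedSpace ℝ Y] :
    Continuous fun q : WithLp 2 (X × Y) => q.fst := (WithLp.fstL 2 ℝ X Y).continuous

theorem continuous_withLp_snd {X Y : Type*} [NormedAddCommGroup X] [NormedSpace ℝ X]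
    [NormedAddCommGroup Y] [NormedSpace ℝ Y] :
    Continuous fun q : WithLp 2 (X × Y) => q.snd := (WithLp.sndL 2 ℝ X Y).continuous

/-- The Poincaré inequality. -/
theorem exists_poincare (hN : 1 ≤ N) {Ω : Set (Eucl N)} (hΩ : IsOpen Ω)
    (hΩb : Bornology.IsBounded Ω) :
    ∃ C : ℝ, 0 ≤ C ∧ ∀ x : H10 Ω, ‖toL2 Ω x‖ ≤ C * ‖grad Ω x‖ := by
  obtain ⟨R, hR0, hR⟩ := hΩb.subset_closedBall_lt 0 0
  -- A translation longer than the diameter moves `Ω` off itself, so on `Ω` the difference `φ (x +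
  -- h) - φ x` is just `-φ x`.
  set h : Eucl N := EuclideanSpace.single (⟨0, hN⟩ : Fin N) (3 * R) with hh
  have hnorm : ‖h‖ = 3 * R := by
    rw [hh, PiLp.norm_single, Real.norm_of_nonneg (by positivity)]
  have hout : ∀ x ∈ Ω, x + h ∉ Ω := by
    intro x hx hxh
    have h1 := mem_closedBall_zero_iff.1 (hR hx)
    have h2 := mem_closedBall_zero_iff.1 (hR hxh)
    have h3 : ‖h‖ ≤ ‖x + h‖ + ‖x‖ := by
      have := norm_sub_le (x + h) x
      rwa [add_sub_cancel_left] at this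
    rw [hnorm] at h3
    linarith
  refine ⟨3 * R, by positivity, H10.induction (p := fun f g => ‖f‖ ≤ 3 * R * ‖g‖) ?_ ?_⟩
  · exact isClosed_le continuous_withLp_fst.norm (continuous_const.mul continuous_withLp_snd.norm)
  · rintro q ⟨φ, hφ, hφc, hφs, hq1, hq2⟩
    have key : ENNReal.ofReal (‖q.fst‖ ^ 2) ≤ ENNReal.ofReal ((3 * R * ‖q.snd‖) ^ 2) := by
      rw [mul_pow, ENNReal.ofReal_mul (sq_nonneg _), ofReal_norm_sq_eq_lintegral,
        ofReal_norm_sq_eq_lintegral]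
      have e1 : ∫⁻ x in Ω, ENNReal.ofReal (‖q.fst x‖ ^ 2) =
          ∫⁻ x in Ω, ENNReal.ofReal ((φ (x + h) - φ x) ^ 2) := by
        refine lintegral_congr_ae ?_
        filter_upwards [hq1, ae_restrict_mem hΩ.measurableSet] with x hx hxΩ
        have h0 : φ (x + h) = 0 := by
          by_contra h0
          exact hout x hxΩ (hφs (subset_tsupport _ h0))
        rw [hx, h0, zero_sub, neg_sq, Real.norm_eq_abs, sq_abs]
      have e2 : ∫⁻ x in Ω, ENNReal.ofReal (‖q.snd x‖ ^ 2) =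
          ∫⁻ x, ENNReal.ofReal (‖∇ φ x‖ ^ 2) := by
        rw [← setLIntegral_gradient_eq hφs hΩ.measurableSet]
        refine lintegral_congr_ae ?_
        filter_upwards [hq2] with x hx
        rw [hx]
      rw [e1, e2, ← hnorm]
      exact (setLIntegral_le_lintegral _ _).trans (lintegral_sq_translate_sub_le hφ h)
    rw [ENNReal.ofReal_le_ofReal_iff (sq_nonneg _)] at key
    exact le_of_sq_le_sq key (by positivity)

end Translations

/-! ### Averages on small cubes. -/

section Cells

variable {N : ℕ}

/-- The half-open cube of side `ε` with index `k`. -/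
def cell (ε : ℝ) (k : Fin N → ℤ) : Set (Eucl N) := {x | ∀ i, ⌊x i / ε⌋ = k i}

theorem cell_eq_preimage {ε : ℝ} (hε : 0 < ε) (k : Fin N → ℤ) :
    cell ε k = (MeasurableEquiv.toLp 2 (Fin N → ℝ)).symm ⁻¹'
      (pi univ fun i => Ico (ε * k i) (ε * (k i + 1))) := by
  ext x
  simp only [cell, mem_ofPred_eq, mem_preimage, Set.mem_pi, mem_univ, true_implies, mem_Ico]
  refine forall_congr' fun i => ?_
  rw [Int.floor_eq_iff, le_div_iff₀ hε, div_lt_iff₀ hε, mul_comm ε, mul_comm ε]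
  rfl

theorem measurableSet_cell {ε : ℝ} (hε : 0 < ε) (k : Fin N → ℤ) : MeasurableSet (cell ε k) := by
  rw [cell_eq_preimage hε]
  exact (MeasurableEquiv.measurable _) (MeasurableSet.univ_pi fun _ => measurableSet_Ico)

theorem volume_cell {ε : ℝ} (hε : 0 < ε) (k : Fin N → ℤ) :
    volume (cell ε k) = ENNReal.ofReal (ε ^ N) := by
  rw [cell_eq_preimage hε,
    (EuclideanSpace.volume_preserving_symm_measurableEquiv_toLp (Fin N)).measure_preimage_equiv,
    Real.volume_pi_Ico]
  have : ∀ i : Fin N, ε * ((k i : ℝ) + 1) - ε * k i = ε := fun i => by ring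
  simp only [this, Finset.prod_const, Finset.card_univ, Fintype.card_fin]
  rw [ENNReal.ofReal_pow hε.le]

theorem cell_subset_closedBall {ε : ℝ} (hε : 0 < ε) {k : Fin N → ℤ} {x : Eucl N}
    (hx : x ∈ cell ε k) : cell ε k ⊆ Metric.closedBall x (ε * √N) := by
  intro y hy
  rw [mem_closedBall_iff_norm, EuclideanSpace.norm_eq]
  have hle : ∀ i, ‖(y - x) i‖ ^ 2 ≤ ε ^ 2 := by
    intro i
    have h1 := Int.floor_eq_iff.1 (hx i)
    have h2 := Int.floor_eq_iff.1 (hy i)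
    rw [le_div_iff₀ hε, div_lt_iff₀ hε] at h1 h2
    rw [Real.norm_eq_abs]
    refine pow_le_pow_left₀ (abs_nonneg _) ?_ 2
    rw [PiLp.sub_apply, abs_le]
    constructor <;> linarith [h1.1, h1.2, h2.1, h2.2]
  rw [show ε * √N = √(ε ^ 2 * N) by
    rw [Real.sqrt_mul (sq_nonneg ε), Real.sqrt_sq hε.le]]
  refine Real.sqrt_le_sqrt ((Finset.sum_le_sum fun i _ => hle i).trans ?_)
  rw [Finset.sum_const, Finset.card_univ, Fintype.card_fin, nsmul_eq_mul, mul_comm]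

/-- The indices of the cubes of side `ε` that meet the ball of radius `R`. -/
noncomputable def cellIndices (N : ℕ) (ε R : ℝ) : Finset (Fin N → ℤ) :=
  Fintype.piFinset fun _ => Finset.Icc ⌊-R / ε⌋ ⌊R / ε⌋

theorem index_mem_cellIndices {ε R : ℝ} (hε : 0 < ε) {x : Eucl N} (hx : ‖x‖ ≤ R) :
    (fun i => ⌊x i / ε⌋) ∈ cellIndices N ε R := by
  rw [cellIndices, Fintype.mem_piFinset]
  intro i
  have h := (PiLp.norm_apply_le x i).trans hx
  rw [Real.norm_eq_abs, abs_le] at h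
  rw [Finset.mem_Icc]
  exact ⟨Int.floor_le_floor (by gcongr; exact h.1), Int.floor_le_floor (by gcongr; exact h.2)⟩

/-- The mean square distance of a smooth function to its averages on cubes. -/
theorem sq_sub_average_le {φ : Eucl N → ℝ} (hφ : Continuous φ) (hφc : HasCompactSupport φ) {ε : ℝ}
    (hε : 0 < ε) {k : Fin N → ℤ} {x : Eucl N} (hx : x ∈ cell ε k) :
    ENNReal.ofReal ((φ x - (ε ^ N)⁻¹ * ∫ y in cell ε k, φ y) ^ 2) ≤
      ENNReal.ofReal ((ε ^ N)⁻¹) *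
        ∫⁻ h in Metric.closedBall (0 : Eucl N) (ε * √N),
          ENNReal.ofReal ((φ (x + h) - φ x) ^ 2) := by
  have hm : 0 < ε ^ N := by positivity
  have hvol : volume.real (cell ε k) = ε ^ N := by
    rw [measureReal_def, volume_cell hε, ENNReal.toReal_ofReal hm.le]
  have hfin : IsFiniteMeasure (volume.restrict (cell ε k)) :=
    ⟨by rw [Measure.restrict_apply_univ, volume_cell hε]; exact ENNReal.ofReal_lt_top⟩
  have hφi : IntegrableOn φ (cell ε k) := (hφ.integrable_of_hasCompactSupport hφc).integrableOn
  obtain ⟨C, hC⟩ := hφc.exists_bound_of_continuous hφ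
  have hdi : IntegrableOn (fun y => φ y - φ x) (cell ε k) := hφi.sub (integrable_const _)
  have hdi2 : IntegrableOn (fun y => (φ y - φ x) ^ 2) (cell ε k) := by
    refine Integrable.of_bound (C := (C + C) ^ 2)
      ((hφ.sub continuous_const).pow 2).aestronglyMeasurable (Eventually.of_forall fun y => ?_)
    rw [norm_pow]
    exact pow_le_pow_left₀ (norm_nonneg _) ((norm_sub_le _ _).trans (add_le_add (hC y) (hC x))) 2
  have hJ := sq_integral_le hdi hdi2
  rw [measureReal_restrict_apply_univ, hvol, integral_sub hφi (integrable_const _),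
    setIntegral_const, hvol, smul_eq_mul] at hJ
  have hreal : (φ x - (ε ^ N)⁻¹ * ∫ y in cell ε k, φ y) ^ 2 ≤
      (ε ^ N)⁻¹ * ∫ y in cell ε k, (φ y - φ x) ^ 2 := by
    have e : φ x - (ε ^ N)⁻¹ * ∫ y in cell ε k, φ y =
        -((ε ^ N)⁻¹ * ((∫ y in cell ε k, φ y) - ε ^ N * φ x)) := by field_simp; ring
    rw [e, neg_sq, mul_pow]
    calc _ ≤ ((ε ^ N)⁻¹) ^ 2 * (ε ^ N * ∫ y in cell ε k, (φ y - φ x) ^ 2) := by gcongr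
      _ = _ := by field_simp
  refine (ENNReal.ofReal_le_ofReal hreal).trans ?_
  rw [ENNReal.ofReal_mul (by positivity), ofReal_integral_eq_lintegral_ofReal hdi2
    (Eventually.of_forall fun _ => sq_nonneg _)]
  refine mul_le_mul' le_rfl ?_
  -- Enlarging the cube to a ball about `x` and setting `y = x + h` makes the domain of integration
  -- independent of `x` and `k`.
  calc ∫⁻ y in cell ε k, ENNReal.ofReal ((φ y - φ x) ^ 2)
      ≤ ∫⁻ y in Metric.closedBall x (ε * √N), ENNReal.ofReal ((φ y - φ x) ^ 2) :=
        lintegral_mono_set (cell_subset_closedBall hε hx)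
    _ = ∫⁻ y, (Metric.closedBall x (ε * √N)).indicator
          (fun y => ENNReal.ofReal ((φ y - φ x) ^ 2)) y := by
        rw [lintegral_indicator Metric.isClosed_closedBall.measurableSet]
    _ = ∫⁻ h, (Metric.closedBall x (ε * √N)).indicator
          (fun y => ENNReal.ofReal ((φ y - φ x) ^ 2)) (x + h) :=
        (lintegral_add_left_eq_self _ x).symm
    _ = ∫⁻ h, (Metric.closedBall (0 : Eucl N) (ε * √N)).indicator
          (fun h => ENNReal.ofReal ((φ (x + h) - φ x) ^ 2)) h := by
        refine lintegral_congr fun h => ?_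
        by_cases hh : h ∈ Metric.closedBall (0 : Eucl N) (ε * √N)
        · rw [indicator_of_mem hh, indicator_of_mem]
          rw [mem_closedBall_iff_norm, add_sub_cancel_left]
          exact mem_closedBall_zero_iff.1 hh
        · rw [indicator_of_notMem hh, indicator_of_notMem]
          rw [mem_closedBall_iff_norm, add_sub_cancel_left]
          exact fun h' => hh (mem_closedBall_zero_iff.2 h')
    _ = _ := lintegral_indicator Metric.isClosed_closedBall.measurableSet _

/-- After exchanging the integrals, the volume of the ball of radius `ε√N` cancels `ε^(-N)`, and the
translation estimate leaves the factor `ε²`. -/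
theorem lintegral_translates_le {φ : Eucl N → ℝ} (hφ : ContDiff ℝ ∞ φ) {ε : ℝ} (hε : 0 < ε) :
    ENNReal.ofReal ((ε ^ N)⁻¹) * ∫⁻ x : Eucl N, ∫⁻ h in Metric.closedBall (0 : Eucl N) (ε * √N),
        ENNReal.ofReal ((φ (x + h) - φ x) ^ 2) ≤
      ENNReal.ofReal (ε ^ 2 * (N * √N ^ N * volume.real (Metric.ball (0 : Eucl N) 1))) *
        ∫⁻ x, ENNReal.ofReal (‖∇ φ x‖ ^ 2) := by
  have hmeas : Measurable (Function.uncurry fun (x h : Eucl N) =>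
      ENNReal.ofReal ((φ (x + h) - φ x) ^ 2)) := by
    refine ENNReal.measurable_ofReal.comp (Continuous.measurable ?_)
    exact ((hφ.continuous.comp (continuous_fst.add continuous_snd)).sub
      (hφ.continuous.comp continuous_fst)).pow 2
  rw [lintegral_lintegral_swap hmeas.aemeasurable]
  set G := ∫⁻ x, ENNReal.ofReal (‖∇ φ x‖ ^ 2) with hG
  have h1 : ∫⁻ h in Metric.closedBall (0 : Eucl N) (ε * √N), ∫⁻ x,
      ENNReal.ofReal ((φ (x + h) - φ x) ^ 2) ≤
      ∫⁻ _ in Metric.closedBall (0 : Eucl N) (ε * √N), ENNReal.ofReal ((ε * √N) ^ 2) * G := by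
    refine setLIntegral_mono measurable_const fun h hh => ?_
    refine (lintegral_sq_translate_sub_le hφ h).trans ?_
    gcongr
    exact mem_closedBall_zero_iff.1 hh
  rw [setLIntegral_const] at h1
  have hball : volume (Metric.closedBall (0 : Eucl N) (ε * √N)) =
      ENNReal.ofReal ((ε * √N) ^ N * volume.real (Metric.ball (0 : Eucl N) 1)) := by
    rw [Measure.addHaar_closedBall _ _ (by positivity), ENNReal.ofReal_mul (by positivity),
      finrank_euclideanSpace_fin, measureReal_def, ENNReal.ofReal_toReal]
    exact measure_ball_lt_top.ne
  rw [hball] at h1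
  calc _ ≤ ENNReal.ofReal ((ε ^ N)⁻¹) * (ENNReal.ofReal ((ε * √N) ^ 2) * G *
        ENNReal.ofReal ((ε * √N) ^ N * volume.real (Metric.ball (0 : Eucl N) 1))) := by gcongr
    _ = (ENNReal.ofReal ((ε ^ N)⁻¹) * ENNReal.ofReal ((ε * √N) ^ 2) *
        ENNReal.ofReal ((ε * √N) ^ N * volume.real (Metric.ball (0 : Eucl N) 1))) * G := by ring
    _ = _ := by
      rw [← ENNReal.ofReal_mul (by positivity), ← ENNReal.ofReal_mul (by positivity)]
      congr 2
      rw [mul_pow, mul_pow, Real.sq_sqrt (by positivity)]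
      field_simp

end Cells

/-! ### The compact imbedding of `H¹₀(Ω)` in `L²(Ω)`. -/

section Rellich

variable {N : ℕ} {Ω : Set (Eucl N)}

/-- The indicator function of a cube, in `L²(Ω)`. -/
noncomputable def cellIndicator (Ω : Set (Eucl N)) {ε : ℝ} (hε : 0 < ε) (k : Fin N → ℤ) : L2 Ω :=
  indicatorConstLp 2 (measurableSet_cell hε k)
    (((Measure.restrict_apply_le _ _).trans_lt
      (by rw [volume_cell hε]; exact ENNReal.ofReal_lt_top)).ne) (1 : ℝ)

/-- The averaging operator on cubes of side `ε`. -/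
noncomputable def cellAverage (Ω : Set (Eucl N)) {ε : ℝ} (hε : 0 < ε) (R : ℝ) : L2 Ω →L[ℝ] L2 Ω :=
  ∑ k ∈ cellIndices N ε R,
    ((ε ^ N)⁻¹ • innerSL ℝ (cellIndicator Ω hε k)).smulRight (cellIndicator Ω hε k)

theorem isCompactOperator_cellAverage {ε : ℝ} (hε : 0 < ε) (R : ℝ) :
    IsCompactOperator (cellAverage Ω hε R) := by
  have : cellAverage Ω hε R ∈ compactOperator (RingHom.id ℝ) (L2 Ω) (L2 Ω) := by
    -- Each summand has rank at most one.
    refine Submodule.sum_mem _ fun k _ => ?_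
    change IsCompactOperator _
    have h := isCompactOperator_of_locallyCompactSpace_rng
      (ContinuousLinearMap.toSpanSingleton ℝ (cellIndicator Ω hε k))
    exact h.comp_clm ((ε ^ N)⁻¹ • innerSL ℝ (cellIndicator Ω hε k))
  exact this

theorem cellAverage_ae_eq {ε : ℝ} (hε : 0 < ε) (R : ℝ) (f : L2 Ω) :
    cellAverage Ω hε R f =ᵐ[volume.restrict Ω] fun x => ∑ k ∈ cellIndices N ε R,
      (cell ε k).indicator (fun _ => (ε ^ N)⁻¹ * ∫ y in cell ε k, f y ∂(volume.restrict Ω)) x := by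
  have h1 : cellAverage Ω hε R f = ∑ k ∈ cellIndices N ε R,
      ((ε ^ N)⁻¹ * ∫ y in cell ε k, f y ∂(volume.restrict Ω)) • cellIndicator Ω hε k := by
    rw [cellAverage, sum_apply]
    refine Finset.sum_congr rfl fun k _ => ?_
    rw [ContinuousLinearMap.smulRight_apply, smul_apply, innerSL_apply_apply, smul_eq_mul,
      cellIndicator, L2.inner_indicatorConstLp_one]
  rw [h1]
  have h2 : ∀ s : Finset (Fin N → ℤ), ((∑ k ∈ s, ((ε ^ N)⁻¹ * ∫ y in cell ε k, f y
      ∂(volume.restrict Ω)) • cellIndicator Ω hε k : L2 Ω) : Eucl N → ℝ) =ᵐ[volume.restrict Ω]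
      fun x => ∑ k ∈ s, (cell ε k).indicator
        (fun _ => (ε ^ N)⁻¹ * ∫ y in cell ε k, f y ∂(volume.restrict Ω)) x := by
    intro s
    induction s using Finset.cons_induction with
    | empty =>
      simp only [Finset.sum_empty]
      exact Lp.coeFn_zero ℝ 2 _
    | cons a s ha ih =>
      simp only [Finset.sum_cons]
      filter_upwards [ih, Lp.coeFn_add (((ε ^ N)⁻¹ * ∫ y in cell ε a, f y
        ∂(volume.restrict Ω)) • cellIndicator Ω hε a) (∑ k ∈ s, ((ε ^ N)⁻¹ * ∫ y in cell ε k, f y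
        ∂(volume.restrict Ω)) • cellIndicator Ω hε k),
        Lp.coeFn_smul ((ε ^ N)⁻¹ * ∫ y in cell ε a, f y ∂(volume.restrict Ω))
          (cellIndicator Ω hε a), indicatorConstLp_coeFn (p := 2) (hs := measurableSet_cell hε a)
          (hμs := ((Measure.restrict_apply_le _ _).trans_lt
            (by rw [volume_cell hε]; exact ENNReal.ofReal_lt_top :
              volume (cell ε a) < ⊤)).ne) (μ := volume.restrict Ω) (c := (1 : ℝ))]
        with x e1 e2 e3 e4
      rw [e2, Pi.add_apply, e1, e3, Pi.smul_apply, cellIndicator, e4]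
      congr 1
      by_cases hx : x ∈ cell ε a
      · simp [hx]
      · simp [hx]
  exact h2 _

/-- The rate in `ε` is uniform on bounded sets of `H¹₀(Ω)`, so the finite-rank averages converge in
operator norm and compactness follows. By density only test functions matter; each point of `Ω` lies
in exactly one cube. -/
theorem norm_sub_cellAverage_le (hΩ : IsOpen Ω) {R : ℝ} (hR : Ω ⊆ Metric.closedBall 0 R) {ε : ℝ}
    (hε : 0 < ε) (x : H10 Ω) :
    ‖toL2 Ω x - cellAverage Ω hε R (toL2 Ω x)‖ ≤
      ε * √(N * √N ^ N * volume.real (Metric.ball (0 : Eucl N) 1)) * ‖grad Ω x‖ := by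
  set C : ℝ := N * √N ^ N * volume.real (Metric.ball (0 : Eucl N) 1) with hC
  have hC0 : 0 ≤ C := by positivity
  refine H10.induction (p := fun f g => ‖f - cellAverage Ω hε R f‖ ≤ ε * √C * ‖g‖) ?_ ?_ x
  · exact isClosed_le (continuous_withLp_fst.sub
      ((cellAverage Ω hε R).continuous.comp continuous_withLp_fst)).norm
      (continuous_const.mul continuous_withLp_snd.norm)
  rintro q ⟨φ, hφ, hφc, hφs, hq1, hq2⟩
  have hφ0 : ∀ y ∉ Ω, φ y = 0 := fun y hy => by
    by_contra h0
    exact hy (hφs (subset_tsupport _ h0))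
  have hint : ∀ k : Fin N → ℤ, ∫ y in cell ε k, q.fst y ∂(volume.restrict Ω) =
      ∫ y in cell ε k, φ y := by
    intro k
    rw [integral_congr_ae (ae_restrict_of_ae hq1),
      Measure.restrict_restrict (measurableSet_cell hε k)]
    exact (setIntegral_eq_of_subset_of_forall_sdiff_eq_zero (measurableSet_cell hε k)
      inter_subset_left fun y hy => hφ0 y fun hyΩ => hy.2 ⟨hy.1, hyΩ⟩).symm
  have key : ENNReal.ofReal (‖q.fst - cellAverage Ω hε R q.fst‖ ^ 2) ≤
      ENNReal.ofReal ((ε * √C * ‖q.snd‖) ^ 2) := by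
    have e2 : ∫⁻ x in Ω, ENNReal.ofReal (‖q.snd x‖ ^ 2) =
        ∫⁻ x, ENNReal.ofReal (‖∇ φ x‖ ^ 2) := by
      rw [← setLIntegral_gradient_eq hφs hΩ.measurableSet]
      refine lintegral_congr_ae ?_
      filter_upwards [hq2] with x hx
      rw [hx]
    rw [mul_pow, mul_pow, Real.sq_sqrt hC0, ENNReal.ofReal_mul (by positivity),
      ofReal_norm_sq_eq_lintegral, ofReal_norm_sq_eq_lintegral, e2]
    refine le_trans ?_ (lintegral_translates_le hφ hε)
    rw [← lintegral_const_mul' _ _ ENNReal.ofReal_ne_top]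
    refine le_trans ?_ (setLIntegral_le_lintegral Ω _)
    refine lintegral_mono_ae ?_
    filter_upwards [Lp.coeFn_sub q.fst (cellAverage Ω hε R q.fst), cellAverage_ae_eq hε R q.fst,
      hq1, ae_restrict_mem hΩ.measurableSet] with x g1 g2 g3 hxΩ
    set k : Fin N → ℤ := fun i => ⌊x i / ε⌋ with hk
    have hxk : x ∈ cell ε k := fun i => rfl
    have hkm : k ∈ cellIndices N ε R :=
      index_mem_cellIndices hε (mem_closedBall_zero_iff.1 (hR hxΩ))
    have hsum : ∑ j ∈ cellIndices N ε R, (cell ε j).indicator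
        (fun _ => (ε ^ N)⁻¹ * ∫ y in cell ε j, q.fst y ∂(volume.restrict Ω)) x =
        (ε ^ N)⁻¹ * ∫ y in cell ε k, φ y := by
      rw [Finset.sum_eq_single k]
      · rw [indicator_of_mem hxk, hint]
      · intro j _ hjk
        refine indicator_of_notMem (fun hxj => hjk ?_) _
        funext i
        exact (hxj i).symm
      · exact fun h => absurd hkm h
    rw [g1, Pi.sub_apply, g2, hsum, g3, Real.norm_eq_abs, sq_abs]
    exact sq_sub_average_le hφ.continuous hφc hε hxk
  rw [ENNReal.ofReal_le_ofReal_iff (sq_nonneg _)] at key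
  exact le_of_sq_le_sq key (by positivity)

theorem norm_grad_le (x : H10 Ω) : ‖grad Ω x‖ ≤ ‖x‖ := by
  have : ‖grad Ω x‖ ^ 2 ≤ ‖x‖ ^ 2 := by
    have h : ‖x‖ ^ 2 = ‖toL2 Ω x‖ ^ 2 + ‖grad Ω x‖ ^ 2 :=
      WithLp.prod_norm_sq_eq_of_L2 (inclH10 Ω x)
    rw [h]
    exact le_add_of_nonneg_left (sq_nonneg _)
  exact le_of_sq_le_sq this (norm_nonneg _)

/-- The Rellich theorem: the imbedding of `H¹₀(Ω)` in `L²(Ω)` is compact. -/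
theorem isCompactOperator_toL2 (hΩ : IsOpen Ω) (hΩb : Bornology.IsBounded Ω) :
    IsCompactOperator (toL2 Ω) := by
  obtain ⟨R, hR⟩ := hΩb.subset_closedBall 0
  set C : ℝ := √(N * √N ^ N * volume.real (Metric.ball (0 : Eucl N) 1)) with hC
  have hpos : ∀ n : ℕ, 0 < 1 / ((n : ℝ) + 1) := fun n => by positivity
  refine isCompactOperator_of_tendsto (l := atTop)
    (F := fun n : ℕ => (cellAverage Ω (hpos n) R).comp (toL2 Ω)) ?_
    (Eventually.of_forall fun n => (isCompactOperator_cellAverage (hpos n) R).comp_clm _)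
  rw [tendsto_iff_norm_sub_tendsto_zero]
  have hlim : Tendsto (fun n : ℕ => 1 / ((n : ℝ) + 1) * C) atTop (𝓝 0) := by
    simpa using tendsto_one_div_add_atTop_nhds_zero_nat.mul_const C
  refine squeeze_zero (fun _ => norm_nonneg _) (fun n => ?_) hlim
  refine ContinuousLinearMap.opNorm_le_bound _ (by positivity) fun x => ?_
  rw [sub_apply, ContinuousLinearMap.comp_apply, norm_sub_rev]
  refine (norm_sub_cellAverage_le hΩ hR (hpos n) x).trans ?_
  gcongr
  exact norm_grad_le x

end Rellich

/-! ### The top eigenvalue of `A† A` for compact `A`. -/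

section Compact

open ContinuousLinearMap Module.End

variable {E F : Type*} [NormedAddCommGroup E] [InnerProductSpace ℝ E] [CompleteSpace E]
  [NormedAddCommGroup F] [InnerProductSpace ℝ F] [CompleteSpace F]

/-- The square of the norm of a nonzero compact operator `A` is an eigenvalue of `A† A`. -/
theorem hasEigenvalue_adjoint_comp_self {A : E →L[ℝ] F} (hA : IsCompactOperator A) (h0 : A ≠ 0) :
    HasEigenvalue ((adjoint A ∘L A : E →L[ℝ] E) : Module.End ℝ E) (‖A‖ ^ 2) := by
  have hτ : 0 < ‖A‖ ^ 2 := by positivity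
  set τ := ‖A‖ ^ 2 with hτA
  set T : E →L[ℝ] E := adjoint A ∘L A with hT
  have hTn : ‖T‖ = τ := by rw [hT, norm_adjoint_comp_self, hτA, sq]
  by_contra hne
  -- If `τ` is not an eigenvalue, `T - τ` is bounded below. Together with `h5` this improves `‖A x‖²
  -- ≤ τ‖x‖²` to a constant `θ < τ`, contradicting `τ = ‖A‖²`.
  obtain ⟨K, hK⟩ := (hA.clm_comp (adjoint A)).antilipschitz_of_not_hasEigenvalue
    (T := T) hτ.ne' hne
  have hKpos : (0 : ℝ) < K + 1 := by positivity
  set θ : ℝ := max (τ - 1 / (2 * τ * (K + 1) ^ 2)) 0 with hθ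
  have hθτ : θ < τ := max_lt (sub_lt_self _ (by positivity)) hτ
  have hbd : ∀ x, ‖A x‖ ^ 2 ≤ θ * ‖x‖ ^ 2 := by
    intro x
    have h1 : ‖x‖ ≤ (K + 1) * ‖T x - τ • x‖ := by
      have := ZeroHomClass.bound_of_antilipschitz _ hK x
      change ‖x‖ ≤ K * ‖T x - τ • x‖ at this
      nlinarith [norm_nonneg (T x - τ • x)]
    have h2 : ‖x‖ ^ 2 ≤ (K + 1) ^ 2 * ‖T x - τ • x‖ ^ 2 := by
      rw [← mul_pow]
      exact pow_le_pow_left₀ (norm_nonneg _) h1 2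
    have h3 : ⟪T x, x⟫ = ‖A x‖ ^ 2 := by
      rw [hT, comp_apply, adjoint_inner_left, real_inner_self_eq_norm_sq]
    have h4 : ‖T x‖ ^ 2 ≤ τ ^ 2 * ‖x‖ ^ 2 := by
      rw [← mul_pow, ← hTn]
      exact pow_le_pow_left₀ (norm_nonneg _) (T.le_opNorm x) 2
    have h5 : ‖T x - τ • x‖ ^ 2 ≤ 2 * τ * (τ * ‖x‖ ^ 2 - ‖A x‖ ^ 2) := by
      rw [norm_sub_sq_real, real_inner_smul_right, h3, norm_smul, mul_pow, Real.norm_eq_abs, sq_abs]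
      linarith
    have h6 : ‖x‖ ^ 2 ≤ (2 * τ * (K + 1) ^ 2) * (τ * ‖x‖ ^ 2 - ‖A x‖ ^ 2) :=
      h2.trans ((mul_le_mul_of_nonneg_left h5 (sq_nonneg _)).trans_eq (by ring))
    have h7 : ‖x‖ ^ 2 / (2 * τ * (K + 1) ^ 2) ≤ τ * ‖x‖ ^ 2 - ‖A x‖ ^ 2 := by
      rw [div_le_iff₀ (by positivity), mul_comm]
      exact h6
    calc ‖A x‖ ^ 2 ≤ (τ - 1 / (2 * τ * (K + 1) ^ 2)) * ‖x‖ ^ 2 := by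
          rw [sub_mul, one_div_mul_eq_div]
          linarith
      _ ≤ θ * ‖x‖ ^ 2 := by gcongr; exact le_max_left _ _
  have hA' : ‖A‖ ≤ √θ := A.opNorm_le_bound (Real.sqrt_nonneg _) fun x => by
    rw [← Real.sqrt_sq (norm_nonneg x), ← Real.sqrt_mul (le_max_right _ _)]
    exact Real.le_sqrt_of_sq_le (hbd x)
  have : τ ≤ θ := by
    have := pow_le_pow_left₀ (norm_nonneg _) hA' 2
    rwa [Real.sq_sqrt (le_max_right _ _)] at this
  exact absurd this (not_le.2 hθτ)

end Compact

/-! ### Coercivity below the first Dirichlet eigenvalue. -/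

section FirstEigenvalue

variable {N : ℕ} {Ω : Set (Eucl N)}

theorem inner_H10 (x y : H10 Ω) :
    ⟪x, y⟫ = ⟪toL2 Ω x, toL2 Ω y⟫ + ⟪grad Ω x, grad Ω y⟫ :=
  WithLp.prod_inner_apply (inclH10 Ω x) (inclH10 Ω y)

/-- Provides the lower bound without which the infimum defining `firstEigenvalue` could not be
compared with an eigenvalue. -/
theorem IsDirichletEigenvalue.nonneg {κ : ℝ} (h : IsDirichletEigenvalue Ω κ) : 0 ≤ κ := by
  obtain ⟨v, hv, h⟩ := h
  have h1 := h v
  rw [real_inner_self_eq_norm_sq, real_inner_self_eq_norm_sq] at h1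
  by_contra! hκ
  have h2 : ‖v‖ ^ 2 = ‖toL2 Ω v‖ ^ 2 + ‖grad Ω v‖ ^ 2 := by
    rw [← real_inner_self_eq_norm_sq, inner_H10, real_inner_self_eq_norm_sq,
      real_inner_self_eq_norm_sq]
  have h3 : ‖grad Ω v‖ ^ 2 = 0 := le_antisymm
    (h1.trans_le (mul_nonpos_of_nonpos_of_nonneg hκ.le (sq_nonneg _))) (sq_nonneg _)
  have h4 : ‖toL2 Ω v‖ ^ 2 = 0 := by
    rw [h3] at h1
    exact (mul_eq_zero.1 h1.symm).resolve_left hκ.ne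
  rw [h3, h4, add_zero] at h2
  exact hv (norm_eq_zero.1 (pow_eq_zero_iff two_ne_zero |>.1 h2))

/-- The variational characterization of the first eigenvalue of the Dirichlet Laplacian. -/
theorem firstEigenvalue_mul_sq_norm_le (hΩ : IsOpen Ω) (hΩb : Bornology.IsBounded Ω) (x : H10 Ω) :
    firstEigenvalue Ω * ‖toL2 Ω x‖ ^ 2 ≤ ‖grad Ω x‖ ^ 2 := by
  by_cases h0 : toL2 Ω = 0
  · rw [h0, zero_apply, norm_zero, zero_pow two_ne_zero, mul_zero]
    exact sq_nonneg _
  obtain ⟨v, hv⟩ := (hasEigenvalue_adjoint_comp_self (isCompactOperator_toL2 hΩ hΩb)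
    h0).exists_hasEigenvector
  have hτ : 0 < ‖toL2 Ω‖ ^ 2 := by positivity
  have hτx : ‖toL2 Ω x‖ ^ 2 ≤ ‖toL2 Ω‖ ^ 2 * ‖x‖ ^ 2 := by
    rw [← mul_pow]
    exact pow_le_pow_left₀ (norm_nonneg _) ((toL2 Ω).le_opNorm x) 2
  set τ := ‖toL2 Ω‖ ^ 2
  -- In the full `H¹` inner product, the eigenvector equation reads `⟪v, w⟫ = τ (⟪v, w⟫ + ⟪∇v,
  -- ∇w⟫)`, that is, `-Δv = ((1 - τ)/τ) v`. Since `τ` is the squared norm of the imbedding, `hτx` is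
  -- the inequality with this same constant.
  have hκ : IsDirichletEigenvalue Ω ((1 - τ) / τ) := by
    refine ⟨v, hv.2, fun w => ?_⟩
    have h1 : (ContinuousLinearMap.adjoint (toL2 Ω)) (toL2 Ω v) = τ • v := hv.apply_eq_smul
    have h2 : ⟪toL2 Ω v, toL2 Ω w⟫ = τ * (⟪toL2 Ω v, toL2 Ω w⟫ + ⟪grad Ω v, grad Ω w⟫) := by
      rw [← inner_H10, ← real_inner_smul_left, ← h1, ContinuousLinearMap.adjoint_inner_left]
    rw [div_mul_eq_mul_div, eq_div_iff hτ.ne']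
    linarith
  have hle : firstEigenvalue Ω ≤ (1 - τ) / τ :=
    csInf_le ⟨0, fun κ h => IsDirichletEigenvalue.nonneg h⟩ hκ
  have hx : ‖x‖ ^ 2 = ‖toL2 Ω x‖ ^ 2 + ‖grad Ω x‖ ^ 2 := by
    rw [← real_inner_self_eq_norm_sq, inner_H10, real_inner_self_eq_norm_sq,
      real_inner_self_eq_norm_sq]
  refine (mul_le_mul_of_nonneg_right hle (sq_nonneg _)).trans ?_
  rw [div_mul_eq_mul_div, div_le_iff₀ hτ]
  rw [hx] at hτx
  linarith

theorem exists_coercive_of_lt_firstEigenvalue (hΩ : IsOpen Ω) (hΩb : Bornology.IsBounded Ω)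
    {lam : ℝ} (hlam : lam < firstEigenvalue Ω) :
    ∃ δ : ℝ, 0 < δ ∧
      ∀ x : H10 Ω, δ * ‖grad Ω x‖ ^ 2 ≤ ‖grad Ω x‖ ^ 2 - lam * ‖toL2 Ω x‖ ^ 2 := by
  -- Were there no eigenvalue, the infimum would be `0` by convention and `lam < 0`, so the first
  -- case also covers that situation.
  rcases le_or_gt lam 0 with h | h
  · refine ⟨1, one_pos, fun x => ?_⟩
    have := mul_nonpos_of_nonpos_of_nonneg h (sq_nonneg ‖toL2 Ω x‖)
    linarith
  · have hpos := h.trans hlam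
    refine ⟨1 - lam / firstEigenvalue Ω, sub_pos.2 ((div_lt_one hpos).2 hlam), fun x => ?_⟩
    have h1 := mul_le_mul_of_nonneg_left (firstEigenvalue_mul_sq_norm_le hΩ hΩb x)
      (div_pos h hpos).le
    rw [← mul_assoc, div_mul_cancel₀ _ hpos.ne'] at h1
    linarith

end FirstEigenvalue

end Kirchhoff

theorem proposition4p3 (N : ℕ) (hN : 1 ≤ N) (Ω : Set (Kirchhoff.Eucl N)) (hΩ : IsOpen Ω)
    (hΩb : Bornology.IsBounded Ω) (α β b c lam mu : ℝ) (hα : 0 < α) (hαβ : α < β)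
    (hb : 0 < b) (hc : 0 < c) :
    (∀ M : ℝ, ∃ Γ Γs : ℝ, ∀ T : ℝ, 0 < T → ∀ h : ℝ → Kirchhoff.L2 Ω,
      MemLp h ⊤ (volume.restrict (Ioo 0 T)) →
      (∀ᵐ t ∂(volume.restrict (Ioo 0 T)), ‖h t‖ ≤ M) →
      ∀ u : ℝ → Kirchhoff.H10 Ω,
        Kirchhoff.IsWeakSolution Ω α β b c lam mu (Ioo 0 T) h u →
        ∀ t ∈ Ioo 0 T,
          ‖Kirchhoff.velocity u t‖ ^ 2 + ‖Kirchhoff.grad Ω (u t)‖ ^ (β + 2)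
            ≤ Γ * t ^ (-(1 / min (α / 2) ((β - α) / ((α + 1) * (β + 2))))) + Γs) ∧
    (lam < Kirchhoff.firstEigenvalue Ω →
      ∃ D : ℝ, ∀ u : ℝ → Kirchhoff.H10 Ω,
        Kirchhoff.IsWeakSolution Ω α β b c lam 0 (Ioi 0) (fun _ => 0) u →
        ∀ t : ℝ, 1 ≤ t →
          ‖Kirchhoff.velocity u t‖ ^ 2 + ‖Kirchhoff.grad Ω (u t)‖ ^ 2
            ≤ D * t ^ (-(2 / α))) := by
  obtain ⟨C, hC, hpoinc⟩ := Kirchhoff.exists_poincare hN hΩ hΩb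
  refine ⟨fun M => Kirchhoff.exists_universal_bound hα hαβ hb hc hC hpoinc M, fun hlam => ?_⟩
  obtain ⟨δ, hδ, hcoer⟩ := Kirchhoff.exists_coercive_of_lt_firstEigenvalue hΩ hΩb hlam
  exact Kirchhoff.exists_decay hα hαβ hb hc hC hpoinc hδ hcoer
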